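/- Graphs are finite and simple. For a graph $G$, a set $X\subseteq V(G)$ and an integer $r\ge 0$, let $B_G(X,r)$ be the set of vertices of $G$ at distance at most $r$ in $G$ from some vertex of $X$, and let $G-A$ be the graph obtained from $G$ by deleting the vertices of $A\subseteq V(G)$. For a positive integer $d$, a distance-$d$ packing of two cycles in $G$ is a pair of distinct cycles of $G$ such that $G$ has no path of length at most $d$ (a single vertex being a path of length $0$) between them. Theorem. There is an algorithm which, given a positive integer $d$ and a graph $G$, finds one of the following: 1. a distance-$d$ packing of two cycles in $G$; 2. sets $X_1,X_2\subseteq V(G)$ with $|X_1|\le 12(d+1)$ and $|X_2|\le 12$ such that both $G-B_G(X_1,2d)$ and $G-B_G(X_2,3d)$ are forests. The algorithm is a single program, the same for all $d$ and $G$, for a random access machine whose arithmetic operations are addition and truncated subtraction of natural numbers, each at unit cost. Its input is the number $|V(G)|$, the integer $d$ and the adjacency matrix of $G$, and its number of elementary steps is bounded by a polynomial in $|V(G)|$ that does not depend on $d$. -/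

import Mathlib

/-! ### Cycles, packings, balls, forests -/

namespace CyclePacking

section Graphs

variable {V : Type*} (G : SimpleGraph V)

/-- A subgraph of `G` that is a cycle. -/
def IsCycleSubgraph (H : G.Subgraph) : Prop :=
  ∃ (v : V) (c : G.Walk v v), c.IsCycle ∧ c.toSubgraph = H

/-- A set `F` of cycles of `G` is a distance-`d` packing if `G` has no path of length at most `d`
between any two distinct cycles of `F` (a path of length `0` is a single vertex). -/
def IsDistancePacking (d : ℕ) (F : Set G.Subgraph) : Prop :=
  (∀ C ∈ F, IsCycleSubgraph G C) ∧
    ∀ C ∈ F, ∀ D ∈ F, C ≠ D →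
      ¬ ∃ u ∈ C.verts, ∃ v ∈ D.verts, ∃ q : G.Walk u v, q.IsPath ∧ q.length ≤ d

/-- `B_G(X, r)`: the vertices at distance at most `r` from some vertex of `X`. -/
def ball (X : Set V) (r : ℕ) : Set V :=
  {u | ∃ v ∈ X, G.edist u v ≤ (r : ℕ∞)}

/-- `G - A` is a forest. -/
def IsForestOutside (A : Set V) : Prop :=
  (G.induce Aᶜ).IsAcyclic

end Graphs

/-! ### A random access machine with a step count

A program has finitely many scalar variables and two-dimensional arrays, all holding natural
numbers. Variables and arrays are named by literals, array positions are computed. The arithmetic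
is addition and truncated subtraction only (no multiplication), so that `t` steps produce numbers
of `O(t)` more bits than those of the input, and time on this machine is polynomially related to
time on a Turing machine. -/

/-- Memory contents: `var x` is the value of variable `x`, and `arr a i j` is the entry of the
array `a` at position `(i, j)`. -/
@[ext]
structure Store where
  var : ℕ → ℕ
  arr : ℕ → ℕ → ℕ → ℕ

namespace Store

def setVar (σ : Store) (x k : ℕ) : Store :=
  { σ with var := fun y => if y = x then k else σ.var y }

def setArr (σ : Store) (a i j k : ℕ) : Store :=
  { σ with arr := fun b i' j' => if b = a ∧ i' = i ∧ j' = j then k else σ.arr b i' j' }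

end Store

inductive Expr where
  | lit (k : ℕ)
  | var (x : ℕ)
  | arr (a : ℕ) (i j : Expr)
  | add (e f : Expr)
  | sub (e f : Expr)

namespace Expr

def eval (σ : Store) : Expr → ℕ
  | lit k => k
  | var x => σ.var x
  | arr a i j => σ.arr a (i.eval σ) (j.eval σ)
  | add e f => e.eval σ + f.eval σ
  | sub e f => e.eval σ - f.eval σ

/-- The number of elementary operations that an evaluation of the expression takes. -/
def cost : Expr → ℕ
  | lit _ => 1
  | var _ => 1
  | arr _ i j => i.cost + j.cost + 1
  | add e f => e.cost + f.cost + 1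
  | sub e f => e.cost + f.cost + 1

end Expr

inductive Prog where
  | skip
  | setVar (x : ℕ) (e : Expr)
  | setArr (a : ℕ) (i j e : Expr)
  | seq (P Q : Prog)
  /-- run `P` if `e ≠ 0`, and `Q` otherwise -/
  | cond (e : Expr) (P Q : Prog)
  /-- run `P` as long as `e ≠ 0` -/
  | loop (e : Expr) (P : Prog)

/-- `Runs P σ τ t`: started with memory `σ`, the program `P` halts with memory `τ` after exactly
`t` elementary steps. -/
inductive Runs : Prog → Store → Store → ℕ → Prop
  | skip (σ : Store) : Runs .skip σ σ 1
  | setVar (x : ℕ) (e : Expr) (σ : Store) :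
      Runs (.setVar x e) σ (σ.setVar x (e.eval σ)) (e.cost + 1)
  | setArr (a : ℕ) (i j e : Expr) (σ : Store) :
      Runs (.setArr a i j e) σ (σ.setArr a (i.eval σ) (j.eval σ) (e.eval σ))
        (i.cost + j.cost + e.cost + 1)
  | seq {P Q : Prog} {σ σ' σ'' : Store} {s t : ℕ} :
      Runs P σ σ' s → Runs Q σ' σ'' t → Runs (.seq P Q) σ σ'' (s + t)
  | cond_true {e : Expr} {P Q : Prog} {σ σ' : Store} {t : ℕ} :
      e.eval σ ≠ 0 → Runs P σ σ' t → Runs (.cond e P Q) σ σ' (e.cost + 1 + t)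
  | cond_false {e : Expr} {P Q : Prog} {σ σ' : Store} {t : ℕ} :
      e.eval σ = 0 → Runs Q σ σ' t → Runs (.cond e P Q) σ σ' (e.cost + 1 + t)
  | loop_done {e : Expr} {P : Prog} {σ : Store} :
      e.eval σ = 0 → Runs (.loop e P) σ σ (e.cost + 1)
  | loop_step {e : Expr} {P : Prog} {σ σ' σ'' : Store} {s t : ℕ} :
      e.eval σ ≠ 0 → Runs P σ σ' s → Runs (.loop e P) σ' σ'' t →
        Runs (.loop e P) σ σ'' (e.cost + 1 + s + t)

/-! ### Input and output -/

open Classical in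
/-- The input: variable `0` holds the number `n` of vertices, variable `1` holds `d`, array `0`
holds the adjacency matrix of the graph, and everything else is `0`. -/
noncomputable def inputStore {n : ℕ} (G : SimpleGraph (Fin n)) (d : ℕ) : Store where
  var x := if x = 0 then n else if x = 1 then d else 0
  arr a i j := if a = 0 ∧ ∃ (hi : i < n) (hj : j < n), G.Adj ⟨i, hi⟩ ⟨j, hj⟩ then 1 else 0

/-- The first `ℓ` entries of column `0` of the array `a` are the vertices of the list `l`, and
`l` has length `ℓ`. -/
def Store.HoldsList {n : ℕ} (τ : Store) (a ℓ : ℕ) (l : List (Fin n)) : Prop :=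
  l.map (fun v => (v : ℕ)) = (List.range ℓ).map fun i => τ.arr a i 0

/-- Column `0` of the array `a` is an indicator of the vertex set `X`. -/
def Store.HoldsSet {n : ℕ} (τ : Store) (a : ℕ) (X : Finset (Fin n)) : Prop :=
  ∀ v : Fin n, v ∈ X ↔ τ.arr a v 0 ≠ 0

/-- An output: two sequences of vertices, or two sets of vertices. -/
inductive Answer (n : ℕ) where
  | cycles (l₁ l₂ : List (Fin n))
  | sets (X₁ X₂ : Finset (Fin n))

/-- Variable `0` tells which kind of answer is given. Two sequences are read from the arrays `1`
and `2`, with their lengths in the variables `1` and `2`; two sets are read from the arrays `1`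
and `2`. -/
def Store.Outputs {n : ℕ} (τ : Store) : Answer n → Prop
  | .cycles l₁ l₂ => τ.var 0 = 0 ∧ τ.HoldsList 1 (τ.var 1) l₁ ∧ τ.HoldsList 2 (τ.var 2) l₂
  | .sets X₁ X₂ => τ.var 0 ≠ 0 ∧ τ.HoldsSet 1 X₁ ∧ τ.HoldsSet 2 X₂

/-- The answer is correct: the two sequences traverse two cycles (first and last vertex equal)
that form a distance-`d` packing of two cycles, or the two sets have the required sizes and leave
a forest when the balls of radius `2 * d` and `3 * d` around them are deleted. -/
def IsCorrect {n : ℕ} (G : SimpleGraph (Fin n)) (d : ℕ) : Answer n → Prop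
  | .cycles l₁ l₂ =>
      ∃ (u v : Fin n) (c₁ : G.Walk u u) (c₂ : G.Walk v v),
        c₁.IsCycle ∧ c₂.IsCycle ∧ c₁.support = l₁ ∧ c₂.support = l₂ ∧
          c₁.toSubgraph ≠ c₂.toSubgraph ∧
          IsDistancePacking G d {c₁.toSubgraph, c₂.toSubgraph}
  | .sets X₁ X₂ =>
      X₁.card ≤ 12 * (d + 1) ∧ X₂.card ≤ 12 ∧
        IsForestOutside G (ball G (X₁ : Set (Fin n)) (2 * d)) ∧
        IsForestOutside G (ball G (X₂ : Set (Fin n)) (3 * d))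

end CyclePacking

/-!
Let `C` be a shortest cycle, of length `g`. If `G - B(C, d)` contains a cycle, then this cycle and
`C` form a packing. Otherwise `F = G - B(C, d)` is a forest, so that every cycle meets `B(C, d)`.
If `g ≤ 12 * (2 * d + 1)`, twelve evenly spaced vertices of `C` have `B(C, d)` in the balls of
radius `2 * d` around them.

If `g` is larger, every cycle that avoids a fixed vertex `c` of `C` leaves `B(C, 2 * d)`, and hence
contains an *ear*: a path outside `B(C, 2 * d)`, extended by shortest paths from its ends to `C`.
Root `F`, and choose ears greedily, each time one whose vertex of least depth (its top) is deepest
among the ears not yet hit. The balls around the top of an ear and around the arcs of `C` at its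
attachments hit all later ears that come close to it. So after three ears either all cycles are
hit, by `c`, three tops and six arcs, or there are four ears that are pairwise far apart. Two of
them whose attachments do not cross give two far cycles, each consisting of an ear and an arc
of `C`; if all attachments cross, two disjoint pairs of ears do, each with two arcs of `C`.

These arcs and cycles are unions of a bounded number of geodesics of `G` and of `F`. The program
therefore tries all 14-tuples of vertices as descriptions of a packing, and then all 24-tuples and
12-tuples as descriptions of hitting sets. It is written in a small language of terms with bounded
sums and commands with bounded loops, in which every program runs in polynomial time.
-/

namespace CyclePacking

open SimpleGraph

/-! ### Cores and geodesics -/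

section Cores

variable {V : Type*} {G : SimpleGraph V}

/-- The graph on the same vertices that keeps the edges of `G` inside `S`. Unlike `G.induce S` it
does not change the vertex type. -/
def restrict (G : SimpleGraph V) (S : Set V) : SimpleGraph V where
  Adj u v := G.Adj u v ∧ u ∈ S ∧ v ∈ S
  symm := ⟨fun _ _ h => ⟨h.1.symm, h.2.2, h.2.1⟩⟩
  loopless := ⟨fun _ h => G.loopless.irrefl _ h.1⟩

lemma restrict_le (S : Set V) : restrict G S ≤ G := fun _ _ h => h.1

lemma restrict_mono {S T : Set V} (h : S ⊆ T) : restrict G S ≤ restrict G T :=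
  fun _ _ ha => ⟨ha.1, h ha.2.1, h ha.2.2⟩

lemma isAcyclic_restrict_compl_mono {A B : Set V} (h : A ⊆ B)
    (hA : (restrict G Aᶜ).IsAcyclic) : (restrict G Bᶜ).IsAcyclic :=
  hA.anti (restrict_mono (Set.compl_subset_compl.mpr h))

lemma mem_of_mem_support_restrict {S : Set V} {u v : V} (p : (restrict G S).Walk u v)
    (hu : u ∈ S) : ∀ x ∈ p.support, x ∈ S := by
  induction p with
  | nil => simpa using hu
  | cons h p ih => simpa [hu] using ih h.2.2

lemma exists_walk_restrict {S : Set V} {u v : V} (p : G.Walk u v) (hp : ∀ x ∈ p.support, x ∈ S) :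
    ∃ q : (restrict G S).Walk u v, q.edges = p.edges ∧ q.support = p.support := by
  have hedges : ∀ e ∈ p.edges, e ∈ (restrict G S).edgeSet := by
    rintro ⟨a, b⟩ he
    exact ⟨p.adj_of_mem_edges he, hp a (p.fst_mem_support_of_mem_edges he),
      hp b (p.snd_mem_support_of_mem_edges he)⟩
  exact ⟨p.transfer _ hedges, p.edges_transfer hedges, p.support_transfer hedges⟩

lemma not_isAcyclic_restrict_iff {S : Set V} : ¬ (restrict G S).IsAcyclic ↔
    ∃ (v : V) (c : G.Walk v v), c.IsCycle ∧ ∀ x ∈ c.support, x ∈ S := by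
  simp only [IsAcyclic, not_forall, not_not]
  constructor
  · rintro ⟨v, c, hc⟩
    refine ⟨v, c.mapLe (restrict_le S), hc.mapLe _, ?_⟩
    simpa using mem_of_mem_support_restrict c (c.adj_snd hc.not_nil).2.1
  · rintro ⟨v, c, hc, hS⟩
    obtain ⟨q, hq, -⟩ := exists_walk_restrict c hS
    have hedges : ∀ e ∈ c.edges, e ∈ (restrict G S).edgeSet :=
      fun e he => q.edges_subset_edgeSet (hq ▸ he)
    exact ⟨v, c.transfer _ hedges, hc.transfer hedges⟩

lemma isAcyclic_induce_iff {S : Set V} : (G.induce S).IsAcyclic ↔ (restrict G S).IsAcyclic := by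
  refine ⟨fun h => ?_, fun h => h.comap
    (⟨Subtype.val, fun {a b} hab => ⟨hab, a.2, b.2⟩⟩ : G.induce S →g restrict G S)
    Subtype.val_injective⟩
  by_contra hcyc
  obtain ⟨v, c, hc, hS⟩ := not_isAcyclic_restrict_iff.mp hcyc
  refine h (c.induce S hS) (Walk.IsCycle.of_map (f := (Embedding.induce S).toHom) ?_)
  rwa [Walk.map_induce]

lemma not_isAcyclic_restrict_of_notMem_support {S : Set V} {u v z : V} {p q : G.Walk u v}
    (hp : p.IsPath) (hz : z ∈ p.support) (hzq : z ∉ q.support) (hpS : ∀ x ∈ p.support, x ∈ S)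
    (hqS : ∀ x ∈ q.support, x ∈ S) : ¬ (restrict G S).IsAcyclic := by
  classical
  have hne : p ≠ q.bypass := fun h => hzq (q.support_bypass_subset_support (h ▸ hz))
  obtain ⟨w, -, -, c, hc, hsub⟩ := hp.exists_isCycle_sublist_of_ne q.bypass_isPath hne
  refine not_isAcyclic_restrict_iff.mpr ⟨w, c, hc, fun x hx => ?_⟩
  rcases List.mem_append.mp (hsub.subset hx) with hxp | hxq
  · exact hpS x hxp
  · exact hqS x (q.support_bypass_subset_support (List.mem_reverse.mp (List.mem_of_mem_tail hxq)))

/-- A core: a nonempty set `K` in which every vertex has two neighbours, so that `G[K]` has minimum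
degree at least two. -/
def IsCore (G : SimpleGraph V) (K : Set V) : Prop :=
  K.Nonempty ∧ ∀ v ∈ K, ∃ a ∈ K, ∃ b ∈ K, a ≠ b ∧ G.Adj v a ∧ G.Adj v b

lemma isCore_support {v : V} {c : G.Walk v v} (hc : c.IsCycle) : IsCore G {u | u ∈ c.support} := by
  refine ⟨⟨v, c.start_mem_support⟩, fun u hu => ?_⟩
  obtain ⟨a, b, hab, hnbrs⟩ := Set.ncard_eq_two.mp (hc.ncard_neighborSet_toSubgraph_eq_two hu)
  have hadj : ∀ x ∈ ({a, b} : Set V), c.toSubgraph.Adj u x := fun x hx => by rwa [← hnbrs] at hx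
  have hmem : ∀ x ∈ ({a, b} : Set V), x ∈ c.support := fun x hx =>
    c.mem_verts_toSubgraph.mp (c.toSubgraph.edge_vert (hadj x hx).symm)
  exact ⟨a, hmem a (by simp), b, hmem b (by simp), hab, (hadj a (by simp)).adj_sub,
    (hadj b (by simp)).adj_sub⟩

lemma exists_walk_of_seq (w : ℕ → V) (L : ℕ) :
    ∀ i, (∀ k, i ≤ k → k < i + L → G.Adj (w k) (w (k + 1))) →
      ∃ p : G.Walk (w i) (w (i + L)),
        p.length = L ∧ p.support = (List.range (L + 1)).map fun k => w (i + k) := by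
  induction L with
  | zero => exact fun i _ => ⟨.nil, by simp, by simp⟩
  | succ L ih =>
    intro i hadj
    obtain ⟨p, hp, hs⟩ := ih (i + 1) fun k hk hk' => hadj k (by omega) (by omega)
    refine ⟨(Walk.cons (hadj i le_rfl (by omega)) p).copy rfl (by congr 1; omega), ?_, ?_⟩
    · simp [hp]
    · rw [Walk.support_copy, Walk.support_cons, hs, List.range_succ_eq_map (n := L + 1),
        List.map_cons, List.map_map]
      refine congrArg _ (List.map_congr_left fun k _ => congrArg w ?_)
      simp only [Nat.succ_eq_add_one]
      omega

/-- Not turning back excludes closed walks of length two. -/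
lemma exists_isCycle_of_seq (w : ℕ → V) {i j : ℕ} (hij : i < j) (hw : w j = w i)
    (hinj : Set.InjOn w (Set.Ico i j)) (hadj : ∀ k, i ≤ k → k < j → G.Adj (w k) (w (k + 1)))
    (hback : ∀ k, i ≤ k → k + 1 < j → w (k + 2) ≠ w k) :
    ∃ c : G.Walk (w i) (w i), c.IsCycle ∧
      c.support = (List.range (j - i + 1)).map fun k => w (i + k) := by
  obtain ⟨p, hp, hs⟩ := exists_walk_of_seq w (j - i) i fun k h1 h2 => hadj k h1 (by omega)
  refine ⟨p.copy rfl (by rw [Nat.add_sub_cancel' hij.le, hw]), ?_, by rw [Walk.support_copy, hs]⟩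
  have hlen : 3 ≤ j - i := by
    by_contra hlt
    obtain h | h : j = i + 1 ∨ j = i + 2 := by omega
    · exact (hadj i le_rfl hij).ne (by rw [← h, hw])
    · exact hback i le_rfl (by omega) (by rw [← h, hw])
  have hinj' : Set.InjOn w (Set.Ioc i j) := by
    rintro k ⟨hik, hkj⟩ l ⟨hil, hlj⟩ hkl
    rcases hkj.eq_or_lt with rfl | hkj <;> rcases hlj.eq_or_lt with rfl | hlj
    · rfl
    · have := hinj ⟨le_rfl, hij⟩ ⟨hil.le, hlj⟩ (hw ▸ hkl); omega
    · have := hinj ⟨hik.le, hkj⟩ ⟨le_rfl, hij⟩ (hkl.trans hw); omega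
    · exact hinj ⟨hik.le, hkj⟩ ⟨hil.le, hlj⟩ hkl
  rw [Walk.isCycle_iff_isPath_tail_and_le_length, Walk.length_copy, hp]
  refine ⟨?_, hlen⟩
  rw [Walk.isPath_def, Walk.support_tail_of_not_nil, Walk.support_copy, hs, List.range_succ_eq_map,
    List.map_cons, List.tail_cons, List.map_map]
  · refine List.Nodup.map_on (fun k hk l hl hkl => ?_) List.nodup_range
    have hk' := List.mem_range.mp hk
    have hl' := List.mem_range.mp hl
    have := hinj' ⟨by omega, by omega⟩ ⟨by omega, by omega⟩ hkl
    omega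
  · rw [← Walk.length_eq_zero_iff, Walk.length_copy, hp]
    omega

lemma exists_first_repeat [Finite V] (w : ℕ → V) :
    ∃ i j, i < j ∧ j ≤ Nat.card V ∧ w j = w i ∧ Set.InjOn w (Set.Iio j) := by
  classical
  have hrepeat : ∃ j, ∃ i, i < j ∧ w j = w i := by
    obtain ⟨x, y, hxy, h⟩ := Finite.exists_ne_map_eq_of_infinite w
    rcases lt_or_gt_of_ne hxy with hlt | hlt
    · exact ⟨y, x, hlt, h.symm⟩
    · exact ⟨x, y, hlt, h⟩
  obtain ⟨i, hi, hw⟩ := Nat.find_spec hrepeat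
  have hinj : Set.InjOn w (Set.Iio (Nat.find hrepeat)) := by
    intro k hk l hl hkl
    rcases lt_trichotomy k l with hlt | heq | hlt
    · exact absurd ⟨k, hlt, hkl.symm⟩ (Nat.find_min hrepeat hl)
    · exact heq
    · exact absurd ⟨l, hlt, hkl⟩ (Nat.find_min hrepeat hk)
  refine ⟨i, _, hi, ?_, hw, hinj⟩
  simpa [hinj.ncard_image] using Set.ncard_le_card (w '' Set.Iio (Nat.find hrepeat))

/-- A walk in a core can always go on without turning back, until it repeats a vertex. -/
lemma not_isAcyclic_of_isCore [Finite V] {S K : Set V} (hKS : K ⊆ S) (hK : IsCore G K) :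
    ¬ (restrict G S).IsAcyclic := by
  have hnext : ∀ v ∈ K, ∀ u, ∃ a ∈ K, a ≠ u ∧ G.Adj v a := by
    intro v hv u
    obtain ⟨a, ha, b, hb, hab, hva, hvb⟩ := hK.2 v hv
    by_cases h : a = u
    · exact ⟨b, hb, fun h' => hab (h.trans h'.symm), hvb⟩
    · exact ⟨a, ha, h, hva⟩
  choose! next hnextK hnext_ne hnext_adj using hnext
  obtain ⟨v₀, hv₀⟩ := hK.1
  let s : ℕ → V × V := fun k => Nat.rec (v₀, next v₀ v₀) (fun _ x => (x.2, next x.2 x.1)) k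
  have hs : ∀ k, (s k).1 ∈ K ∧ (s k).2 ∈ K ∧ G.Adj (s k).1 (s k).2 := by
    intro k
    induction k with
    | zero => exact ⟨hv₀, hnextK _ hv₀ _, hnext_adj _ hv₀ _⟩
    | succ k ih => exact ⟨ih.2.1, hnextK _ ih.2.1 _, hnext_adj _ ih.2.1 _⟩
  obtain ⟨i, j, hij, -, hw, hinj⟩ := exists_first_repeat fun k => (s k).1
  obtain ⟨c, hc, -⟩ := exists_isCycle_of_seq (G := restrict G S) (fun k => (s k).1) hij hw
    (hinj.mono fun k hk => hk.2)
    (fun k _ _ => ⟨(hs k).2.2, hKS (hs k).1, hKS (hs k).2.1⟩)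
    (fun k _ _ => hnext_ne _ (hs k).2.1 _)
  exact fun h => h c hc

end Cores

section Geodesics

variable {V : Type*} {G : SimpleGraph V}

/-- The vertices on some geodesic between `u` and `v`, for a distance function `D`. -/
def between (D : V → V → ℕ) (u v : V) : Set V := {w | D u w + D w v ≤ D u v}

open Classical in
/-- The distance in `G`, and `M` for vertices in different components, where `G.dist` would be
`0`. -/
noncomputable def cappedDist (G : SimpleGraph V) (M : ℕ) (u v : V) : ℕ :=
  if G.Reachable u v then G.dist u v else M

lemma cappedDist_of_reachable {M : ℕ} {u v : V} (h : G.Reachable u v) :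
    cappedDist G M u v = G.dist u v :=
  if_pos h

lemma cappedDist_comm (M : ℕ) (u v : V) : cappedDist G M u v = cappedDist G M v u := by
  by_cases h : G.Reachable u v
  · rw [cappedDist_of_reachable h, cappedDist_of_reachable h.symm, dist_comm]
  · rw [cappedDist, cappedDist, if_neg h, if_neg fun h' => h h'.symm]

lemma between_comm (M : ℕ) (u v : V) :
    between (cappedDist G M) u v = between (cappedDist G M) v u := by
  ext w
  rw [between, between, Set.mem_ofPred_eq, Set.mem_ofPred_eq, cappedDist_comm M u w,
    cappedDist_comm M w v, cappedDist_comm M u v, add_comm]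

lemma dist_lt_card [Fintype V] {u v : V} (h : G.Reachable u v) :
    G.dist u v < Fintype.card V := by
  obtain ⟨p, hp, hl⟩ := h.exists_path_of_dist
  exact hl ▸ hp.length_lt

lemma reachable_of_mem_between [Fintype V] {M : ℕ} (hM : Fintype.card V ≤ M) {u v w : V}
    (huv : G.Reachable u v) (hw : w ∈ between (cappedDist G M) u v) :
    G.Reachable u w ∧ G.Reachable w v := by
  have hlt : cappedDist G M u v < M :=
    cappedDist_of_reachable huv ▸ (dist_lt_card huv).trans_le hM
  have hle : cappedDist G M u w + cappedDist G M w v ≤ cappedDist G M u v := hw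
  constructor
  · by_contra h
    have : cappedDist G M u w = M := if_neg h
    omega
  · by_contra h
    have : cappedDist G M w v = M := if_neg h
    omega

lemma between_eq_support [Fintype V] {M : ℕ} (hM : Fintype.card V ≤ M) {u v : V}
    {A : G.Walk u v} (huniq : ∀ p : G.Walk u v, p.IsPath → p.length ≤ A.length → p = A) :
    between (cappedDist G M) u v = {w | w ∈ A.support} := by
  classical
  obtain ⟨p, hp, hl⟩ := A.reachable.exists_path_of_dist
  obtain rfl : p = A := huniq p hp (hl ▸ G.dist_le A)
  ext w
  constructor
  · intro hw
    obtain ⟨huw, hwv⟩ := reachable_of_mem_between hM p.reachable hw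
    simp only [between, Set.mem_ofPred_eq, cappedDist_of_reachable, huw, hwv, p.reachable] at hw
    obtain ⟨q₁, hq₁⟩ := huw.exists_walk_length_eq_dist
    obtain ⟨q₂, hq₂⟩ := hwv.exists_walk_length_eq_dist
    have hq : (q₁.append q₂).length = G.dist u v :=
      le_antisymm (by rw [Walk.length_append]; omega) (G.dist_le _)
    rw [← huniq _ (Walk.isPath_of_length_eq_dist _ hq) (by omega)]
    simp
  · intro hw
    have htake := G.dist_le (p.takeUntil w hw)
    have hdrop := G.dist_le (p.dropUntil w hw)
    have hsplit : (p.takeUntil w hw).length + (p.dropUntil w hw).length = p.length := by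
      rw [← Walk.length_append, Walk.take_spec]
    simp only [between, Set.mem_ofPred_eq, cappedDist_of_reachable, p.reachable,
      (p.takeUntil w hw).reachable, (p.dropUntil w hw).reachable]
    omega

lemma between_self [Fintype V] {M : ℕ} (hM : Fintype.card V ≤ M) (u : V) :
    between (cappedDist G M) u u = {u} := by
  rw [between_eq_support hM (A := Walk.nil)]
  · simp
  · exact fun p _ hp => (Walk.length_eq_zero_iff.mp (Nat.le_zero.mp hp)).eq_nil

end Geodesics

/-! ### Shortest cycles and ears -/

section ShortestCycle

variable {V : Type*} {G : SimpleGraph V} {C : Set V}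

lemma mem_ball_iff {X : Set V} {r : ℕ} {u : V} :
    u ∈ ball G X r ↔ ∃ v ∈ X, ∃ p : G.Walk u v, p.length ≤ r := by
  constructor
  · rintro ⟨v, hv, h⟩
    obtain ⟨p, hp⟩ := exists_walk_of_edist_ne_top (ne_top_of_le_ne_top (ENat.natCast_ne_top r) h)
    exact ⟨v, hv, p, by exact_mod_cast hp.trans_le h⟩
  · rintro ⟨v, hv, p, hp⟩
    exact ⟨v, hv, (edist_le p).trans (by exact_mod_cast hp)⟩

lemma ball_mono {X Y : Set V} {r s : ℕ} (h : X ⊆ Y) (hrs : r ≤ s) : ball G X r ⊆ ball G Y s := by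
  intro u hu
  obtain ⟨v, hv, p, hp⟩ := mem_ball_iff.mp hu
  exact mem_ball_iff.mpr ⟨v, h hv, p, hp.trans hrs⟩

lemma mem_ball_of_walk {X : Set V} {r s : ℕ} {u v : V} (p : G.Walk u v) (hv : v ∈ ball G X r)
    (h : p.length + r ≤ s) : u ∈ ball G X s := by
  obtain ⟨x, hx, q, hq⟩ := mem_ball_iff.mp hv
  exact mem_ball_iff.mpr ⟨x, hx, p.append q, by rw [Walk.length_append]; omega⟩

lemma subset_ball (X : Set V) (r : ℕ) : X ⊆ ball G X r :=
  fun u hu => mem_ball_iff.mpr ⟨u, hu, .nil, Nat.zero_le r⟩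

lemma length_takeUntil_add_length_dropUntil [DecidableEq V] {u v w : V} (p : G.Walk u v)
    (hw : w ∈ p.support) : (p.takeUntil w hw).length + (p.dropUntil w hw).length = p.length := by
  rw [← Walk.length_append, Walk.take_spec]

/-- `γ` runs around a cycle of length `g` of `G`. -/
structure IsCyclicSeq (G : SimpleGraph V) (g : ℕ) (γ : ℕ → V) : Prop where
  three_le : 3 ≤ g
  periodic : ∀ i, γ (i + g) = γ i
  adj : ∀ i, G.Adj (γ i) (γ (i + 1))
  injOn : Set.InjOn γ (Set.Iio g)

lemma exists_isCyclicSeq_of_isCycle {v : V} {c : G.Walk v v} (hc : c.IsCycle) :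
    ∃ γ : ℕ → V, IsCyclicSeq G c.length γ ∧ Set.range γ = {x | x ∈ c.support} ∧ γ 0 = v := by
  have h3 := hc.three_le_length
  have hmod : ∀ i, i % c.length < c.length := fun i => Nat.mod_lt i (by omega)
  refine ⟨fun i => c.getVert (i % c.length), ⟨h3, by simp, fun i => ?_, fun i hi j hj h => ?_⟩,
    ?_, by simp⟩
  · have hadj := c.adj_getVert_succ (hmod i)
    have hone : 1 % c.length = 1 := Nat.mod_eq_of_lt (by omega)
    by_cases hi : i % c.length + 1 = c.length
    · have hsucc : (i + 1) % c.length = 0 := by rw [Nat.add_mod, hone, hi, Nat.mod_self]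
      rw [hi, Walk.getVert_length] at hadj
      simpa only [hsucc, Walk.getVert_zero] using hadj
    · have hsucc : (i + 1) % c.length = i % c.length + 1 := by
        rw [Nat.add_mod, hone, Nat.mod_eq_of_lt (by have := hmod i; omega)]
      simpa only [hsucc] using hadj
  · have hi' : i < c.length := hi
    have hj' : j < c.length := hj
    simp only [Nat.mod_eq_of_lt hi', Nat.mod_eq_of_lt hj'] at h
    exact hc.getVert_injOn' (by simp only [Set.mem_ofPred_eq]; omega)
      (by simp only [Set.mem_ofPred_eq]; omega) h
  · ext x
    simp only [Set.mem_range, Set.mem_ofPred_eq, Walk.mem_support_iff_exists_getVert]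
    constructor
    · rintro ⟨i, rfl⟩
      exact ⟨_, rfl, (hmod i).le⟩
    · rintro ⟨i, rfl, hi⟩
      rcases hi.lt_or_eq with hi | rfl
      · exact ⟨i, by rw [Nat.mod_eq_of_lt hi]⟩
      · exact ⟨0, by simp⟩

namespace IsCyclicSeq

variable {g : ℕ} {γ : ℕ → V}

lemma apply_mod (hC : IsCyclicSeq G g γ) (i : ℕ) : γ (i % g) = γ i :=
  Function.Periodic.map_mod_nat hC.periodic i

lemma mod_lt (hC : IsCyclicSeq G g γ) (i : ℕ) : i % g < g :=
  Nat.mod_lt _ (by have := hC.three_le; omega)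

lemma exists_lt_of_mem_range (hC : IsCyclicSeq G g γ) {x : V} (h : x ∈ Set.range γ) :
    ∃ i < g, γ i = x := by
  obtain ⟨i, rfl⟩ := h
  exact ⟨i % g, hC.mod_lt i, hC.apply_mod i⟩

lemma ne_of_lt (hC : IsCyclicSeq G g γ) {i j : ℕ} (hij : i < j) (hj : j < i + g) : γ i ≠ γ j := by
  intro h
  rw [← hC.apply_mod i, ← hC.apply_mod j] at h
  have hmod : i ≡ j [MOD g] := hC.injOn (hC.mod_lt i) (hC.mod_lt j) h
  have := Nat.le_of_dvd (by omega) ((Nat.modEq_iff_dvd' hij.le).mp hmod)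
  omega

lemma exists_arc (hC : IsCyclicSeq G g γ) {i j : ℕ} (hij : i ≤ j) (hj : j < i + g) :
    ∃ A : G.Walk (γ i) (γ j), A.IsPath ∧ A.length = j - i ∧
      ∀ x, x ∈ A.support ↔ ∃ k, i ≤ k ∧ k ≤ j ∧ γ k = x := by
  obtain ⟨A, hl, hs⟩ := exists_walk_of_seq (G := G) γ (j - i) i fun k _ _ => hC.adj k
  refine ⟨A.copy rfl (by congr 1; omega), ?_, by simpa using hl, fun x => ?_⟩
  · rw [Walk.isPath_def, Walk.support_copy, hs]
    refine List.Nodup.map_on (fun x hx y hy hxy => ?_) List.nodup_range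
    simp only [List.mem_range] at hx hy
    by_contra hne
    rcases lt_or_gt_of_ne hne with h | h
    · exact hC.ne_of_lt (by omega) (by omega) hxy
    · exact hC.ne_of_lt (by omega) (by omega) hxy.symm
  · simp only [Walk.support_copy, hs, List.mem_map, List.mem_range]
    constructor
    · rintro ⟨k, hk, rfl⟩
      exact ⟨i + k, by omega, by omega, rfl⟩
    · rintro ⟨k, hik, hkj, rfl⟩
      exact ⟨k - i, by omega, by congr 1; omega⟩

/-- Walk along the cycle from `δ 0` in both directions until `B` is reached. A vertex whose
neighbours are all in `B` as well is not reached, so that the two walks together are a path. -/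
lemma exists_path_through_zero {n m : ℕ} {δ : ℕ → V} (hδ : IsCyclicSeq G n δ) {B : Set V}
    (hzero : δ 0 ∉ B) (hm : δ m ∈ B) (hnbr : ∀ x, G.Adj x (δ m) → x ∈ B) :
    ∃ (a b : V) (Q : G.Walk a b), Q.IsPath ∧ δ 0 ∈ Q.support ∧ (∀ x ∈ Q.support, x ∈ Set.range δ) ∧
      (∀ x ∈ Q.support, x ≠ a → x ≠ b → x ∉ B) ∧ (a ∈ B ∧ ∃ x ∉ B, G.Adj x a) ∧
      (b ∈ B ∧ ∃ x ∉ B, G.Adj x b) := by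
  classical
  wlog hmn : m < n generalizing m
  · exact this (m := m % n) (by rwa [hδ.apply_mod]) (by rwa [hδ.apply_mod]) (hδ.mod_lt m)
  have hn : δ n = δ 0 := by simpa using hδ.periodic 0
  have hforth : ∃ k, δ k ∈ B := ⟨m, hm⟩
  obtain ⟨k, hk, hkmin⟩ : ∃ k, δ k ∈ B ∧ ∀ l < k, δ l ∉ B :=
    ⟨_, Nat.find_spec hforth, fun l hl => Nat.find_min hforth hl⟩
  obtain ⟨s, hsn, hs, hsmax⟩ : ∃ s ≤ n, δ s ∈ B ∧ ∀ l, s < l → l ≤ n → δ l ∉ B :=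
    ⟨_, Nat.findGreatest_le n, Nat.findGreatest_spec (P := (δ · ∈ B)) hmn.le hm,
      fun _ => Nat.findGreatest_is_greatest⟩
  have hk0 : k ≠ 0 := by rintro rfl; exact hzero hk
  have hsn' : s ≠ n := by rintro rfl; exact hzero (hn ▸ hs)
  have hkprev : δ (k - 1) ∉ B ∧ G.Adj (δ (k - 1)) (δ k) := by
    have hadj := hδ.adj (k - 1)
    rw [Nat.sub_add_cancel (Nat.pos_of_ne_zero hk0)] at hadj
    exact ⟨hkmin _ (by omega), hadj⟩
  have hsnext : δ (s + 1) ∉ B ∧ G.Adj (δ (s + 1)) (δ s) :=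
    ⟨hsmax _ (by omega) (by omega), (hδ.adj s).symm⟩
  have hkm : k < m := by
    have hkm' : k ≠ m := by rintro rfl; exact hkprev.1 (hnbr _ hkprev.2)
    have : ¬ m < k := fun h => hkmin m h hm
    omega
  have hms : m < s := by
    have hms' : s ≠ m := by rintro rfl; exact hsnext.1 (hnbr _ hsnext.2)
    have : ¬ s < m := fun h => hsmax m h hmn.le hm
    omega
  obtain ⟨Q, hQ, -, hQs⟩ := hδ.exists_arc (i := s) (j := k + n) (by omega) (by omega)
  have hend : δ (k + n) = δ k := hδ.periodic k
  refine ⟨δ s, δ k, Q.copy rfl hend, by simpa using hQ, ?_, ?_, ?_, ⟨hs, _, hsnext⟩, hk, _, hkprev⟩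
  all_goals simp only [Walk.support_copy, hQs]
  · exact ⟨n, hsn, by omega, hn⟩
  · rintro x ⟨l, -, -, rfl⟩
    exact ⟨l, rfl⟩
  · rintro x ⟨l, hsl, hlk, rfl⟩ hxs hxk
    have hls : l ≠ s := by rintro rfl; exact hxs rfl
    have hlk' : l ≠ k + n := by rintro rfl; exact hxk hend
    rcases le_total l n with hln | hnl
    · exact hsmax l (by omega) hln
    · obtain ⟨l, rfl⟩ := Nat.exists_eq_add_of_le' hnl
      exact hδ.periodic l ▸ hkmin l (by omega)

end IsCyclicSeq

/-- The distance of the positions `i, j < g` on a cycle of length `g`. -/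
def cyc (g i j : ℕ) : ℕ := min (i - j + (j - i)) (g - (i - j + (j - i)))

lemma cyc_comm (g i j : ℕ) : cyc g i j = cyc g j i := by
  rw [cyc, cyc, add_comm]

lemma IsCyclicSeq.exists_cyc_path {g : ℕ} {γ : ℕ → V} (hC : IsCyclicSeq G g γ) {i j : ℕ}
    (hi : i < g) (hj : j < g) : ∃ A : G.Walk (γ i) (γ j), A.IsPath ∧ A.length = cyc g i j ∧
      ∀ x ∈ A.support, x ∈ Set.range γ := by
  wlog hij : i ≤ j generalizing i j
  · obtain ⟨A, hA, hl, hs⟩ := this hj hi (by omega)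
    exact ⟨A.reverse, hA.reverse, by rw [Walk.length_reverse, hl, cyc_comm], by simpa using hs⟩
  by_cases hshort : j - i ≤ g - (j - i)
  · obtain ⟨A, hA, hl, hs⟩ := hC.exists_arc hij (by omega)
    refine ⟨A, hA, by rw [hl, cyc]; omega, fun x hx => ?_⟩
    obtain ⟨k, -, -, rfl⟩ := (hs x).mp hx
    exact ⟨k, rfl⟩
  · obtain ⟨A, hA, hl, hs⟩ := hC.exists_arc (i := j) (j := i + g) (by omega) (by omega)
    refine ⟨(A.copy rfl (hC.periodic i)).reverse, by simpa using hA, ?_, fun x hx => ?_⟩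
    · rw [Walk.length_reverse, Walk.length_copy, hl, cyc]
      omega
    · rw [Walk.support_reverse, Walk.support_copy, List.mem_reverse] at hx
      obtain ⟨k, -, -, rfl⟩ := (hs x).mp hx
      exact ⟨k, rfl⟩

/-- `γ` runs around a shortest cycle, of length `g`, of `G`. -/
structure IsShortestCycle (G : SimpleGraph V) (g : ℕ) (γ : ℕ → V) : Prop
    extends IsCyclicSeq G g γ where
  le_length : ∀ (v : V) (c : G.Walk v v), c.IsCycle → g ≤ c.length

lemma exists_isShortestCycle (h : ¬ G.IsAcyclic) : ∃ g γ, IsShortestCycle G g γ := by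
  obtain ⟨v, c, hc, hl⟩ := exists_girth_eq_length.mpr h
  obtain ⟨γ, hγ, -⟩ := exists_isCyclicSeq_of_isCycle hc
  exact ⟨_, γ, hγ, fun v c' hc' => hl ▸ girth_le_length hc'⟩

/-- A walk of length at most `r` from `w` to the vertex `x` of `C` that uses no edge inside `C`. -/
def Anchored (G : SimpleGraph V) (C : Set V) (r : ℕ) (w x : V) : Prop :=
  ∃ p : G.Walk w x, p.length ≤ r ∧ ∀ e ∈ p.edges, ∃ y ∈ e, y ∉ C

lemma Anchored.refl (C : Set V) (r : ℕ) (x : V) : Anchored G C r x x :=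
  ⟨.nil, by simp, by simp⟩

lemma Anchored.mono {C : Set V} {r s : ℕ} {w x : V} (h : Anchored G C r w x) (hrs : r ≤ s) :
    Anchored G C s w x := by
  obtain ⟨p, hp, he⟩ := h
  exact ⟨p, hp.trans hrs, he⟩

namespace IsShortestCycle

variable {g : ℕ} {γ : ℕ → V}

lemma path_unique (hC : IsShortestCycle G g γ) {u v : V} {p q : G.Walk u v} (hp : p.IsPath)
    (hq : q.IsPath) (h : p.length + q.length < g) : p = q := by
  by_contra hne
  obtain ⟨w, -, -, c, hc, hl⟩ := hp.exists_isCycle_length_le_add_of_ne hq hne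
  have := hC.le_length w c hc
  omega

lemma exists_arc_edges (hC : IsShortestCycle G g γ) {i j : ℕ} (hi : i < g) (hj : j < g)
    (W : G.Walk (γ i) (γ j)) (hW : 2 * W.length < g) :
    ∃ E : Finset (Sym2 V), E.card = cyc g i j ∧
      ∀ e ∈ E, e ∈ W.edges ∧ ∀ x ∈ e, x ∈ Set.range γ := by
  classical
  obtain ⟨A, hA, hl, hs⟩ := hC.exists_cyc_path hi hj
  have hAW : A = W.bypass := by
    refine hC.path_unique hA W.bypass_isPath ?_
    have := W.length_bypass_le_length
    have : 2 * cyc g i j ≤ g := by unfold cyc; omega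
    omega
  refine ⟨A.edges.toFinset, ?_, fun e he => ?_⟩
  · rw [List.toFinset_card_of_nodup hA.isTrail.edges_nodup, Walk.length_edges, hl]
  · have he' := List.mem_toFinset.mp he
    exact ⟨W.edges_bypass_subset_edges (hAW ▸ he'),
      fun x hx => hs x (A.mem_support_of_mem_edges he' hx)⟩

lemma cyc_le_of_anchored (hC : IsShortestCycle G g γ) {i j r s : ℕ} (hi : i < g) (hj : j < g)
    {w w' : V} (hw : Anchored G (Set.range γ) r w (γ i)) (hw' : Anchored G (Set.range γ) r w' (γ j))
    (q : G.Walk w w') (hq : q.length ≤ s) (hg : 4 * r + 2 * s < g) :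
    cyc g i j ≤ s ∧ ((∀ e ∈ q.edges, ∃ y ∈ e, y ∉ Set.range γ) → i = j) := by
  classical
  obtain ⟨p, hp, hpe⟩ := hw
  obtain ⟨p', hp', hpe'⟩ := hw'
  obtain ⟨E, hE, hEe⟩ := hC.exists_arc_edges hi hj (p.reverse.append (q.append p')) (by
    simp only [Walk.length_append, Walk.length_reverse]; omega)
  have hsub : ∀ e ∈ E, e ∈ q.edges ∧ ∀ x ∈ e, x ∈ Set.range γ := by
    intro e he
    obtain ⟨hmem, hin⟩ := hEe e he
    have hnot : ¬ ∃ y ∈ e, y ∉ Set.range γ := fun ⟨y, hy, hyC⟩ => hyC (hin y hy)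
    simp only [Walk.edges_append, Walk.edges_reverse, List.mem_append, List.mem_reverse] at hmem
    rcases hmem with hmem | hmem | hmem
    · exact absurd (hpe e hmem) hnot
    · exact ⟨hmem, hin⟩
    · exact absurd (hpe' e hmem) hnot
  constructor
  · calc cyc g i j = E.card := hE.symm
      _ ≤ q.edges.toFinset.card :=
          Finset.card_le_card fun e he => List.mem_toFinset.mpr (hsub e he).1
      _ ≤ q.edges.length := List.toFinset_card_le _
      _ ≤ s := q.length_edges.trans_le hq
  · intro h
    have hempty : E = ∅ := by
      refine Finset.eq_empty_iff_forall_notMem.mpr fun e he => ?_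
      obtain ⟨y, hy, hyC⟩ := h e (hsub e he).1
      exact hyC ((hsub e he).2 y hy)
    rw [hempty, Finset.card_empty, cyc] at hE
    omega

end IsShortestCycle

/-- A shortest walk from its first vertex to the set `C`. The distance from `C` drops at unit speed
along it. -/
structure IsDescent (C : Set V) {u x : V} (p : G.Walk u x) : Prop where
  end_mem : x ∈ C
  length_le : ∀ l, u ∈ ball G C l → p.length ≤ l

lemma exists_isDescent {k : ℕ} {u : V} (hu : u ∈ ball G C k) :
    ∃ (x : V) (p : G.Walk u x), IsDescent C p := by
  classical
  have hex : ∃ l, u ∈ ball G C l := ⟨k, hu⟩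
  obtain ⟨x, hx, p, hp⟩ := mem_ball_iff.mp (Nat.find_spec hex)
  exact ⟨x, p, hx, fun l hl => hp.trans (Nat.find_min' hex hl)⟩

lemma exists_isDescent_of_adj {k : ℕ} {u : V} (hu : u ∈ ball G C k)
    (hadj : ∃ v ∉ ball G C k, G.Adj v u) :
    ∃ (x : V) (p : G.Walk u x), IsDescent C p ∧ p.length = k := by
  obtain ⟨x, p, hp⟩ := exists_isDescent hu
  obtain ⟨v, hv, hvu⟩ := hadj
  refine ⟨x, p, hp, le_antisymm (hp.length_le k hu) ?_⟩
  by_contra! hlt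
  exact hv (mem_ball_iff.mpr ⟨x, hp.end_mem, p.cons hvu, hlt⟩)

namespace IsDescent

variable {u w x : V} {p : G.Walk u x}

lemma isPath (hp : IsDescent C p) : p.IsPath := by
  obtain ⟨q, hq⟩ := p.reachable.exists_walk_length_eq_dist
  refine p.isPath_of_length_eq_dist (le_antisymm ?_ (G.dist_le p))
  exact hq ▸ hp.length_le _ (mem_ball_iff.mpr ⟨x, hp.end_mem, q, le_rfl⟩)

lemma dropUntil [DecidableEq V] (hp : IsDescent C p) (hw : w ∈ p.support) :
    IsDescent C (p.dropUntil w hw) := by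
  refine ⟨hp.end_mem, fun l hl => ?_⟩
  have := hp.length_le _ (mem_ball_of_walk (p.takeUntil w hw) hl le_rfl)
  have := length_takeUntil_add_length_dropUntil p hw
  omega

lemma mem_ball (hp : IsDescent C p) (hw : w ∈ p.support) : w ∈ ball G C p.length := by
  classical
  exact mem_ball_iff.mpr ⟨x, hp.end_mem, p.dropUntil w hw, p.length_dropUntil_le_length hw⟩

lemma eq_of_mem (hp : IsDescent C p) (hw : w ∈ p.support) (hwC : w ∈ C) : w = x := by
  classical
  exact Walk.eq_of_length_eq_zero
    (Nat.le_zero.mp ((hp.dropUntil hw).length_le 0 (subset_ball C 0 hwC)))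

lemma anchored (hp : IsDescent C p) (hw : w ∈ p.support) : Anchored G C p.length w x := by
  classical
  refine ⟨p.dropUntil w hw, p.length_dropUntil_le_length hw, ?_⟩
  rintro ⟨a, b⟩ he
  have he' := p.edges_dropUntil_subset_edges hw he
  by_contra! hC
  have ha := hp.eq_of_mem (p.fst_mem_support_of_mem_edges he') (hC a (by simp))
  have hb := hp.eq_of_mem (p.snd_mem_support_of_mem_edges he') (hC b (by simp))
  exact (p.adj_of_mem_edges he').ne (ha.trans hb.symm)

lemma exists_walk_notMem_ball (hp : IsDescent C p) (hw : w ∈ p.support) {m : ℕ}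
    (hm : w ∉ ball G C m) : ∃ q : G.Walk u w, q.length + m < p.length ∧
      ∀ y ∈ q.support, y ∉ ball G C m := by
  classical
  have hsplit := length_takeUntil_add_length_dropUntil p hw
  have hlt : m < (p.dropUntil w hw).length := by
    by_contra! hle
    exact hm (mem_ball_iff.mpr ⟨x, hp.end_mem, _, hle⟩)
  refine ⟨p.takeUntil w hw, by omega, fun y hy hyC => ?_⟩
  have := hp.length_le _ (mem_ball_of_walk ((p.takeUntil w hw).takeUntil y hy) hyC le_rfl)
  have := (p.takeUntil w hw).length_takeUntil_le_length hy
  omega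

end IsDescent

namespace IsShortestCycle

variable {g : ℕ} {γ : ℕ → V}

/-- A shortest cycle is induced, so that the vertex of `K` with the largest position would have only
one neighbour in `K`. -/
lemma exists_notMem_range (hC : IsShortestCycle G g γ) {K : Set V} (hK : IsCore G K)
    (h0 : γ 0 ∉ K) : ∃ u ∈ K, u ∉ Set.range γ := by
  by_contra! hKC
  have hpos : ∀ v ∈ K, ∃ i < g, γ i = v := fun v hv => hC.exists_lt_of_mem_range (hKC v hv)
  choose! pos hpos_lt hpos using hpos
  have hfin : K.Finite := ((Set.finite_Iio g).image γ).subset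
    fun v hv => ⟨pos v, hpos_lt v hv, hpos v hv⟩
  obtain ⟨v, hv, hmax⟩ := Set.exists_max_image K pos hfin hK.1
  have hnbr : ∀ a ∈ K, G.Adj v a → pos a + 1 = pos v := by
    intro a ha hva
    have ha0 : pos a ≠ 0 := fun h => h0 (by rwa [← h, hpos a ha])
    have hne : pos v ≠ pos a := fun h => hva.ne (by rw [← hpos v hv, ← hpos a ha, h])
    have hadj : G.Adj (γ (pos v)) (γ (pos a)) := by rwa [hpos v hv, hpos a ha]
    have hcyc := (hC.cyc_le_of_anchored (r := 0) (s := 1) (hpos_lt v hv) (hpos_lt a ha)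
      (Anchored.refl _ _ _) (Anchored.refl _ _ _) hadj.toWalk (by simp)
      (by have := hC.three_le; omega)).1
    have := hmax a ha
    have := hpos_lt v hv
    unfold cyc at hcyc
    omega
  obtain ⟨a, ha, b, hb, hab, hva, hvb⟩ := hK.2 v hv
  have hpos_ab : pos a = pos b := by have := hnbr a ha hva; have := hnbr b hb hvb; omega
  exact hab (by rw [← hpos a ha, ← hpos b hb, hpos_ab])

lemma descent_end_eq (hC : IsShortestCycle G g γ) {r : ℕ} (hg : 4 * r + 2 < g) {u a x y : V}
    (hua : G.Adj u a) (hu : u ∉ Set.range γ) {p : G.Walk u x} {q : G.Walk a y}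
    (hp : IsDescent (Set.range γ) p) (hq : IsDescent (Set.range γ) q) (hpr : p.length ≤ r)
    (hqr : q.length ≤ r) : x = y := by
  obtain ⟨i, hi, rfl⟩ := hC.exists_lt_of_mem_range hp.end_mem
  obtain ⟨j, hj, rfl⟩ := hC.exists_lt_of_mem_range hq.end_mem
  refine congrArg γ ((hC.cyc_le_of_anchored (s := 1) hi hj
    ((hp.anchored p.start_mem_support).mono hpr) ((hq.anchored q.start_mem_support).mono hqr)
    hua.toWalk (by simp) hg).2 fun e he => ?_)
  rw [Adj.edges_toWalk, List.mem_singleton] at he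
  exact ⟨u, by simp [he], hu⟩

/-- Around a long shortest cycle, every other cycle leaves `B(C, r)`: the descents from a highest
vertex of `K` through two neighbours in `K` would form a short cycle. -/
lemma exists_notMem_ball [Finite V] (hC : IsShortestCycle G g γ) {r : ℕ} (hg : 4 * r + 2 < g)
    {K : Set V} (hK : IsCore G K) (h0 : γ 0 ∉ K) : ∃ u ∈ K, u ∉ ball G (Set.range γ) r := by
  classical
  by_contra! hball
  have hdesc : ∀ u ∈ K, ∃ l, ∃ (x : V) (p : G.Walk u x), IsDescent (Set.range γ) p ∧ p.length = l :=
    fun u hu => by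
      obtain ⟨x, p, hp⟩ := exists_isDescent (hball u hu)
      exact ⟨_, x, p, hp, rfl⟩
  choose! lev hlev using hdesc
  have hlev_le : ∀ u ∈ K, lev u ≤ r := by
    intro u hu
    obtain ⟨x, p, hp, hpl⟩ := hlev u hu
    exact hpl ▸ hp.length_le r (hball u hu)
  obtain ⟨u, hu, hmax⟩ := Set.exists_max_image K lev K.toFinite hK.1
  have huC : u ∉ Set.range γ := by
    obtain ⟨v, hv, hvC⟩ := hC.exists_notMem_range hK h0
    intro huC
    obtain ⟨x, p, hp, hpl⟩ := hlev u hu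
    obtain ⟨y, q, hq, hql⟩ := hlev v hv
    have := hp.length_le 0 (subset_ball _ 0 huC)
    have := hmax v hv
    exact hvC (Walk.eq_of_length_eq_zero (p := q) (by omega) ▸ hq.end_mem)
  obtain ⟨x, p, hp, hpl⟩ := hlev u hu
  have hnbr : ∀ a ∈ K, ∀ h : G.Adj u a, ∃ q : G.Walk a x, (q.cons h).IsPath ∧ q.length ≤ r := by
    intro a ha hua
    obtain ⟨y, q, hq, hql⟩ := hlev a ha
    obtain rfl := hC.descent_end_eq hg hua huC hp hq (hpl ▸ hlev_le u hu) (hql ▸ hlev_le a ha)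
    refine ⟨q, (Walk.cons_isPath_iff _ _).mpr ⟨hq.isPath, fun huq => ?_⟩, hql ▸ hlev_le a ha⟩
    have hdrop := hp.length_le _ (mem_ball_iff.mpr ⟨_, hq.end_mem, q.dropUntil u huq, le_rfl⟩)
    have := length_takeUntil_add_length_dropUntil q huq
    have := hmax a ha
    exact hua.ne (Walk.eq_of_length_eq_zero (p := q.takeUntil u huq) (by omega)).symm
  obtain ⟨a, ha, b, hb, hab, hua, hub⟩ := hK.2 u hu
  obtain ⟨qa, hqa, hla⟩ := hnbr a ha hua
  obtain ⟨qb, hqb, hlb⟩ := hnbr b hb hub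
  have heq := hC.path_unique hqa hqb (by simp only [Walk.length_cons]; omega)
  exact hab (Walk.cons.inj heq).1

end IsShortestCycle

/-- A path `Q` from `a` to `b` outside `B(C, 2 * d)` except for its ends, and shortest paths from
the ends to `C`, which arrive at the positions `i` and `j`. The vertex `z` records that `Q` does
leave `B(C, 2 * d)`. -/
structure Ear (G : SimpleGraph V) (g : ℕ) (γ : ℕ → V) (d : ℕ) where
  a : V
  b : V
  Q : G.Walk a b
  isPath : Q.IsPath
  z : V
  z_mem : z ∈ Q.support
  z_high : z ∉ ball G (Set.range γ) (2 * d)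
  high : ∀ x ∈ Q.support, x ≠ a → x ≠ b → x ∉ ball G (Set.range γ) (2 * d)
  i : ℕ
  j : ℕ
  hi : i < g
  hj : j < g
  pa : G.Walk a (γ i)
  pb : G.Walk b (γ j)
  pa_isDescent : IsDescent (Set.range γ) pa
  pb_isDescent : IsDescent (Set.range γ) pb
  pa_length : pa.length = 2 * d
  pb_length : pb.length = 2 * d

lemma IsShortestCycle.exists_ear [Finite V] {g d : ℕ} {γ : ℕ → V} (hC : IsShortestCycle G g γ)
    (hd : 1 ≤ d) (hg : 8 * d + 2 < g) (hF : (restrict G (ball G (Set.range γ) d)ᶜ).IsAcyclic)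
    {U : Set V} (hU : ¬ (restrict G U).IsAcyclic) (h0 : γ 0 ∉ U) :
    ∃ e : Ear G g γ d, ∀ x ∈ e.Q.support, x ∈ U := by
  classical
  obtain ⟨v, c, hc, hcU⟩ := not_isAcyclic_restrict_iff.mp hU
  obtain ⟨z, hzc, hz⟩ := hC.exists_notMem_ball (r := 2 * d) (by omega) (isCore_support hc)
    fun h => h0 (hcU _ h)
  obtain ⟨w, hwc, hw⟩ : ∃ w ∈ c.support, w ∈ ball G (Set.range γ) d := by
    by_contra! hfar
    exact not_isAcyclic_restrict_iff.mpr ⟨v, c, hc, hfar⟩ hF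
  obtain ⟨δ, hδ, hδc, rfl⟩ := exists_isCyclicSeq_of_isCycle (hc.rotate hzc)
  have hrange : ∀ x, x ∈ Set.range δ ↔ x ∈ c.support := fun x => by rw [hδc]; simp
  obtain ⟨m, rfl⟩ := (hrange w).mpr hwc
  have hnbr : ∀ x, G.Adj x (δ m) → x ∈ ball G (Set.range γ) (2 * d) := fun x hx =>
    mem_ball_of_walk hx.toWalk hw (by rw [Walk.length_cons, Walk.length_nil]; omega)
  obtain ⟨a, b, Q, hQ, hzQ, hQδ, hQhigh, ⟨ha, ha'⟩, hb, hb'⟩ :=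
    hδ.exists_path_through_zero hz (ball_mono subset_rfl (by omega) hw) hnbr
  obtain ⟨x, pa, hpa, hpal⟩ := exists_isDescent_of_adj ha ha'
  obtain ⟨y, pb, hpb, hpbl⟩ := exists_isDescent_of_adj hb hb'
  obtain ⟨i, hi, rfl⟩ := hC.exists_lt_of_mem_range hpa.end_mem
  obtain ⟨j, hj, rfl⟩ := hC.exists_lt_of_mem_range hpb.end_mem
  exact ⟨⟨a, b, Q, hQ, δ 0, hzQ, hz, hQhigh, i, j, hi, hj, pa, pb, hpa, hpb, hpal, hpbl⟩,
    fun x hx => hcU x ((hrange x).mp (hQδ x hx))⟩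

end ShortestCycle

section Ears

variable {V : Type*} {G F : SimpleGraph V}

lemma exists_subwalk {u v x y : V} (p : G.Walk u v) (hx : x ∈ p.support) (hy : y ∈ p.support) :
    ∃ q : G.Walk x y, ∀ z ∈ q.support, z ∈ p.support := by
  classical
  refine ⟨(p.takeUntil x hx).reverse.append (p.takeUntil y hy), fun z hz => ?_⟩
  rw [Walk.mem_support_append_iff, Walk.support_reverse, List.mem_reverse] at hz
  exact hz.elim (fun h => p.support_takeUntil_subset_support hx h)
    fun h => p.support_takeUntil_subset_support hy h

lemma notMem_support_of_length_eq_dist {u v w : V} {p : G.Walk u v} (hp : p.length = G.dist u v)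
    (hw : G.dist u v ≤ G.dist u w) (hne : w ≠ v) : w ∉ p.support := by
  classical
  intro hwp
  have hsplit := length_takeUntil_add_length_dropUntil p hwp
  have := G.dist_le (p.takeUntil w hwp)
  exact hne (Walk.eq_of_length_eq_zero (p := p.dropUntil w hwp) (by omega))

/-- A root of the component of `v`. -/
noncomputable def root (F : SimpleGraph V) (v : V) : V := (F.connectedComponentMk v).out

/-- The depth of `v` if every component of the forest `F` is rooted at its `root`. -/
noncomputable def depth (F : SimpleGraph V) (v : V) : ℕ := F.dist (root F v) v

lemma reachable_root (F : SimpleGraph V) (v : V) : F.Reachable (root F v) v :=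
  ConnectedComponent.exact (Quot.out_eq (F.connectedComponentMk v))

lemma root_eq_of_reachable {u v : V} (h : F.Reachable u v) : root F u = root F v := by
  rw [root, root, ConnectedComponent.sound h]

lemma depth_lt_card [Finite V] (F : SimpleGraph V) (v : V) : depth F v < Nat.card V := by
  cases nonempty_fintype V
  exact Nat.card_eq_fintype_card (α := V) ▸ dist_lt_card (reachable_root F v)

/-- If `t` is a vertex of least depth of the walk `Q`, then the root path of a vertex of `Q` runs
through `t`, unless a detour would close a cycle. -/
lemma mem_support_of_depth_le (hF : F.IsAcyclic) {a b t z v : V} {Q : F.Walk a b}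
    (ht : t ∈ Q.support) (hmin : ∀ x ∈ Q.support, depth F t ≤ depth F x)
    (hz : depth F z ≤ depth F t) (W : F.Walk z v) (hv : v ∈ Q.support) : t ∈ W.support := by
  classical
  by_contra htW
  obtain ⟨R, hR⟩ := exists_subwalk Q ht hv
  have hroot : root F z = root F t := root_eq_of_reachable (W.reachable.trans R.reachable.symm)
  obtain ⟨q, hql⟩ := (hroot ▸ reachable_root F z).exists_walk_length_eq_dist
  obtain ⟨p, hp, hpl⟩ := (reachable_root F t).exists_path_of_dist
  have htq : t ∉ q.support := by
    refine notMem_support_of_length_eq_dist hql ?_ fun h => htW (h ▸ W.start_mem_support)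
    simpa only [depth, hroot] using hz
  cases hRc : R.bypass with
  | nil => exact htW W.end_mem_support
  | @cons _ y _ hty rest =>
    have htrest : t ∉ rest.support := by
      have hpath := R.bypass_isPath
      rw [hRc, Walk.cons_isPath_iff] at hpath
      exact hpath.2
    have hyQ : y ∈ Q.support :=
      hR y (R.support_bypass_subset_support (by rw [hRc]; simp))
    have hyp : y ∉ p.support := by
      refine notMem_support_of_length_eq_dist hpl ?_ hty.ne'
      have hy := hmin y hyQ
      rwa [depth, depth, root_eq_of_reachable hty.symm.reachable] at hy
    set W' := (q.append W).append rest.reverse with hW'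
    have htW' : t ∉ W'.support := by
      simp only [hW', Walk.mem_support_append_iff, Walk.support_reverse, List.mem_reverse, not_or]
      exact ⟨⟨htq, htW⟩, htrest⟩
    have huniq : p.concat hty = W'.bypass := congrArg Subtype.val
      ((hF.subsingleton_path _ _).elim ⟨_, hp.concat hyp hty⟩ ⟨_, W'.bypass_isPath⟩)
    refine htW' (W'.support_bypass_subset_support ?_)
    rw [← huniq, Walk.support_concat]
    simp

variable {g d : ℕ} {γ : ℕ → V}

lemma notMem_ball_of_walk {X : Set V} {r s : ℕ} {x y z : V} (hx : x ∉ ball G X (r + s))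
    (q : G.Walk x y) (hq : q.length ≤ r) (hz : z ∈ q.support) : z ∉ ball G X s := by
  classical
  intro hzX
  have := q.length_takeUntil_le_length hz
  exact hx (mem_ball_of_walk (q.takeUntil z hz) hzX (by omega))

namespace Ear

/-- The ear traversed in the opposite direction. -/
def swap (e : Ear G g γ d) : Ear G g γ d where
  a := e.b
  b := e.a
  Q := e.Q.reverse
  isPath := e.isPath.reverse
  z := e.z
  z_mem := by simpa using e.z_mem
  z_high := e.z_high
  high := fun x hx hxb hxa => e.high x (by simpa using hx) hxa hxb
  i := e.j
  j := e.i
  hi := e.hj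
  hj := e.hi
  pa := e.pb
  pb := e.pa
  pa_isDescent := e.pb_isDescent
  pb_isDescent := e.pa_isDescent
  pa_length := e.pb_length
  pb_length := e.pa_length

/-- The vertices of the ear together with its descents to the cycle. -/
def verts (e : Ear G g γ d) : Set V :=
  {x | x ∈ e.Q.support ∨ x ∈ e.pa.support ∨ x ∈ e.pb.support}

/-- The ears are at distance more than `d`, and so are the places where they meet the cycle. -/
def Far (e f : Ear G g γ d) : Prop :=
  (∀ u ∈ e.verts, ∀ w ∈ f.verts, ∀ q : G.Walk u w, d < q.length) ∧
    d < cyc g e.i f.i ∧ d < cyc g e.i f.j ∧ d < cyc g e.j f.i ∧ d < cyc g e.j f.j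

lemma Far.symm {e f : Ear G g γ d} (h : e.Far f) : f.Far e := by
  obtain ⟨hwalk, hii, hij, hji, hjj⟩ := h
  refine ⟨fun u hu w hw q => ?_, ?_, ?_, ?_, ?_⟩
  · simpa using hwalk w hw u hu q.reverse
  all_goals rw [cyc_comm]; assumption

lemma mem_verts_cases (e : Ear G g γ d) {u : V} (hu : u ∈ e.verts) :
    (u ∈ e.Q.support ∧ u ∉ ball G (Set.range γ) (2 * d)) ∨
      ∃ k < g, (k = e.i ∨ k = e.j) ∧ ∃ x ∈ e.Q.support, ∃ p : G.Walk x (γ k),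
        IsDescent (Set.range γ) p ∧ p.length = 2 * d ∧ u ∈ p.support := by
  have ha (h : u ∈ e.pa.support) : ∃ k < g, (k = e.i ∨ k = e.j) ∧ ∃ x ∈ e.Q.support,
      ∃ p : G.Walk x (γ k), IsDescent (Set.range γ) p ∧ p.length = 2 * d ∧ u ∈ p.support :=
    ⟨e.i, e.hi, .inl rfl, e.a, e.Q.start_mem_support, e.pa, e.pa_isDescent, e.pa_length, h⟩
  have hb (h : u ∈ e.pb.support) : ∃ k < g, (k = e.i ∨ k = e.j) ∧ ∃ x ∈ e.Q.support,
      ∃ p : G.Walk x (γ k), IsDescent (Set.range γ) p ∧ p.length = 2 * d ∧ u ∈ p.support :=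
    ⟨e.j, e.hj, .inr rfl, e.b, e.Q.end_mem_support, e.pb, e.pb_isDescent, e.pb_length, h⟩
  rcases hu with hu | hu | hu
  · by_cases hua : u = e.a
    · exact .inr (ha (hua ▸ e.pa.start_mem_support))
    by_cases hub : u = e.b
    · exact .inr (hb (hub ▸ e.pb.start_mem_support))
    exact .inl ⟨hu, e.high u hu hua hub⟩
  · exact .inr (ha hu)
  · exact .inr (hb hu)

lemma notMem_ball_of_mem_Q (e : Ear G g γ d) (hd : 1 ≤ d) {x : V} (hx : x ∈ e.Q.support) :
    x ∉ ball G (Set.range γ) d := by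
  intro h
  by_cases hxa : x = e.a
  · have := e.pa_isDescent.length_le d (hxa ▸ h)
    have := e.pa_length
    omega
  by_cases hxb : x = e.b
  · have := e.pb_isDescent.length_le d (hxb ▸ h)
    have := e.pb_length
    omega
  exact e.high x hx hxa hxb (ball_mono subset_rfl (by omega) h)

lemma exists_walk_of_mem_verts (e : Ear G g γ d) {u : V} (hu : u ∈ e.verts)
    (hfar : u ∉ ball G (Set.range γ) d) : ∃ x ∈ e.Q.support, ∃ r : G.Walk x u, r.length ≤ d ∧
      ∀ y ∈ r.support, y ∉ ball G (Set.range γ) d := by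
  rcases e.mem_verts_cases hu with ⟨huQ, -⟩ | ⟨k, -, -, x, hx, p, hp, hpl, hup⟩
  · exact ⟨u, huQ, .nil, by simp, by simpa using hfar⟩
  · obtain ⟨r, hr, hravoid⟩ := hp.exists_walk_notMem_ball hup hfar
    exact ⟨x, hx, r, by omega, hravoid⟩

lemma lt_length_of_high {e f : Ear G g γ d}
    (hQ : ∀ u ∈ e.Q.support, ∀ w ∈ f.Q.support, ∀ q : G.Walk u w,
      (∀ y ∈ q.support, y ∉ ball G (Set.range γ) d) → 2 * d < q.length)
    {u w : V} (hu : u ∈ e.Q.support) (huhigh : u ∉ ball G (Set.range γ) (2 * d))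
    (hw : w ∈ f.verts) (q : G.Walk u w) : d < q.length := by
  by_contra! hq
  have hqavoid : ∀ z ∈ q.support, z ∉ ball G (Set.range γ) d := fun z hz =>
    notMem_ball_of_walk (by rwa [← two_mul]) q hq hz
  obtain ⟨x, hx, r, hr, hravoid⟩ := f.exists_walk_of_mem_verts hw (hqavoid w q.end_mem_support)
  have := hQ u hu x hx (q.append r.reverse) fun y hy => by
    rw [Walk.mem_support_append_iff, Walk.support_reverse, List.mem_reverse] at hy
    exact hy.elim (hqavoid y) (hravoid y)
  rw [Walk.length_append, Walk.length_reverse] at this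
  omega

end Ear

/-- Close to the cycle it is the positions of the attachments that keep two ears apart, since a
short walk between their descents would be a shortcut for the cycle. -/
lemma IsShortestCycle.far_of_walks (hC : IsShortestCycle G g γ) (hg : 10 * d < g)
    {e f : Ear G g γ d}
    (hQ : ∀ u ∈ e.Q.support, ∀ w ∈ f.Q.support, ∀ q : G.Walk u w,
      (∀ y ∈ q.support, y ∉ ball G (Set.range γ) d) → 2 * d < q.length)
    (hii : d < cyc g e.i f.i) (hij : d < cyc g e.i f.j) (hji : d < cyc g e.j f.i)
    (hjj : d < cyc g e.j f.j) : e.Far f := by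
  refine ⟨fun u hu w hw q => ?_, hii, hij, hji, hjj⟩
  rcases e.mem_verts_cases hu with ⟨huQ, huhigh⟩ | ⟨k, hk, hki, _, _, p, hp, hpl, hup⟩
  · exact Ear.lt_length_of_high hQ huQ huhigh hw q
  rcases f.mem_verts_cases hw with ⟨hwQ, hwhigh⟩ | ⟨l, hl, hli, _, _, r, hr, hrl, hwr⟩
  · rw [← Walk.length_reverse]
    exact Ear.lt_length_of_high (fun u hu w hw q hq => by
      simpa using hQ w hw u hu q.reverse (by simpa using hq)) hwQ hwhigh hu q.reverse
  · by_contra! hq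
    have := (hC.cyc_le_of_anchored hk hl ((hp.anchored hup).mono hpl.le)
      ((hr.anchored hwr).mono hrl.le) q hq (by omega)).1
    rcases hki with rfl | rfl <;> rcases hli with rfl | rfl <;> omega

/-- The vertices of the cycle within distance `d` of the position `i`. -/
def arcAround (g : ℕ) (γ : ℕ → V) (d i : ℕ) : Set V := {x | ∃ k < g, cyc g k i ≤ d ∧ γ k = x}

/-- The vertex `t` and the two arcs around the positions `i` and `j`. For `t` the top of an ear
attached at `i` and `j`, an ear that avoids `B(earTrace, 2 * d)` is far from this one. -/
def earTrace (g : ℕ) (γ : ℕ → V) (d : ℕ) (t : V) (i j : ℕ) : Set V :=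
  {t} ∪ arcAround g γ d i ∪ arcAround g γ d j

namespace Ear

/-- The ear avoids the ball around `Z`. -/
def Survives (e : Ear G g γ d) (Z : Set V) : Prop := ∀ x ∈ e.Q.support, x ∉ ball G Z (2 * d)

namespace Survives

variable {e : Ear G g γ d} {Z Z' : Set V}

lemma mono (h : e.Survives Z') (hZ : Z ⊆ Z') : e.Survives Z :=
  fun x hx hb => h x hx (ball_mono hZ le_rfl hb)

lemma swap (h : e.Survives Z) : e.swap.Survives Z := fun x hx => h x (by simpa [Ear.swap] using hx)

lemma notMem (h : e.Survives Z) : γ e.i ∉ Z := fun hZ =>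
  h e.a e.Q.start_mem_support (mem_ball_iff.mpr ⟨γ e.i, hZ, e.pa, e.pa_length.le⟩)

lemma lt_cyc {t : V} {i j : ℕ} (h : e.Survives (earTrace g γ d t i j)) :
    d < cyc g i e.i ∧ d < cyc g j e.i := by
  rw [cyc_comm g i, cyc_comm g j]
  constructor <;> by_contra! hle
  · exact h.notMem (.inl (.inr ⟨e.i, e.hi, hle, rfl⟩))
  · exact h.notMem (.inr ⟨e.i, e.hi, hle, rfl⟩)

end Survives

end Ear

namespace IsShortestCycle

lemma exists_deepest_ear [Finite V] (hC : IsShortestCycle G g γ) (hd : 1 ≤ d) (hg : 8 * d + 2 < g)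
    (hF : (restrict G (ball G (Set.range γ) d)ᶜ).IsAcyclic) {dep : V → ℕ} {M : ℕ}
    (hM : ∀ v, dep v ≤ M) {Z : Set V} (hZ : γ 0 ∈ Z)
    (hcyc : ¬ (restrict G (ball G Z (2 * d))ᶜ).IsAcyclic) :
    ∃ (e : Ear G g γ d) (t : V), t ∈ e.Q.support ∧ e.Survives Z ∧
      (∀ x ∈ e.Q.support, dep t ≤ dep x) ∧
      ∀ f : Ear G g γ d, f.Survives Z → ∃ s ∈ f.Q.support, dep s ≤ dep t := by
  classical
  let IsLowerBound (k : ℕ) : Prop :=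
    ∃ e : Ear G g γ d, e.Survives Z ∧ ∀ x ∈ e.Q.support, k ≤ dep x
  have hzero : IsLowerBound 0 := by
    obtain ⟨e, he⟩ := hC.exists_ear hd hg hF hcyc (fun h => h (subset_ball _ _ hZ))
    exact ⟨e, he, fun _ _ => Nat.zero_le _⟩
  have hle (k) (hk : IsLowerBound k) : k ≤ M := by
    obtain ⟨e, -, h⟩ := hk
    exact (h _ e.Q.start_mem_support).trans (hM _)
  obtain ⟨e, he, hdep⟩ := Nat.findGreatest_spec (Nat.zero_le M) hzero
  obtain ⟨t, ht, htmin⟩ := Set.exists_min_image {x | x ∈ e.Q.support} dep (Set.toFinite _)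
    ⟨_, e.Q.start_mem_support⟩
  refine ⟨e, t, ht, he, htmin, fun f hf => ?_⟩
  by_contra! hdeeper
  have hnext : IsLowerBound (dep t + 1) := ⟨f, hf, hdeeper⟩
  have := Nat.le_findGreatest (hle _ hnext) hnext
  have := hdep t ht
  omega

lemma far_of_survives (hC : IsShortestCycle G g γ) (hd : 1 ≤ d) (hg : 10 * d < g)
    (hF : (restrict G (ball G (Set.range γ) d)ᶜ).IsAcyclic) {e f : Ear G g γ d} {t s : V}
    (ht : t ∈ e.Q.support)
    (hmin : ∀ x ∈ e.Q.support, depth (restrict G (ball G (Set.range γ) d)ᶜ) t ≤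
      depth (restrict G (ball G (Set.range γ) d)ᶜ) x)
    (hs : s ∈ f.Q.support)
    (hst : depth (restrict G (ball G (Set.range γ) d)ᶜ) s ≤
      depth (restrict G (ball G (Set.range γ) d)ᶜ) t)
    (hf : f.Survives (earTrace g γ d t e.i e.j)) : e.Far f := by
  classical
  refine hC.far_of_walks hg (fun u hu w hw q hq => ?_) hf.lt_cyc.1 hf.swap.lt_cyc.1 hf.lt_cyc.2
    hf.swap.lt_cyc.2
  by_contra! hlen
  obtain ⟨Q, -, hQ⟩ := exists_walk_restrict (S := (ball G (Set.range γ) d)ᶜ) e.Q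
    fun x hx => e.notMem_ball_of_mem_Q hd hx
  obtain ⟨R, hR⟩ := exists_subwalk f.Q hs hw
  obtain ⟨W, -, hW⟩ := exists_walk_restrict (S := (ball G (Set.range γ) d)ᶜ)
    (R.append q.reverse) fun x hx => by
      rw [Walk.mem_support_append_iff, Walk.support_reverse, List.mem_reverse] at hx
      exact hx.elim (fun h => f.notMem_ball_of_mem_Q hd (hR x h)) (hq x)
  have htW := mem_support_of_depth_le hF (Q := Q) (by rwa [hQ]) (by rwa [hQ]) hst W (by rwa [hQ])
  rw [hW, Walk.mem_support_append_iff, Walk.support_reverse, List.mem_reverse] at htW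
  have htrace : t ∈ earTrace g γ d t e.i e.j := .inl (.inl rfl)
  rcases htW with htR | htq
  · exact hf t (hR t htR) (subset_ball _ _ htrace)
  · refine hf w hw (mem_ball_iff.mpr ⟨t, htrace, (q.dropUntil t htq).reverse, ?_⟩)
    rw [Walk.length_reverse]
    exact (q.length_dropUntil_le_length htq).trans hlen

/-- Ears are chosen greedily, each of them with the deepest top among those that survive the traces
of the previous ones. -/
lemma traces_or_far_ears [Finite V] (hC : IsShortestCycle G g γ) (hd : 1 ≤ d)
    (hg : 10 * d + 2 < g) (hF : (restrict G (ball G (Set.range γ) d)ᶜ).IsAcyclic) (n : ℕ) :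
    (∃ (t : Fin n → V) (i j : Fin n → ℕ), (∀ l, i l < g) ∧ (∀ l, j l < g) ∧
      (restrict G (ball G ({γ 0} ∪ ⋃ l, earTrace g γ d (t l) (i l) (j l)) (2 * d))ᶜ).IsAcyclic) ∨
    ∃ e : Fin (n + 1) → Ear G g γ d, ∀ k l, k < l → (e k).Far (e l) := by
  classical
  have hmono {Z Z' : Set V} (h : Z ⊆ Z') (hZ : (restrict G (ball G Z (2 * d))ᶜ).IsAcyclic) :
      (restrict G (ball G Z' (2 * d))ᶜ).IsAcyclic :=
    isAcyclic_restrict_compl_mono (ball_mono h le_rfl) hZ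
  have hpos : 0 < g := by omega
  by_cases hzero : (restrict G (ball G {γ 0} (2 * d))ᶜ).IsAcyclic
  · exact .inl ⟨fun _ => γ 0, fun _ => 0, fun _ => 0, fun _ => hpos, fun _ => hpos,
      hmono Set.subset_union_left hzero⟩
  have hnext (Z : Set V) (hZ : γ 0 ∈ Z) (hcyc : ¬ (restrict G (ball G Z (2 * d))ᶜ).IsAcyclic) :=
    hC.exists_deepest_ear hd (by omega) hF
      (fun v => (depth_lt_card (restrict G (ball G (Set.range γ) d)ᶜ) v).le) hZ hcyc
  have hV : Nonempty V := ⟨γ 0⟩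
  have hEar : Nonempty (Ear G g γ d) := ⟨(hnext {γ 0} rfl hzero).choose⟩
  choose! next top htop hsurvives hmin hdeepest using hnext
  let Z (k : ℕ) : Set V :=
    k.rec {γ 0} fun _ Z => Z ∪ earTrace g γ d (top Z) (next Z).i (next Z).j
  have hZmono : Monotone Z := monotone_nat_of_le_succ fun _ => Set.subset_union_left
  have hZ0 (k) : γ 0 ∈ Z k := hZmono (Nat.zero_le k) rfl
  have hZn (k) : Z k ⊆ {γ 0} ∪ ⋃ l : Fin k,
      earTrace g γ d (top (Z l)) (next (Z l)).i (next (Z l)).j := by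
    induction k with
    | zero => exact Set.subset_union_left
    | succ k ih =>
      rintro x (hx | hx)
      · refine (ih hx).imp_right fun h => ?_
        obtain ⟨l, hl⟩ := Set.mem_iUnion.mp h
        exact Set.mem_iUnion.mpr ⟨l.castSucc, hl⟩
      · exact .inr (Set.mem_iUnion.mpr ⟨Fin.last k, hx⟩)
  by_cases hn : (restrict G (ball G (Z n) (2 * d))ᶜ).IsAcyclic
  · exact .inl ⟨_, _, _, fun l => (next (Z l)).hi, fun l => (next (Z l)).hj, hmono (hZn n) hn⟩
  have hcyc (k : Fin (n + 1)) : ¬ (restrict G (ball G (Z k) (2 * d))ᶜ).IsAcyclic :=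
    fun h => hn (hmono (hZmono (Nat.lt_succ_iff.mp k.2)) h)
  refine .inr ⟨fun k => next (Z k), fun k l hkl => ?_⟩
  have hl := hsurvives _ (hZ0 l) (hcyc l)
  have hkZ : Z (k + 1) ⊆ Z l := hZmono hkl
  obtain ⟨s, hs, hst⟩ := hdeepest _ (hZ0 k) (hcyc k) _ (hl.mono (hZmono hkl.le))
  exact hC.far_of_survives hd (by omega) hF (htop _ (hZ0 k) (hcyc k)) (hmin _ (hZ0 k) (hcyc k)) hs
    hst (hl.mono (Set.subset_union_right.trans hkZ))

end IsShortestCycle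

end Ears

/-! ### Packings of two cycles -/

section Packings

variable {V : Type*} {G : SimpleGraph V} {g d : ℕ} {γ : ℕ → V}

/-- A closed chain of four geodesic pieces. -/
def cycleSet (D : V → V → ℕ) (p : Fin 14 → V) : Set V :=
  between D (p 0) (p 1) ∪ between D (p 1) (p 2) ∪ between D (p 2) (p 3) ∪ between D (p 3) (p 0)

/-- A closed chain of ten geodesic pieces, two of them for the second distance function. -/
def chainSet (D D' : V → V → ℕ) (p : Fin 14 → V) : Set V :=
  between D' (p 4) (p 5) ∪ (between D (p 5) (p 8) ∪ between D (p 8) (p 9) ∪ between D (p 9) (p 10) ∪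
    between D (p 10) (p 7)) ∪ between D' (p 7) (p 6) ∪ (between D (p 6) (p 11) ∪
    between D (p 11) (p 12) ∪ between D (p 12) (p 13) ∪ between D (p 13) (p 4))

/-- The graph `G` without the ball of radius `d` around `cycleSet`. -/
def awayFromCycle (G : SimpleGraph V) (M d : ℕ) (p : Fin 14 → V) : SimpleGraph V :=
  restrict G (ball G (cycleSet (cappedDist G M) p) d)ᶜ

/-- The tuple `p` describes two cycles at distance more than `d`. -/
def IsPackingTuple (G : SimpleGraph V) (M d : ℕ) (p : Fin 14 → V) : Prop :=
  ¬ (restrict G (chainSet (cappedDist G M) (cappedDist (awayFromCycle G M d p) M) p)).IsAcyclic ∧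
    ¬ (restrict G (ball G (chainSet (cappedDist G M)
      (cappedDist (awayFromCycle G M d p) M) p) d)ᶜ).IsAcyclic

lemma lt_cyc_iff_of_le {i j : ℕ} (hij : i ≤ j) :
    d < cyc g i j ↔ i + d < j ∧ j + d < i + g := by
  unfold cyc
  omega

lemma lt_cyc_iff_of_ge {i j : ℕ} (hij : j ≤ i) :
    d < cyc g i j ↔ j + d < i ∧ i + d < j + g :=
  cyc_comm g i j ▸ lt_cyc_iff_of_le hij

namespace Ear

lemma verts_eq_union (e : Ear G g γ d) :
    e.verts = {x | x ∈ e.Q.support} ∪ ({x | x ∈ e.pa.support} ∪ {x | x ∈ e.pb.support}) :=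
  rfl

lemma verts_swap (e : Ear G g γ d) : e.swap.verts = e.verts := by
  ext x
  simp only [verts, swap, Walk.support_reverse, List.mem_reverse, Set.mem_ofPred_eq]
  tauto

lemma Far.swap_left {e f : Ear G g γ d} (h : e.Far f) : e.swap.Far f := by
  obtain ⟨hwalk, hii, hij, hji, hjj⟩ := h
  exact ⟨by rwa [verts_swap], hji, hjj, hii, hij⟩

lemma Far.swap_right {e f : Ear G g γ d} (h : e.Far f) : e.Far f.swap := h.symm.swap_left.symm

lemma not_isAcyclic_of_walk (e : Ear G g γ d) {S : Set V} (hS : e.verts ⊆ S)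
    (q : G.Walk (γ e.i) (γ e.j)) (hzq : e.z ∉ q.support) (hq : ∀ x ∈ q.support, x ∈ S) :
    ¬ (restrict G S).IsAcyclic := by
  refine not_isAcyclic_restrict_of_notMem_support (q := e.pa.append (q.append e.pb.reverse))
    e.isPath e.z_mem (fun hz => ?_) (fun x hx => hS (.inl hx)) fun x hx => ?_
  · simp only [Walk.mem_support_append_iff, Walk.support_reverse, List.mem_reverse] at hz
    rcases hz with hz | hz | hz
    · exact e.z_high (e.pa_length ▸ e.pa_isDescent.mem_ball hz)
    · exact hzq hz
    · exact e.z_high (e.pb_length ▸ e.pb_isDescent.mem_ball hz)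
  · simp only [Walk.mem_support_append_iff, Walk.support_reverse, List.mem_reverse] at hx
    rcases hx with hx | hx | hx
    · exact hS (.inr (.inl hx))
    · exact hq x hx
    · exact hS (.inr (.inr hx))

lemma z_notMem_range (e : Ear G g γ d) : e.z ∉ Set.range γ :=
  fun h => e.z_high (subset_ball _ _ h)

end Ear

/-- The union of the ears in `E` and of the vertices of the cycle at the positions in `I`. -/
def earUnion (E : Set (Ear G g γ d)) (I : Set ℕ) : Set V :=
  {x | (∃ e ∈ E, x ∈ e.verts) ∨ ∃ k ∈ I, γ k = x}

lemma earUnion_pair (e f : Ear G g γ d) (I : Set ℕ) :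
    earUnion {e, f} I = e.verts ∪ f.verts ∪ γ '' I := by
  ext x
  simp only [earUnion, Set.mem_ofPred_eq, Set.mem_insert_iff, Set.mem_singleton_iff,
    or_and_right, exists_or, exists_eq_left, Set.mem_union, Set.mem_image]

/-- The ears in `E` are attached at positions in `I`, and their union contains a cycle. -/
structure IsLoop (E : Set (Ear G g γ d)) (I : Set ℕ) : Prop where
  lt : ∀ k ∈ I, k < g
  i_mem : ∀ e ∈ E, e.i ∈ I
  j_mem : ∀ e ∈ E, e.j ∈ I
  not_isAcyclic : ¬ (restrict G (earUnion E I)).IsAcyclic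

namespace IsCyclicSeq

lemma isLoop_inner (hC : IsCyclicSeq G g γ) {e : Ear G g γ d} (hij : e.i ≤ e.j) :
    IsLoop {e} (Set.Icc e.i e.j) := by
  have hj := e.hj
  refine ⟨fun k hk => hk.2.trans_lt hj, ?_, ?_, ?_⟩
  · rintro _ rfl
    exact ⟨le_rfl, hij⟩
  · rintro _ rfl
    exact ⟨hij, le_rfl⟩
  · obtain ⟨A, -, -, hA⟩ := hC.exists_arc hij (by omega)
    refine e.not_isAcyclic_of_walk (fun x hx => .inl ⟨e, rfl, hx⟩) A (fun hz => ?_) fun x hx => ?_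
    · obtain ⟨k, -, -, hk⟩ := (hA e.z).mp hz
      exact e.z_notMem_range ⟨k, hk⟩
    · obtain ⟨k, hik, hkj, rfl⟩ := (hA x).mp hx
      exact .inr ⟨k, ⟨hik, hkj⟩, rfl⟩

lemma isLoop_outer (hC : IsCyclicSeq G g γ) {e : Ear G g γ d} (hij : e.i < e.j) :
    IsLoop {e} {k | k < g ∧ (k ≤ e.i ∨ e.j ≤ k)} := by
  have hi := e.hi
  have hj := e.hj
  refine ⟨fun k hk => hk.1, ?_, ?_, ?_⟩
  · rintro _ rfl
    exact ⟨hi, .inl le_rfl⟩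
  · rintro _ rfl
    exact ⟨hj, .inr le_rfl⟩
  · obtain ⟨A, -, -, hA⟩ := hC.exists_arc (i := e.j) (j := e.i + g) (by omega) (by omega)
    have hA' (x) : x ∈ (A.copy rfl (hC.periodic _)).reverse.support ↔
        ∃ k, e.j ≤ k ∧ k ≤ e.i + g ∧ γ k = x := by
      rw [Walk.support_reverse, Walk.support_copy, List.mem_reverse, hA]
    refine e.not_isAcyclic_of_walk (fun x hx => .inl ⟨e, rfl, hx⟩)
      (A.copy rfl (hC.periodic _)).reverse (fun hz => ?_) fun x hx => .inr ?_
    · obtain ⟨k, -, -, hk⟩ := (hA' _).mp hz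
      exact e.z_notMem_range ⟨k, hk⟩
    · obtain ⟨k, hjk, hki, rfl⟩ := (hA' _).mp hx
      rcases lt_or_ge k g with hkg | hgk
      · exact ⟨k, ⟨hkg, .inr hjk⟩, rfl⟩
      · obtain ⟨k, rfl⟩ := Nat.exists_eq_add_of_le' hgk
        exact ⟨k, ⟨by omega, .inl (by omega)⟩, (hC.periodic k).symm⟩

lemma isLoop_pair (hC : IsCyclicSeq G g γ) {e f : Ear G g γ d} (hfar : e.Far f)
    (hii : e.i ≤ f.i) (hjj : e.j ≤ f.j) :
    IsLoop {e, f} (Set.Icc e.i f.i ∪ Set.Icc e.j f.j) := by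
  have hi := f.hi
  have hj := f.hj
  refine ⟨?_, ?_, ?_, ?_⟩
  · rintro k (⟨-, hk⟩ | ⟨-, hk⟩) <;> omega
  · rintro x (rfl | rfl) <;> simp only [Set.mem_union, Set.mem_Icc] <;> omega
  · rintro x (rfl | rfl) <;> simp only [Set.mem_union, Set.mem_Icc] <;> omega
  obtain ⟨A, -, -, hA⟩ := hC.exists_arc hii (by omega)
  obtain ⟨B, -, -, hB⟩ := hC.exists_arc hjj (by omega)
  let S := A.append (f.pa.reverse.append (f.Q.append (f.pb.append B.reverse)))
  have hS {x : V} (hx : x ∈ S.support) : x ∈ A.support ∨ x ∈ B.support ∨ x ∈ f.verts := by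
    simp only [S, Walk.mem_support_append_iff, Walk.support_reverse, List.mem_reverse] at hx
    rw [Ear.verts, Set.mem_ofPred_eq]
    tauto
  refine e.not_isAcyclic_of_walk (fun x hx => .inl ⟨e, .inl rfl, hx⟩) S (fun hz => ?_)
    fun x hx => ?_
  · rcases hS hz with hz | hz | hz
    · obtain ⟨k, -, -, hk⟩ := (hA _).mp hz
      exact e.z_notMem_range ⟨k, hk⟩
    · obtain ⟨k, -, -, hk⟩ := (hB _).mp hz
      exact e.z_notMem_range ⟨k, hk⟩
    · simpa using hfar.1 e.z (.inl e.z_mem) e.z hz .nil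
  · rcases hS hx with hx | hx | hx
    · obtain ⟨k, hik, hki, rfl⟩ := (hA x).mp hx
      exact .inr ⟨k, .inl ⟨hik, hki⟩, rfl⟩
    · obtain ⟨k, hjk, hkj, rfl⟩ := (hB x).mp hx
      exact .inr ⟨k, .inr ⟨hjk, hkj⟩, rfl⟩
    · exact .inl ⟨f, .inr rfl, hx⟩

end IsCyclicSeq

namespace IsShortestCycle

lemma cyc_le_of_mem_verts (hC : IsShortestCycle G g γ) (hg : 10 * d < g) {f : Ear G g γ d} {k : ℕ}
    (hk : k < g) {w : V} (hw : w ∈ f.verts) (q : G.Walk (γ k) w) (hq : q.length ≤ d) :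
    cyc g k f.i ≤ d ∨ cyc g k f.j ≤ d := by
  rcases f.mem_verts_cases hw with ⟨-, hhigh⟩ | ⟨l, hl, hli, _, _, p, hp, hpl, hwp⟩
  · have hlow : w ∈ ball G (Set.range γ) (2 * d) :=
      mem_ball_iff.mpr ⟨γ k, ⟨k, rfl⟩, q.reverse, by rw [Walk.length_reverse]; omega⟩
    exact absurd hlow hhigh
  · have := (hC.cyc_le_of_anchored hk hl (Anchored.refl _ (2 * d) _)
      ((hp.anchored hwp).mono hpl.le) q hq (by omega)).1
    rcases hli with rfl | rfl
    · exact .inl this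
    · exact .inr this

lemma lt_length_of_isLoop (hC : IsShortestCycle G g γ) (hg : 10 * d < g)
    {E E' : Set (Ear G g γ d)} {I I' : Set ℕ} (hE : IsLoop E I) (hE' : IsLoop E' I')
    (hEE : ∀ e ∈ E, ∀ f ∈ E', e.Far f) (hII : ∀ k ∈ I, ∀ l ∈ I', d < cyc g k l) {u v : V}
    (hu : u ∈ earUnion E I) (hv : v ∈ earUnion E' I') (q : G.Walk u v) : d < q.length := by
  by_contra! hq
  rcases hu with ⟨e, he, hu⟩ | ⟨k, hk, rfl⟩ <;> rcases hv with ⟨f, hf, hv⟩ | ⟨l, hl, rfl⟩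
  · exact hq.not_gt ((hEE e he f hf).1 u hu v hv q)
  · have := hC.cyc_le_of_mem_verts hg (hE'.lt l hl) hu q.reverse (by simpa using hq)
    have hi := hII _ (hE.i_mem e he) l hl
    have hj := hII _ (hE.j_mem e he) l hl
    rw [cyc_comm] at hi hj
    omega
  · have := hC.cyc_le_of_mem_verts hg (hE.lt k hk) hv q hq
    have hi := hII k hk _ (hE'.i_mem f hf)
    have hj := hII k hk _ (hE'.j_mem f hf)
    omega
  · have := (hC.cyc_le_of_anchored (hE.lt k hk) (hE'.lt l hl) (Anchored.refl _ (2 * d) _)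
      (Anchored.refl _ (2 * d) _) q hq (by omega)).1
    exact this.not_gt (hII k hk l hl)

lemma isPackingTuple_of_isLoop (hC : IsShortestCycle G g γ) (hg : 10 * d < g)
    {E E' : Set (Ear G g γ d)} {I I' : Set ℕ} (hE : IsLoop E I) (hE' : IsLoop E' I')
    (hEE : ∀ e ∈ E, ∀ f ∈ E', e.Far f) (hII : ∀ k ∈ I, ∀ l ∈ I', d < cyc g k l) {M : ℕ}
    {p : Fin 14 → V}
    (hp : chainSet (cappedDist G M) (cappedDist (awayFromCycle G M d p) M) p = earUnion E I) :
    IsPackingTuple G M d p := by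
  refine ⟨hp ▸ hE.not_isAcyclic, fun h => hE'.not_isAcyclic (h.anti (restrict_mono ?_))⟩
  rw [hp]
  intro u hu hub
  obtain ⟨v, hv, q, hq⟩ := mem_ball_iff.mp hub
  have := hC.lt_length_of_isLoop hg hE hE' hEE hII hv hu q.reverse
  rw [Walk.length_reverse] at this
  omega

end IsShortestCycle

section Geodesics

variable [Fintype V] {M : ℕ}

namespace IsShortestCycle

lemma between_eq (hC : IsShortestCycle G g γ) (hM : Fintype.card V ≤ M) {u v : V} {A : G.Walk u v}
    (hA : A.IsPath) (hl : 2 * A.length < g) :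
    between (cappedDist G M) u v = {x | x ∈ A.support} :=
  between_eq_support hM fun _ hp _ => hC.path_unique hp hA (by omega)

lemma between_arc (hC : IsShortestCycle G g γ) (hM : Fintype.card V ≤ M) {i j : ℕ} (hij : i ≤ j)
    (hj : 2 * (j - i) < g) : between (cappedDist G M) (γ i) (γ j) = γ '' Set.Icc i j := by
  obtain ⟨A, hA, hl, hs⟩ := hC.exists_arc hij (by omega)
  rw [hC.between_eq hM hA (by omega)]
  ext x
  simp only [Set.mem_ofPred_eq, hs, Set.mem_image, Set.mem_Icc, and_assoc]

lemma between_arc_halves (hC : IsShortestCycle G g γ) (hM : Fintype.card V ≤ M) {i j : ℕ}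
    (hij : i ≤ j) (hj : j - i + 2 ≤ g) :
    between (cappedDist G M) (γ i) (γ (i + (j - i) / 2)) ∪
      between (cappedDist G M) (γ (i + (j - i) / 2)) (γ j) = γ '' Set.Icc i j := by
  rw [hC.between_arc hM (by omega) (by omega), hC.between_arc hM (by omega) (by omega),
    ← Set.image_union, Set.Icc_union_Icc_eq_Icc (by omega) (by omega)]

lemma cycleSet_eq (hC : IsShortestCycle G g γ) (hM : Fintype.card V ≤ M) {p : Fin 14 → V}
    (h0 : p 0 = γ 0) (h1 : p 1 = γ (g / 4)) (h2 : p 2 = γ (g / 2)) (h3 : p 3 = γ (3 * g / 4)) :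
    cycleSet (cappedDist G M) p = Set.range γ := by
  have h4 : p 0 = γ g := by rw [h0, ← hC.periodic 0, zero_add]
  have := hC.three_le
  have hlast : between (cappedDist G M) (p 3) (p 0) = γ '' Set.Icc (3 * g / 4) g := by
    rw [h3, h4, hC.between_arc hM (by omega) (by omega)]
  rw [cycleSet, hlast, h0, h1, h2, h3, hC.between_arc hM (by omega) (by omega),
    hC.between_arc hM (by omega) (by omega), hC.between_arc hM (by omega) (by omega),
    ← Set.image_union, ← Set.image_union, ← Set.image_union]
  refine (Set.image_subset_range _ _).antisymm fun x hx => ?_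
  obtain ⟨k, hk, rfl⟩ := hC.exists_lt_of_mem_range hx
  refine ⟨k, ?_, rfl⟩
  simp only [Set.mem_union, Set.mem_Icc]
  omega

end IsShortestCycle

lemma Ear.between_Q (e : Ear G g γ d) (hd : 1 ≤ d) (hM : Fintype.card V ≤ M)
    (hF : (restrict G (ball G (Set.range γ) d)ᶜ).IsAcyclic) :
    between (cappedDist (restrict G (ball G (Set.range γ) d)ᶜ) M) e.a e.b =
      {x | x ∈ e.Q.support} := by
  obtain ⟨q, -, hq⟩ := exists_walk_restrict (S := (ball G (Set.range γ) d)ᶜ) e.Q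
    fun x hx => e.notMem_ball_of_mem_Q hd hx
  have hqp : q.IsPath := by
    rw [Walk.isPath_def, hq]
    exact e.isPath.support_nodup
  rw [between_eq_support hM fun r hr _ =>
    congrArg Subtype.val ((hF.subsingleton_path _ _).elim ⟨r, hr⟩ ⟨q, hqp⟩), hq]

/-- Four points that cut the cycle into geodesics, and ten further points. -/
def chainTuple (g : ℕ) (γ : ℕ → V) (a b a' b' x y z x' y' z' : V) : Fin 14 → V :=
  ![γ 0, γ (g / 4), γ (g / 2), γ (3 * g / 4), a, b, a', b', x, y, z, x', y', z']

namespace IsShortestCycle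

lemma awayFromCycle_chainTuple (hC : IsShortestCycle G g γ) (hM : Fintype.card V ≤ M)
    (a b a' b' x y z x' y' z' : V) :
    awayFromCycle G M d (chainTuple g γ a b a' b' x y z x' y' z') =
      restrict G (ball G (Set.range γ) d)ᶜ := by
  rw [awayFromCycle, hC.cycleSet_eq hM rfl rfl rfl rfl]

lemma between_pa (hC : IsShortestCycle G g γ) (hg : 10 * d < g) (hM : Fintype.card V ≤ M)
    (e : Ear G g γ d) : between (cappedDist G M) e.a (γ e.i) = {x | x ∈ e.pa.support} :=
  hC.between_eq hM e.pa_isDescent.isPath (by rw [e.pa_length]; omega)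

lemma between_pb (hC : IsShortestCycle G g γ) (hg : 10 * d < g) (hM : Fintype.card V ≤ M)
    (e : Ear G g γ d) : between (cappedDist G M) e.b (γ e.j) = {x | x ∈ e.pb.support} :=
  hC.between_pa hg hM e.swap

lemma exists_chainSet_eq_of_ear (hC : IsShortestCycle G g γ) (hd : 1 ≤ d) (hg : 10 * d < g)
    (hM : Fintype.card V ≤ M) (hF : (restrict G (ball G (Set.range γ) d)ᶜ).IsAcyclic)
    {e : Ear G g γ d} (hij : e.i ≤ e.j) (hlen : e.j - e.i + 2 ≤ g) :
    ∃ p : Fin 14 → V, chainSet (cappedDist G M) (cappedDist (awayFromCycle G M d p) M) p =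
      earUnion {e} (Set.Icc e.i e.j) := by
  refine ⟨chainTuple g γ e.a e.b e.a e.a (γ e.j) (γ (e.i + (e.j - e.i) / 2)) (γ e.i)
    e.a e.a e.a, ?_⟩
  rw [hC.awayFromCycle_chainTuple hM]
  change between _ e.a e.b ∪ (between _ e.b (γ e.j) ∪
    between _ (γ e.j) (γ (e.i + (e.j - e.i) / 2)) ∪
    between _ (γ (e.i + (e.j - e.i) / 2)) (γ e.i) ∪ between _ (γ e.i) e.a) ∪ between _ e.a e.a ∪
    (between _ e.a e.a ∪ between _ e.a e.a ∪ between _ e.a e.a ∪ between _ e.a e.a) = _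
  rw [e.between_Q hd hM hF, hC.between_pb hg hM, between_comm M (γ e.j), between_comm M _ (γ e.i),
    between_comm M (γ e.i) e.a, hC.between_pa hg hM, between_self hM, between_self hM]
  ext x
  have harc := Set.ext_iff.mp (hC.between_arc_halves hM hij hlen) x
  have hx : x = e.a → x ∈ e.Q.support := fun h => h ▸ e.Q.start_mem_support
  simp only [Set.mem_union, Set.mem_image] at harc
  simp only [Set.mem_union, Set.mem_ofPred_eq, earUnion, Set.mem_singleton_iff, exists_eq_left,
    Ear.verts, ← harc]
  tauto

lemma exists_chainSet_eq_of_pair (hC : IsShortestCycle G g γ) (hd : 1 ≤ d) (hg : 10 * d < g)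
    (hM : Fintype.card V ≤ M) (hF : (restrict G (ball G (Set.range γ) d)ᶜ).IsAcyclic)
    {e f : Ear G g γ d} (hii : e.i ≤ f.i) (hilen : f.i - e.i + 2 ≤ g) (hjj : e.j ≤ f.j)
    (hjlen : f.j - e.j + 2 ≤ g) :
    ∃ p : Fin 14 → V, chainSet (cappedDist G M) (cappedDist (awayFromCycle G M d p) M) p =
      earUnion {e, f} (Set.Icc e.i f.i ∪ Set.Icc e.j f.j) := by
  refine ⟨chainTuple g γ e.a e.b f.a f.b (γ e.j) (γ (e.j + (f.j - e.j) / 2)) (γ f.j)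
    (γ f.i) (γ (e.i + (f.i - e.i) / 2)) (γ e.i), ?_⟩
  rw [hC.awayFromCycle_chainTuple hM]
  change between _ e.a e.b ∪ (between _ e.b (γ e.j) ∪
    between _ (γ e.j) (γ (e.j + (f.j - e.j) / 2)) ∪
    between _ (γ (e.j + (f.j - e.j) / 2)) (γ f.j) ∪ between _ (γ f.j) f.b) ∪ between _ f.b f.a ∪
    (between _ f.a (γ f.i) ∪ between _ (γ f.i) (γ (e.i + (f.i - e.i) / 2)) ∪
      between _ (γ (e.i + (f.i - e.i) / 2)) (γ e.i) ∪ between _ (γ e.i) e.a) = _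
  rw [e.between_Q hd hM hF, between_comm M f.b f.a, f.between_Q hd hM hF, hC.between_pb hg hM e,
    between_comm M (γ f.j) f.b, hC.between_pb hg hM f, hC.between_pa hg hM f,
    between_comm M (γ e.i) e.a, hC.between_pa hg hM e, between_comm M (γ f.i),
    between_comm M _ (γ e.i)]
  rw [earUnion_pair, Set.image_union, ← hC.between_arc_halves hM hii hilen,
    ← hC.between_arc_halves hM hjj hjlen, Ear.verts_eq_union,
    Ear.verts_eq_union]
  ac_rfl

lemma exists_isPackingTuple_of_disjoint_or_nested (hC : IsShortestCycle G g γ) (hd : 1 ≤ d)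
    (hg : 10 * d < g) (hM : Fintype.card V ≤ M)
    (hF : (restrict G (ball G (Set.range γ) d)ᶜ).IsAcyclic) {e f : Ear G g γ d} (hfar : e.Far f)
    (he : e.i ≤ e.j) (hf : f.i ≤ f.j) (hii : e.i ≤ f.i) (hji : f.i < e.j → f.j ≤ e.j) :
    ∃ p : Fin 14 → V, IsPackingTuple G M d p := by
  have hej := e.hj
  have hfj := f.hj
  obtain ⟨-, farii, farij, farji, farjj⟩ := id hfar
  rw [lt_cyc_iff_of_le (by omega)] at farii farij
  obtain ⟨p, hp⟩ := hC.exists_chainSet_eq_of_ear hd hg hM hF hf (by omega)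
  have hloop := hC.isLoop_inner hf
  have hEE : ∀ x ∈ ({f} : Set (Ear G g γ d)), ∀ y ∈ ({e} : Set (Ear G g γ d)), x.Far y := by
    rintro _ rfl _ rfl
    exact hfar.symm
  rcases lt_or_ge f.i e.j with hlt | hge
  · rw [lt_cyc_iff_of_ge (hji hlt)] at farjj
    refine ⟨p, hC.isPackingTuple_of_isLoop hg hloop (hC.isLoop_outer (by omega)) hEE ?_ hp⟩
    rintro k ⟨hik, hkj⟩ l ⟨hl, hl' | hl'⟩
    · exact (lt_cyc_iff_of_ge (by omega)).mpr (by omega)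
    · exact (lt_cyc_iff_of_le (by omega)).mpr (by omega)
  · rw [lt_cyc_iff_of_le hge] at farji
    refine ⟨p, hC.isPackingTuple_of_isLoop hg hloop (hC.isLoop_inner he) hEE ?_ hp⟩
    rintro k ⟨hik, hkj⟩ l ⟨hil, hlj⟩
    exact (lt_cyc_iff_of_ge (by omega)).mpr (by omega)

/-- The first two and the last two of four pairwise crossing ears give a cycle each. -/
lemma exists_isPackingTuple_of_crossing (hC : IsShortestCycle G g γ) (hd : 1 ≤ d)
    (hg : 10 * d < g) (hM : Fintype.card V ≤ M)
    (hF : (restrict G (ball G (Set.range γ) d)ᶜ).IsAcyclic) {e : Fin 4 → Ear G g γ d}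
    (hfar : ∀ k l, k < l → (e k).Far (e l)) (hsort : Monotone fun k => (e k).i)
    (hcross : ∀ k l, k < l → (e l).i < (e k).j ∧ (e k).j < (e l).j) :
    ∃ p : Fin 14 → V, IsPackingTuple G M d p := by
  obtain ⟨i1_lt_j0, j0_lt_j1⟩ := hcross 0 1 (by decide)
  obtain ⟨i2_lt_j1, j1_lt_j2⟩ := hcross 1 2 (by decide)
  obtain ⟨i3_lt_j0, j0_lt_j3⟩ := hcross 0 3 (by decide)
  obtain ⟨i3_lt_j2, j2_lt_j3⟩ := hcross 2 3 (by decide)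
  have sort01 : (e 0).i ≤ (e 1).i := hsort (by decide)
  have sort12 : (e 1).i ≤ (e 2).i := hsort (by decide)
  have sort23 : (e 2).i ≤ (e 3).i := hsort (by decide)
  obtain ⟨-, farii, farij, farji, farjj⟩ := hfar 1 2 (by decide)
  obtain ⟨-, farii', farij', farji', farjj'⟩ := hfar 0 3 (by decide)
  rw [lt_cyc_iff_of_le (by omega)] at farii farij farjj farii' farij' farjj'
  rw [lt_cyc_iff_of_ge (by omega)] at farji farji'
  obtain ⟨p, hp⟩ := hC.exists_chainSet_eq_of_pair hd hg hM hF (e := e 0) (f := e 1) sort01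
    (by omega) (by omega) (by omega)
  refine ⟨p, hC.isPackingTuple_of_isLoop hg
    (hC.isLoop_pair (hfar 0 1 (by decide)) (by omega) (by omega))
    (hC.isLoop_pair (hfar 2 3 (by decide)) (by omega) (by omega)) ?_ ?_ hp⟩
  · rintro x (rfl | rfl) y (rfl | rfl) <;> exact hfar _ _ (by decide)
  · rintro k (⟨hik, hki⟩ | ⟨hjk, hkj⟩) l (⟨hil, hli⟩ | ⟨hjl, hlj⟩)
    · exact (lt_cyc_iff_of_le (by omega)).mpr (by omega)
    · exact (lt_cyc_iff_of_le (by omega)).mpr (by omega)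
    · exact (lt_cyc_iff_of_ge (by omega)).mpr (by omega)
    · exact (lt_cyc_iff_of_le (by omega)).mpr (by omega)

end IsShortestCycle

end Geodesics

lemma Ear.exists_sorted_of_far {n : ℕ} {e : Fin n → Ear G g γ d}
    (hfar : ∀ k l, k < l → (e k).Far (e l)) :
    ∃ f : Fin n → Ear G g γ d, (∀ k l, k < l → (f k).Far (f l)) ∧ (∀ k, (f k).i ≤ (f k).j) ∧
      Monotone fun k => (f k).i := by
  let orient (e : Ear G g γ d) : Ear G g γ d := if e.i ≤ e.j then e else e.swap
  have horient (e : Ear G g γ d) : (orient e).i ≤ (orient e).j := by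
    dsimp only [orient]
    split_ifs with h
    · exact h
    · exact (not_le.mp h).le
  have hfar_orient (k l) (h : k < l) : (orient (e k)).Far (orient (e l)) := by
    have h := hfar k l h
    dsimp only [orient]
    split_ifs
    exacts [h, h.swap_right, h.swap_left, h.swap_left.swap_right]
  let σ := Tuple.sort fun k => (orient (e k)).i
  refine ⟨fun k => orient (e (σ k)), fun k l hkl => ?_, fun k => horient _,
    Tuple.monotone_sort fun k => (orient (e k)).i⟩
  rcases lt_or_gt_of_ne (σ.injective.ne hkl.ne) with h | h
  · exact hfar_orient _ _ h
  · exact (hfar_orient _ _ h).symm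

lemma IsShortestCycle.exists_isPackingTuple_of_far [Fintype V] {M : ℕ}
    (hC : IsShortestCycle G g γ) (hd : 1 ≤ d) (hg : 10 * d < g) (hM : Fintype.card V ≤ M)
    (hF : (restrict G (ball G (Set.range γ) d)ᶜ).IsAcyclic) {e : Fin 4 → Ear G g γ d}
    (hfar : ∀ k l, k < l → (e k).Far (e l)) : ∃ p : Fin 14 → V, IsPackingTuple G M d p := by
  obtain ⟨f, hfar, horient, hsort⟩ := Ear.exists_sorted_of_far hfar
  by_cases hcross : ∀ k l, k < l → (f l).i < (f k).j ∧ (f k).j < (f l).j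
  · exact hC.exists_isPackingTuple_of_crossing hd hg hM hF hfar hsort hcross
  · push Not at hcross
    obtain ⟨k, l, hkl, hcross⟩ := hcross
    exact hC.exists_isPackingTuple_of_disjoint_or_nested hd hg hM hF (hfar k l hkl) (horient k)
      (horient l) (hsort hkl.le) hcross

end Packings

/-! ### Hitting sets -/

section HittingSets

variable {V : Type*} {G : SimpleGraph V} {M g d : ℕ} {γ : ℕ → V}

/-- Twelve geodesic pieces and twelve vertices whose balls meet all cycles. -/
def HasHittingTuples (G : SimpleGraph V) (M d : ℕ) : Prop :=
  (∃ p q : Fin 12 → V, (⋃ k, between (cappedDist G M) (p k) (q k)).ncard ≤ 12 * (d + 1) ∧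
    (restrict G (ball G (⋃ k, between (cappedDist G M) (p k) (q k)) (2 * d))ᶜ).IsAcyclic) ∧
  ∃ p : Fin 12 → V, (restrict G (ball G (Set.range p) (3 * d))ᶜ).IsAcyclic

lemma hasHittingTuples_of_family {ι : Type*} [Fintype ι] [Nonempty ι] (hι : Fintype.card ι ≤ 12)
    (P Q R : ι → V) (hcard : ∑ k, (between (cappedDist G M) (P k) (Q k)).ncard ≤ 12 * (d + 1))
    (hpieces : (restrict G
      (ball G (⋃ k, between (cappedDist G M) (P k) (Q k)) (2 * d))ᶜ).IsAcyclic)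
    (hpoints : (restrict G (ball G (Set.range R) (3 * d))ᶜ).IsAcyclic) :
    HasHittingTuples G M d := by
  obtain ⟨f⟩ : Nonempty (ι ↪ Fin 12) :=
    Function.Embedding.nonempty_of_card_le (by rwa [Fintype.card_fin])
  have hf : Function.Surjective (Function.invFun f) := Function.invFun_surjective f.injective
  have hunion : (⋃ k, between (cappedDist G M) ((P ∘ Function.invFun f) k)
      ((Q ∘ Function.invFun f) k)) = ⋃ k, between (cappedDist G M) (P k) (Q k) :=
    hf.iUnion_comp fun k => between (cappedDist G M) (P k) (Q k)
  refine ⟨⟨P ∘ Function.invFun f, Q ∘ Function.invFun f, ?_, by rwa [hunion]⟩,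
    R ∘ Function.invFun f, by rwa [hf.range_comp]⟩
  rw [hunion]
  exact (Set.ncard_iUnion_le_of_fintype _).trans hcard

lemma IsCyclicSeq.arcAround_subset_ball (hC : IsCyclicSeq G g γ) {i : ℕ}
    (hi : i < g) : arcAround g γ d i ⊆ ball G {γ i} d := by
  rintro _ ⟨k, hk, hki, rfl⟩
  obtain ⟨A, -, hA, -⟩ := hC.exists_cyc_path hk hi
  exact mem_ball_iff.mpr ⟨γ i, rfl, A, hA.le.trans hki⟩

lemma IsCyclicSeq.isCore_range (hC : IsCyclicSeq G g γ) :
    IsCore G (Set.range γ) := by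
  have hthree := hC.three_le
  refine ⟨⟨γ 0, 0, rfl⟩, ?_⟩
  rintro _ ⟨k, rfl⟩
  have hpred : G.Adj (γ (k + g - 1)) (γ k) := by
    have := hC.adj (k + g - 1)
    rwa [Nat.sub_add_cancel (by omega), hC.periodic] at this
  exact ⟨γ (k + 1), ⟨_, rfl⟩, γ (k + g - 1), ⟨_, rfl⟩, hC.ne_of_lt (by omega) (by omega),
    hC.adj k, hpred.symm⟩

variable [Fintype V]

lemma hasHittingTuples_of_points (hM : Fintype.card V ≤ M) (p : Fin 12 → V)
    (h : (restrict G (ball G (Set.range p) (2 * d))ᶜ).IsAcyclic) : HasHittingTuples G M d := by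
  have hunion : (⋃ k, between (cappedDist G M) (p k) (p k)) = Set.range p := by
    simp only [between_self hM, Set.iUnion_singleton_eq_range]
  refine hasHittingTuples_of_family (by simp) p p p ?_ (by rwa [hunion])
    (isAcyclic_restrict_compl_mono (ball_mono subset_rfl (by omega)) h)
  simp [between_self hM]

namespace IsShortestCycle

lemma arcAround_subset_between (hC : IsShortestCycle G g γ) (hM : Fintype.card V ≤ M)
    (hg : 4 * d < g) {i : ℕ} (hi : i < g) :
    arcAround g γ d i ⊆ between (cappedDist G M) (γ (i + g - d)) (γ (i + g + d)) := by
  rintro x ⟨k, hk, hki, rfl⟩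
  rw [hC.between_arc hM (by omega) (by omega)]
  unfold cyc at hki
  by_cases hnear : i - k + (k - i) ≤ d
  · exact ⟨k + g, ⟨by omega, by omega⟩, hC.periodic k⟩
  rcases le_total i k with hik | hki
  · exact ⟨k, ⟨by omega, by omega⟩, rfl⟩
  · exact ⟨k + g + g, ⟨by omega, by omega⟩, by rw [hC.periodic, hC.periodic]⟩

lemma ncard_between_le (hC : IsShortestCycle G g γ) (hM : Fintype.card V ≤ M) (hg : 4 * d < g)
    (i : ℕ) : (between (cappedDist G M) (γ (i + g - d)) (γ (i + g + d))).ncard ≤ 2 * d + 1 := by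
  rw [hC.between_arc hM (by omega) (by omega)]
  refine (Set.ncard_image_le (Set.finite_Icc _ _)).trans ?_
  rw [Set.ncard_eq_toFinset_card', Set.toFinset_Icc, Nat.card_Icc]
  omega

lemma hasHittingTuples_of_arcs (hC : IsShortestCycle G g γ) (hM : Fintype.card V ≤ M)
    (hg : 4 * d < g) {ι κ : Type*} [Fintype ι] [Fintype κ] [Nonempty ι]
    (hcard : Fintype.card ι + Fintype.card κ ≤ 12)
    (hsize : Fintype.card ι + Fintype.card κ * (2 * d + 1) ≤ 12 * (d + 1)) (t : ι → V) (i : κ → ℕ)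
    (hi : ∀ l, i l < g)
    (h : (restrict G
      (ball G (Set.range t ∪ ⋃ l, arcAround g γ d (i l)) (2 * d))ᶜ).IsAcyclic) :
    HasHittingTuples G M d := by
  refine hasHittingTuples_of_family (by rwa [Fintype.card_sum])
    (Sum.elim t fun l => γ (i l + g - d)) (Sum.elim t fun l => γ (i l + g + d))
    (Sum.elim t fun l => γ (i l)) ?_ (isAcyclic_restrict_compl_mono (ball_mono ?_ le_rfl) h)
    (isAcyclic_restrict_compl_mono ?_ h)
  · have harcs := Finset.sum_le_card_nsmul Finset.univ _ _
      fun l _ => hC.ncard_between_le hM hg (i l)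
    simp only [Fintype.sum_sum_type, Sum.elim_inl, Sum.elim_inr, between_self hM,
      Set.ncard_singleton, Finset.sum_const, smul_eq_mul, mul_one, Finset.card_univ] at harcs ⊢
    omega
  · simp only [Set.iUnion_sum, Sum.elim_inl, Sum.elim_inr, between_self hM,
      Set.iUnion_singleton_eq_range]
    exact Set.union_subset_union_right _
      (Set.iUnion_mono fun l => hC.arcAround_subset_between hM hg (hi l))
  · intro x hx
    obtain ⟨v, hv, w, hw⟩ := mem_ball_iff.mp hx
    refine mem_ball_of_walk w (?_ : v ∈ ball G (Set.range _) d) (by omega)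
    rcases hv with ⟨l, rfl⟩ | hv
    · exact subset_ball _ _ ⟨.inl l, rfl⟩
    · obtain ⟨l, hv⟩ := Set.mem_iUnion.mp hv
      have hcenter : γ (i l) ∈ Set.range (Sum.elim t fun l => γ (i l)) := ⟨.inr l, rfl⟩
      exact ball_mono (Set.singleton_subset_iff.mpr hcenter) le_rfl
        (hC.arcAround_subset_ball (hi l) hv)

lemma hasHittingTuples_of_traces (hC : IsShortestCycle G g γ) (hM : Fintype.card V ≤ M)
    (hg : 4 * d < g) (t : Fin 3 → V) (i j : Fin 3 → ℕ) (hi : ∀ l, i l < g) (hj : ∀ l, j l < g)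
    (h : (restrict G
      (ball G ({γ 0} ∪ ⋃ l, earTrace g γ d (t l) (i l) (j l)) (2 * d))ᶜ).IsAcyclic) :
    HasHittingTuples G M d := by
  refine hC.hasHittingTuples_of_arcs (ι := Option (Fin 3)) (κ := Fin 3 ⊕ Fin 3) hM hg
    (by simp) (by simp only [Fintype.card_option, Fintype.card_sum, Fintype.card_fin]; omega)
    (fun l => l.elim (γ 0) t) (Sum.elim i j) (Sum.rec hi hj) ?_
  have htraces : (Set.range (fun l : Option (Fin 3) => l.elim (γ 0) t) ∪
      ⋃ l, arcAround g γ d (Sum.elim i j l)) =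
      {γ 0} ∪ ⋃ l, earTrace g γ d (t l) (i l) (j l) := by
    ext x
    simp only [Set.mem_union, Set.mem_range, Option.exists, Option.elim_none, Option.elim_some,
      Set.mem_iUnion, Sum.exists, Sum.elim_inl, Sum.elim_inr, earTrace, Set.mem_singleton_iff,
      exists_or, eq_comm (a := x), or_assoc]
  rwa [htraces]

lemma hasHittingTuples_of_le (hC : IsShortestCycle G g γ) (hM : Fintype.card V ≤ M)
    (hg : g ≤ 12 * (2 * d + 1)) (hF : (restrict G (ball G (Set.range γ) d)ᶜ).IsAcyclic) :
    HasHittingTuples G M d := by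
  have hwalk {a b : ℕ} (hab : a ≤ b) : ∃ p : G.Walk (γ a) (γ b), p.length = b - a := by
    obtain ⟨p, hp, -⟩ := exists_walk_of_seq (G := G) γ (b - a) a fun k _ _ => hC.adj k
    exact ⟨p.copy rfl (by congr 1; omega), by simpa using hp⟩
  refine hasHittingTuples_of_points hM (fun k : Fin 12 => γ (k * (2 * d + 1) + d))
    (isAcyclic_restrict_compl_mono (fun x hx => ?_) hF)
  obtain ⟨v, hv, w, hw⟩ := mem_ball_iff.mp hx
  obtain ⟨k, hk, rfl⟩ := hC.exists_lt_of_mem_range hv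
  refine mem_ball_of_walk w (r := d) ?_ (by omega)
  have hq : k / (2 * d + 1) < 12 := by
    rw [Nat.div_lt_iff_lt_mul (by omega)]
    omega
  have hdiv := Nat.div_add_mod' k (2 * d + 1)
  have hmod := Nat.mod_lt k (show 0 < 2 * d + 1 by omega)
  rcases le_total k (k / (2 * d + 1) * (2 * d + 1) + d) with hle | hle
  · obtain ⟨p, hp⟩ := hwalk hle
    exact mem_ball_iff.mpr ⟨_, ⟨⟨_, hq⟩, rfl⟩, p, hp.trans_le (by omega)⟩
  · obtain ⟨p, hp⟩ := hwalk hle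
    exact mem_ball_iff.mpr ⟨_, ⟨⟨_, hq⟩, rfl⟩, p.reverse,
      (p.length_reverse.trans hp).trans_le (by omega)⟩

lemma exists_isPackingTuple_of_not_isAcyclic (hC : IsShortestCycle G g γ)
    (hM : Fintype.card V ≤ M) (hF : ¬ (restrict G (ball G (Set.range γ) d)ᶜ).IsAcyclic) :
    ∃ p : Fin 14 → V, IsPackingTuple G M d p := by
  have hthree := hC.three_le
  let p := chainTuple g γ (γ 0) (γ 0) (γ 0) (γ 0) (γ (g / 4)) (γ (g / 2)) (γ (3 * g / 4))
    (γ 0) (γ 0) (γ 0)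
  have hstart : γ 0 ∈ between (cappedDist G M) (γ 0) (γ (g / 4)) := by
    rw [hC.between_arc hM (by omega) (by omega)]
    exact ⟨0, ⟨le_rfl, by omega⟩, rfl⟩
  have hchain : chainSet (cappedDist G M) (cappedDist (awayFromCycle G M d p) M) p =
      Set.range γ := by
    rw [← hC.cycleSet_eq hM (p := p) rfl rfl rfl rfl]
    change between _ (γ 0) (γ 0) ∪ cycleSet (cappedDist G M) p ∪ between _ (γ 0) (γ 0) ∪
      (between _ (γ 0) (γ 0) ∪ between _ (γ 0) (γ 0) ∪ between _ (γ 0) (γ 0) ∪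
        between _ (γ 0) (γ 0)) = _
    simp only [between_self hM, Set.union_self]
    have hmem : {γ 0} ⊆ cycleSet (cappedDist G M) p :=
      Set.singleton_subset_iff.mpr (.inl (.inl (.inl hstart)))
    rw [Set.union_eq_self_of_subset_left hmem, Set.union_eq_self_of_subset_right hmem,
      Set.union_eq_self_of_subset_right hmem]
  exact ⟨p, by rw [hchain]; exact not_isAcyclic_of_isCore subset_rfl hC.isCore_range,
    by rwa [hchain]⟩

end IsShortestCycle

theorem hasHittingTuples_or_isPackingTuple [Nonempty V] (hd : 1 ≤ d) (hM : Fintype.card V ≤ M) :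
    HasHittingTuples G M d ∨ ∃ p : Fin 14 → V, IsPackingTuple G M d p := by
  by_cases hac : G.IsAcyclic
  · exact .inl (hasHittingTuples_of_points hM (fun _ => Classical.arbitrary V)
      (hac.anti (restrict_le _)))
  obtain ⟨g, γ, hC⟩ := exists_isShortestCycle hac
  by_cases hF : (restrict G (ball G (Set.range γ) d)ᶜ).IsAcyclic
  · rcases le_or_gt g (12 * (2 * d + 1)) with hg | hg
    · exact .inl (hC.hasHittingTuples_of_le hM hg hF)
    · rcases hC.traces_or_far_ears hd (by omega) hF 3 with ⟨t, i, j, hi, hj, h⟩ | ⟨e, he⟩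
      · exact .inl (hC.hasHittingTuples_of_traces hM (by omega) t i j hi hj h)
      · exact .inr (hC.exists_isPackingTuple_of_far hd (by omega) hM hF he)
  · exact .inr (hC.exists_isPackingTuple_of_not_isAcyclic hM hF)

end HittingSets

/-! ### Terms with bounded sums and commands with bounded loops -/

/-- Terms; `sum x t` adds up the values of `t` for all values of `x` less than the size of the
graph. -/
inductive Tm where
  | lit (k : ℕ)
  | size
  | dist
  | v (x : ℕ)
  | arr (a : ℕ) (t u : Tm)
  | add (t u : Tm)
  | sub (t u : Tm)
  | ite (c t u : Tm)
  | sum (x : ℕ) (t : Tm)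

/-- The value of a term for the size `n`, the distance `d` and the memory `m`. -/
def Tm.den (n d : ℕ) : Tm → Store → ℕ
  | lit k, _ => k
  | size, _ => n
  | dist, _ => d
  | v x, m => m.var x
  | arr a t u, m => m.arr a (t.den n d m) (u.den n d m)
  | add t u, m => t.den n d m + u.den n d m
  | sub t u, m => t.den n d m - u.den n d m
  | ite c t u, m => if c.den n d m ≠ 0 then t.den n d m else u.den n d m
  | sum x t, m => ∑ i ∈ Finset.range n, t.den n d (m.setVar x i)

/-- Commands; `loop x P` runs `P` for all values of `x` less than the size of the graph. -/
inductive Cmd where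
  | skip
  | assign (x : ℕ) (t : Tm)
  | cell (a : ℕ) (t u w : Tm)
  | seq (P Q : Cmd)
  | ite (c : Tm) (P Q : Cmd)
  | loop (x : ℕ) (P : Cmd)

/-- The memory after a run of a command. -/
def Cmd.run (n d : ℕ) : Cmd → Store → Store
  | skip, m => m
  | assign x t, m => m.setVar x (t.den n d m)
  | cell a t u w, m => m.setArr a (t.den n d m) (u.den n d m) (w.den n d m)
  | seq P Q, m => Q.run n d (P.run n d m)
  | ite c P Q, m => if c.den n d m ≠ 0 then P.run n d m else Q.run n d m
  | loop x P, m => Nat.rec (motive := fun _ => Store) m (fun i m' => P.run n d (m'.setVar x i)) n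

section Store

variable (m : Store) (x k l : ℕ)

lemma setVar_setVar_same : (m.setVar x k).setVar x l = m.setVar x l := by
  ext y <;> simp only [Store.setVar]
  split_ifs <;> rfl

lemma setVar_self : m.setVar x (m.var x) = m := by
  ext y <;> simp only [Store.setVar]
  split_ifs with h
  · rw [h]
  · rfl

lemma setVar_var (y : ℕ) : (m.setVar x k).var y = if y = x then k else m.var y := rfl

@[simp]
lemma setVar_var_self : (m.setVar x k).var x = k := if_pos rfl

variable {x} in
lemma setVar_var_of_ne {y : ℕ} (h : y ≠ x) : (m.setVar x k).var y = m.var y := if_neg h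

@[simp]
lemma setVar_arr : (m.setVar x k).arr = m.arr := rfl

end Store

section Machine

/-- The machine memory that represents the memory `m` of commands: the registers `0` and `1` hold
`n` and `d`, the even registers from `2` on hold the variables of `m`, and the odd registers from
`3` on form the scratch space `r`. -/
def machine (n d : ℕ) (m : Store) (r : ℕ → ℕ) : Store where
  var
    | 0 => n
    | 1 => d
    | k + 2 => if Even k then m.var (k / 2) else r (k / 2)
  arr := m.arr

/-- The register that holds the variable `x`. -/
def varReg (x : ℕ) : ℕ := 2 * x + 2

/-- The register number `s` of the scratch space. -/
def scratchReg (s : ℕ) : ℕ := 2 * s + 3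

variable (n d : ℕ) (m : Store) (r : ℕ → ℕ)

@[simp]
lemma machine_var_zero : (machine n d m r).var 0 = n := rfl

@[simp]
lemma machine_var_varReg (x : ℕ) : (machine n d m r).var (varReg x) = m.var x := by
  simp [machine, varReg]

@[simp]
lemma machine_var_scratchReg (s : ℕ) : (machine n d m r).var (scratchReg s) = r s := by
  have h : (2 * s + 1) / 2 = s := by omega
  simp [machine, scratchReg, h]

@[simp]
lemma machine_arr : (machine n d m r).arr = m.arr := rfl

@[simp]
lemma machine_setVar_varReg (x k : ℕ) :
    (machine n d m r).setVar (varReg x) k = machine n d (m.setVar x k) r := by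
  ext y
  · rcases y with _ | _ | y
    · simp [Store.setVar, machine, varReg]
    · simp [Store.setVar, machine, varReg]
    · have h : y = 2 * x ↔ Even y ∧ y / 2 = x := by grind
      by_cases hy : Even y <;> simp [Store.setVar, machine, varReg, h, hy]
  · rfl

@[simp]
lemma machine_setVar_scratchReg (s k : ℕ) :
    (machine n d m r).setVar (scratchReg s) k = machine n d m (Function.update r s k) := by
  ext y
  · rcases y with _ | _ | y
    · simp [Store.setVar, machine, scratchReg]
    · simp [Store.setVar, machine, scratchReg]
    · have h : y = 2 * s + 1 ↔ ¬ Even y ∧ y / 2 = s := by grind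
      by_cases hy : Even y <;>
        simp [Store.setVar, machine, scratchReg, h, hy, Function.update_apply]
  · rfl

lemma machine_setArr (a i j k : ℕ) :
    (machine n d m r).setArr a i j k = machine n d (m.setArr a i j k) r := rfl

end Machine

/-- Some program writes the value of `f` to the scratch register `s` in a number of steps that is
polynomial in `n`; it keeps the lower scratch registers, so that these can hold intermediate
results. -/
def IsEvaluable (f : ℕ → ℕ → Store → ℕ) : Prop :=
  ∀ s, ∃ (P : Prog) (p : Polynomial ℕ), ∀ n d m r, ∃ r' c,
    Runs P (machine n d m r) (machine n d m r') c ∧ c ≤ p.eval n ∧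
      r' s = f n d m ∧ Set.EqOn r' r (Set.Iio s)

/-- Some program changes the memory by `F` in a number of steps that is polynomial in `n`; it
keeps the scratch registers below `s`. -/
def IsExecutable (F : ℕ → ℕ → Store → Store) : Prop :=
  ∀ s, ∃ (P : Prog) (p : Polynomial ℕ), ∀ n d m r, ∃ r' c,
    Runs P (machine n d m r) (machine n d (F n d m) r') c ∧ c ≤ p.eval n ∧
      Set.EqOn r' r (Set.Iio s)

lemma eqOn_update_Iio (r : ℕ → ℕ) {s s' : ℕ} (h : s ≤ s') (k : ℕ) :
    Set.EqOn (Function.update r s' k) r (Set.Iio s) :=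
  fun _ hi => Function.update_of_ne (hi.trans_le h).ne _ _

lemma runs_setVar_of_eval_eq {e : Expr} {σ : Store} {k : ℕ} (x : ℕ) (h : e.eval σ = k) :
    Runs (.setVar x e) σ (σ.setVar x k) (e.cost + 1) :=
  h ▸ .setVar x e σ

section Loop

/-- A program that runs `P` for all values of the variable `x` less than `n`, with the scratch
register `s` as the counter. -/
def forLoop (x s : ℕ) (P : Prog) : Prog :=
  .seq (.setVar (scratchReg s) (.lit 0)) (.loop (.sub (.var 0) (.var (scratchReg s)))
    (.seq (.setVar (varReg x) (.var (scratchReg s)))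
      (.seq P (.setVar (scratchReg s) (.add (.var (scratchReg s)) (.lit 1))))))

/-- The invariant is required to hold after the counter has been advanced. -/
theorem exists_runs_forLoop {P : Prog} {n d x s T : ℕ} {m : Store} {r : ℕ → ℕ}
    (Inv : ℕ → Store → (ℕ → ℕ) → Prop) (init : Inv 0 m (Function.update r s 0))
    (step : ∀ i < n, ∀ m r, Inv i m r → ∃ m' r' c,
      Runs P (machine n d (m.setVar x i) r) (machine n d m' r') c ∧ c ≤ T ∧ r' s = r s ∧
        Inv (i + 1) m' (Function.update r' s (i + 1))) :
    ∃ m' r' c, Runs (forLoop x s P) (machine n d m r) (machine n d m' r') c ∧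
      c ≤ n * (T + 10) + 6 ∧ Inv n m' r' := by
  have loop : ∀ k i m r, i + k = n → r s = i → Inv i m r → ∃ m' r' c,
      Runs (.loop (.sub (.var 0) (.var (scratchReg s))) (.seq (.setVar (varReg x)
        (.var (scratchReg s))) (.seq P (.setVar (scratchReg s)
          (.add (.var (scratchReg s)) (.lit 1)))))) (machine n d m r) (machine n d m' r') c ∧
      c ≤ k * (T + 10) + 4 ∧ Inv n m' r' := by
    intro k
    induction k with
    | zero =>
      intro i m r hi hs hInv
      exact ⟨m, r, _, .loop_done (by simp [Expr.eval]; omega), by simp [Expr.cost], hi ▸ hInv⟩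
    | succ k ih =>
      intro i m r hi hs hInv
      obtain ⟨m₁, r₁, c₁, hrun, hc₁, hs₁, hInv₁⟩ := step i (by omega) m r hInv
      obtain ⟨m₂, r₂, c₂, hrest, hc₂, hInv₂⟩ := ih (i + 1) m₁ _ (by omega)
        (Function.update_self ..) hInv₁
      have setX := runs_setVar_of_eval_eq (e := .var (scratchReg s)) (σ := machine n d m r)
        (varReg x) (by simp [Expr.eval, hs] : _ = i)
      have setCounter := runs_setVar_of_eval_eq (e := .add (.var (scratchReg s)) (.lit 1))
        (σ := machine n d m₁ r₁) (scratchReg s) (by simp [Expr.eval, hs₁, hs] : _ = i + 1)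
      rw [machine_setVar_varReg] at setX
      rw [machine_setVar_scratchReg] at setCounter
      refine ⟨m₂, r₂, _, .loop_step (by simp [Expr.eval]; omega)
        (.seq setX (.seq hrun setCounter)) hrest, ?_, hInv₂⟩
      simp only [Expr.cost]
      rw [Nat.succ_mul]
      omega
  obtain ⟨m', r', c, hrun, hc, hInv⟩ := loop n 0 m _ (by omega) (Function.update_self ..) init
  have setCounter := Runs.setVar (scratchReg s) (.lit 0) (machine n d m r)
  rw [machine_setVar_scratchReg] at setCounter
  exact ⟨m', r', _, .seq setCounter hrun, by simp only [Expr.cost]; omega, hInv⟩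

end Loop

section Evaluable

variable {f g h : ℕ → ℕ → Store → ℕ}

lemma isEvaluable_of_expr (e : Expr) (he : ∀ n d m r, e.eval (machine n d m r) = f n d m) :
    IsEvaluable f := by
  refine fun s => ⟨.setVar (scratchReg s) e, .C (e.cost + 1), fun n d m r => ?_⟩
  have hrun := runs_setVar_of_eval_eq (scratchReg s) (he n d m r)
  rw [machine_setVar_scratchReg] at hrun
  exact ⟨_, _, hrun, by simp, Function.update_self .., eqOn_update_Iio r le_rfl _⟩

lemma IsEvaluable.binary (hf : IsEvaluable f) (hg : IsEvaluable g)
    (op : ℕ → ℕ → Store → ℕ → ℕ → ℕ) (e : ℕ → ℕ → Expr) (k : ℕ) (hcost : ∀ x y, (e x y).cost ≤ k)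
    (heval : ∀ n d m r x y, (e (scratchReg x) (scratchReg y)).eval (machine n d m r) =
      op n d m (r x) (r y)) :
    IsEvaluable fun n d m => op n d m (f n d m) (g n d m) := by
  intro s
  obtain ⟨P, p, hP⟩ := hf s
  obtain ⟨Q, q, hQ⟩ := hg (s + 1)
  refine ⟨.seq P (.seq Q (.setVar (scratchReg s) (e (scratchReg s) (scratchReg (s + 1))))),
    p + (q + .C (k + 1)), fun n d m r => ?_⟩
  obtain ⟨r₁, c₁, hrun₁, hc₁, hval₁, heq₁⟩ := hP n d m r
  obtain ⟨r₂, c₂, hrun₂, hc₂, hval₂, heq₂⟩ := hQ n d m r₁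
  have hs : r₂ s = f n d m := (heq₂ (Nat.lt_succ_self s)).trans hval₁
  have hset := runs_setVar_of_eval_eq (scratchReg s) (heval n d m r₂ s (s + 1))
  rw [hs, hval₂, machine_setVar_scratchReg] at hset
  refine ⟨_, _, .seq hrun₁ (.seq hrun₂ hset), ?_, Function.update_self .., ?_⟩
  · have := hcost (scratchReg s) (scratchReg (s + 1))
    simp only [Polynomial.eval_add, Polynomial.eval_C]
    omega
  · exact (eqOn_update_Iio r₂ le_rfl _).trans
      ((heq₂.mono (Set.Iio_subset_Iio s.le_succ)).trans heq₁)

lemma IsEvaluable.ite (hf : IsEvaluable f) (hg : IsEvaluable g) (hh : IsEvaluable h) :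
    IsEvaluable fun n d m => if f n d m ≠ 0 then g n d m else h n d m := by
  intro s
  obtain ⟨P, p, hP⟩ := hf s
  obtain ⟨Q, q, hQ⟩ := hg s
  obtain ⟨R, r, hR⟩ := hh s
  refine ⟨.seq P (.cond (.var (scratchReg s)) Q R), p + (.C 2 + q + r), fun n d m ρ => ?_⟩
  obtain ⟨ρ₁, c₁, hrun₁, hc₁, hval₁, heq₁⟩ := hP n d m ρ
  simp only [Polynomial.eval_add, Polynomial.eval_C]
  have hcond : (Expr.var (scratchReg s)).eval (machine n d m ρ₁) = f n d m := by
    simp [Expr.eval, hval₁]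
  split_ifs with hc
  · obtain ⟨ρ₂, c₂, hrun₂, hc₂, hval₂, heq₂⟩ := hQ n d m ρ₁
    exact ⟨ρ₂, _, .seq hrun₁ (.cond_true (hcond ▸ hc) hrun₂), by simp only [Expr.cost]; omega,
      hval₂, heq₂.trans heq₁⟩
  · obtain ⟨ρ₂, c₂, hrun₂, hc₂, hval₂, heq₂⟩ := hR n d m ρ₁
    exact ⟨ρ₂, _, .seq hrun₁ (.cond_false (hcond.trans (not_not.1 hc)) hrun₂),
      by simp only [Expr.cost]; omega, hval₂, heq₂.trans heq₁⟩

/-- The registers `s`, `s + 2` and `s + 3` hold the partial sum, the counter and the summand. -/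
lemma exists_runs_sumLoop {P : Prog} {n d x s T : ℕ} {m : Store} {r : ℕ → ℕ} (hr : r s = 0)
    (hP : ∀ m r, ∃ r' c, Runs P (machine n d m r) (machine n d m r') c ∧ c ≤ T ∧
      r' (s + 3) = f n d m ∧ Set.EqOn r' r (Set.Iio (s + 3))) :
    ∃ y r' c, Runs (forLoop x (s + 2) (.seq P (.setVar (scratchReg s)
        (.add (.var (scratchReg s)) (.var (scratchReg (s + 3)))))))
        (machine n d m r) (machine n d (m.setVar x y) r') c ∧
      c ≤ n * (T + 14) + 6 ∧ r' s = ∑ i ∈ Finset.range n, f n d (m.setVar x i) ∧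
      r' (s + 1) = r (s + 1) ∧ Set.EqOn r' r (Set.Iio s) := by
  obtain ⟨_, r', c, hrun, hc, ⟨y, rfl⟩, hinv⟩ := exists_runs_forLoop (n := n) (d := d)
    (P := .seq P (.setVar (scratchReg s)
      (.add (.var (scratchReg s)) (.var (scratchReg (s + 3)))))) (x := x) (s := s + 2)
    (T := T + 4) (m := m) (r := r)
    (fun i m' r' => (∃ y, m' = m.setVar x y) ∧
      r' s = ∑ j ∈ Finset.range i, f n d (m.setVar x j) ∧ r' (s + 1) = r (s + 1) ∧
      Set.EqOn r' r (Set.Iio s))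
    ⟨⟨m.var x, (setVar_self m x).symm⟩, by simp [hr], by simp,
      eqOn_update_Iio _ (by omega) _⟩ (by
      rintro i - _ r₁ ⟨⟨y, rfl⟩, hsum, hsave, heq⟩
      rw [setVar_setVar_same]
      obtain ⟨r₂, c, hrun, hc, hval, heq₂⟩ := hP (m.setVar x i) r₁
      have hadd := Runs.setVar (scratchReg s)
        (.add (.var (scratchReg s)) (.var (scratchReg (s + 3)))) (machine n d (m.setVar x i) r₂)
      rw [machine_setVar_scratchReg] at hadd
      have hkeep : ∀ j < s + 3, r₂ j = r₁ j := fun j hj => heq₂ hj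
      refine ⟨_, _, _, .seq hrun hadd, by simp only [Expr.cost]; omega, ?_, ⟨i, rfl⟩, ?_, ?_, ?_⟩
      · simpa using hkeep (s + 2) (by omega)
      · simp [Expr.eval, hval, Finset.sum_range_succ, ← hsum, hkeep s (by omega)]
      · simpa [← hsave] using hkeep (s + 1) (by omega)
      · exact (eqOn_update_Iio _ (by omega) _).trans ((eqOn_update_Iio _ le_rfl _).trans
          ((heq₂.mono (Set.Iio_subset_Iio (by omega))).trans heq)))
  exact ⟨y, r', c, hrun, by linarith, hinv⟩

lemma IsEvaluable.sum (hf : IsEvaluable f) (x : ℕ) :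
    IsEvaluable fun n d m => ∑ i ∈ Finset.range n, f n d (m.setVar x i) := by
  intro s
  obtain ⟨P, p, hP⟩ := hf (s + 3)
  refine ⟨.seq (.setVar (scratchReg s) (.lit 0)) (.seq
    (.setVar (scratchReg (s + 1)) (.var (varReg x))) (.seq (forLoop x (s + 2) (.seq P
      (.setVar (scratchReg s) (.add (.var (scratchReg s)) (.var (scratchReg (s + 3)))))))
    (.setVar (varReg x) (.var (scratchReg (s + 1)))))), .X * (p + .C 14) + .C 12,
    fun n d m r => ?_⟩
  have initSum := Runs.setVar (scratchReg s) (.lit 0) (machine n d m r)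
  have save := Runs.setVar (scratchReg (s + 1)) (.var (varReg x))
    (machine n d m (Function.update r s 0))
  simp only [machine_setVar_scratchReg, Expr.eval, machine_var_varReg] at initSum save
  obtain ⟨y, r', c, hrun, hc, hsum, hsave, heq⟩ := exists_runs_sumLoop (x := x) (m := m)
    (r := Function.update (Function.update r s 0) (s + 1) (m.var x)) (by simp) (hP n d)
  have restore := runs_setVar_of_eval_eq (e := .var (scratchReg (s + 1)))
    (σ := machine n d (m.setVar x y) r') (varReg x) (by simp [Expr.eval, hsave] : _ = m.var x)
  rw [machine_setVar_varReg, setVar_setVar_same, setVar_self] at restore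
  refine ⟨r', _, .seq initSum (.seq save (.seq hrun restore)), ?_, hsum,
    heq.trans ((eqOn_update_Iio _ (by omega) _).trans (eqOn_update_Iio _ le_rfl _))⟩
  simp only [Expr.cost, Polynomial.eval_add, Polynomial.eval_mul, Polynomial.eval_X,
    Polynomial.eval_C]
  omega

end Evaluable

theorem Tm.isEvaluable (t : Tm) : IsEvaluable fun n d m => t.den n d m := by
  induction t with
  | lit k => exact isEvaluable_of_expr (.lit k) fun _ _ _ _ => rfl
  | size => exact isEvaluable_of_expr (.var 0) fun _ _ _ _ => rfl
  | dist => exact isEvaluable_of_expr (.var 1) fun _ _ _ _ => rfl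
  | v x => exact isEvaluable_of_expr (.var (varReg x)) fun n d m r => machine_var_varReg n d m r x
  | arr a t u iht ihu =>
    exact iht.binary ihu (fun _ _ m i j => m.arr a i j) (fun x y => .arr a (.var x) (.var y)) 3
      (by simp [Expr.cost]) (by simp [Expr.eval])
  | add t u iht ihu =>
    exact iht.binary ihu (fun _ _ _ i j => i + j) (fun x y => .add (.var x) (.var y)) 3
      (by simp [Expr.cost]) (by simp [Expr.eval])
  | sub t u iht ihu =>
    exact iht.binary ihu (fun _ _ _ i j => i - j) (fun x y => .sub (.var x) (.var y)) 3
      (by simp [Expr.cost]) (by simp [Expr.eval])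
  | ite c t u ihc iht ihu => exact ihc.ite iht ihu
  | sum x t ih => exact ih.sum x

section Executable

variable {F K : ℕ → ℕ → Store → Store}

lemma isExecutable_id : IsExecutable fun _ _ m => m :=
  fun _ => ⟨.skip, .C 1, fun _ _ _ r => ⟨r, 1, .skip _, by simp, fun _ _ => rfl⟩⟩

lemma IsEvaluable.isExecutable_setVar {f : ℕ → ℕ → Store → ℕ} (hf : IsEvaluable f) (x : ℕ) :
    IsExecutable fun n d m => m.setVar x (f n d m) := by
  intro s
  obtain ⟨P, p, hP⟩ := hf s
  refine ⟨.seq P (.setVar (varReg x) (.var (scratchReg s))), p + .C 2, fun n d m r => ?_⟩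
  obtain ⟨r', c, hrun, hc, hval, heq⟩ := hP n d m r
  have hset := Runs.setVar (varReg x) (.var (scratchReg s)) (machine n d m r')
  simp only [machine_setVar_varReg, Expr.eval, machine_var_scratchReg, hval] at hset
  refine ⟨r', _, .seq hrun hset, ?_, heq⟩
  simp only [Expr.cost, Polynomial.eval_add, Polynomial.eval_C]
  omega

lemma IsEvaluable.isExecutable_setArr {f g h : ℕ → ℕ → Store → ℕ} (hf : IsEvaluable f)
    (hg : IsEvaluable g) (hh : IsEvaluable h) (a : ℕ) :
    IsExecutable fun n d m => m.setArr a (f n d m) (g n d m) (h n d m) := by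
  intro s
  obtain ⟨P, p, hP⟩ := hf s
  obtain ⟨Q, q, hQ⟩ := hg (s + 1)
  obtain ⟨R, r, hR⟩ := hh (s + 2)
  refine ⟨.seq P (.seq Q (.seq R (.setArr a (.var (scratchReg s)) (.var (scratchReg (s + 1)))
    (.var (scratchReg (s + 2)))))), p + (q + (r + .C 4)), fun n d m ρ => ?_⟩
  obtain ⟨ρ₁, c₁, hrun₁, hc₁, hval₁, heq₁⟩ := hP n d m ρ
  obtain ⟨ρ₂, c₂, hrun₂, hc₂, hval₂, heq₂⟩ := hQ n d m ρ₁
  obtain ⟨ρ₃, c₃, hrun₃, hc₃, hval₃, heq₃⟩ := hR n d m ρ₂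
  have hset := Runs.setArr a (.var (scratchReg s)) (.var (scratchReg (s + 1)))
    (.var (scratchReg (s + 2))) (machine n d m ρ₃)
  have hs : ρ₃ s = f n d m :=
    (heq₃ (Set.mem_Iio.2 (by omega))).trans ((heq₂ (Set.mem_Iio.2 (by omega))).trans hval₁)
  have hs' : ρ₃ (s + 1) = g n d m := (heq₃ (Set.mem_Iio.2 (by omega))).trans hval₂
  simp only [machine_setArr, Expr.eval, machine_var_scratchReg, hs, hs', hval₃] at hset
  refine ⟨ρ₃, _, .seq hrun₁ (.seq hrun₂ (.seq hrun₃ hset)), ?_, ?_⟩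
  · simp only [Expr.cost, Polynomial.eval_add, Polynomial.eval_C]
    omega
  · exact (heq₃.mono (Set.Iio_subset_Iio (by omega))).trans
      ((heq₂.mono (Set.Iio_subset_Iio (by omega))).trans heq₁)

lemma IsExecutable.comp (hF : IsExecutable F) (hK : IsExecutable K) :
    IsExecutable fun n d m => K n d (F n d m) := by
  intro s
  obtain ⟨P, p, hP⟩ := hF s
  obtain ⟨Q, q, hQ⟩ := hK s
  refine ⟨.seq P Q, p + q, fun n d m r => ?_⟩
  obtain ⟨r₁, c₁, hrun₁, hc₁, heq₁⟩ := hP n d m r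
  obtain ⟨r₂, c₂, hrun₂, hc₂, heq₂⟩ := hQ n d _ r₁
  exact ⟨r₂, _, .seq hrun₁ hrun₂, by rw [Polynomial.eval_add]; omega, heq₂.trans heq₁⟩

lemma IsExecutable.ite {f : ℕ → ℕ → Store → ℕ} (hf : IsEvaluable f) (hF : IsExecutable F)
    (hK : IsExecutable K) :
    IsExecutable fun n d m => if f n d m ≠ 0 then F n d m else K n d m := by
  intro s
  obtain ⟨P, p, hP⟩ := hf s
  obtain ⟨Q, q, hQ⟩ := hF s
  obtain ⟨R, r, hR⟩ := hK s
  refine ⟨.seq P (.cond (.var (scratchReg s)) Q R), p + (.C 2 + q + r), fun n d m ρ => ?_⟩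
  obtain ⟨ρ₁, c₁, hrun₁, hc₁, hval₁, heq₁⟩ := hP n d m ρ
  simp only [Polynomial.eval_add, Polynomial.eval_C]
  have hcond : (Expr.var (scratchReg s)).eval (machine n d m ρ₁) = f n d m := by
    simp [Expr.eval, hval₁]
  split_ifs with hc
  · obtain ⟨ρ₂, c₂, hrun₂, hc₂, heq₂⟩ := hQ n d m ρ₁
    exact ⟨ρ₂, _, .seq hrun₁ (.cond_true (hcond ▸ hc) hrun₂), by simp only [Expr.cost]; omega,
      heq₂.trans heq₁⟩
  · obtain ⟨ρ₂, c₂, hrun₂, hc₂, heq₂⟩ := hR n d m ρ₁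
    exact ⟨ρ₂, _, .seq hrun₁ (.cond_false (hcond.trans (not_not.1 hc)) hrun₂),
      by simp only [Expr.cost]; omega, heq₂.trans heq₁⟩

lemma IsExecutable.loop (hF : IsExecutable F) (x : ℕ) :
    IsExecutable fun n d m =>
      Nat.rec (motive := fun _ => Store) m (fun i m' => F n d (m'.setVar x i)) n := by
  intro s
  obtain ⟨P, p, hP⟩ := hF (s + 1)
  refine ⟨forLoop x s P, .X * (p + .C 10) + .C 6, fun n d m r => ?_⟩
  obtain ⟨_, r', c, hrun, hc, rfl, heq⟩ := exists_runs_forLoop (n := n) (d := d) (P := P) (x := x)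
    (s := s) (T := p.eval n) (m := m) (r := r)
    (fun i m' r' => m' = Nat.rec (motive := fun _ => Store) m
      (fun i m' => F n d (m'.setVar x i)) i ∧ Set.EqOn r' r (Set.Iio s))
    ⟨rfl, eqOn_update_Iio r le_rfl _⟩ (by
      rintro i - _ r₁ ⟨rfl, heq⟩
      obtain ⟨r₂, c, hrun, hc, heq₂⟩ := hP n d _ r₁
      exact ⟨_, r₂, c, hrun, hc, heq₂ s.lt_succ_self, rfl, (eqOn_update_Iio r₂ le_rfl _).trans
        ((heq₂.mono (Set.Iio_subset_Iio s.le_succ)).trans heq)⟩)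
  exact ⟨r', c, hrun, by simpa using hc, heq⟩

end Executable

theorem Cmd.isExecutable (C : Cmd) : IsExecutable fun n d m => C.run n d m := by
  induction C with
  | skip => exact isExecutable_id
  | assign x t => exact t.isEvaluable.isExecutable_setVar x
  | cell a t u w => exact t.isEvaluable.isExecutable_setArr u.isEvaluable w.isEvaluable a
  | seq P Q ihP ihQ => exact ihP.comp ihQ
  | ite c P Q ihP ihQ => exact ihP.ite c.isEvaluable ihQ
  | loop x P ih => exact ih.loop x

variable {n d : ℕ}

section Frame

/-- The variables that a term reads or sums over. -/
def Tm.vars : Tm → List ℕ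
  | lit _ => []
  | size => []
  | dist => []
  | v x => [x]
  | arr _ t u => t.vars ++ u.vars
  | add t u => t.vars ++ u.vars
  | sub t u => t.vars ++ u.vars
  | ite c t u => c.vars ++ (t.vars ++ u.vars)
  | sum _ t => t.vars

/-- The arrays that a term reads. -/
def Tm.arrs : Tm → List ℕ
  | lit _ => []
  | size => []
  | dist => []
  | v _ => []
  | arr a t u => a :: (t.arrs ++ u.arrs)
  | add t u => t.arrs ++ u.arrs
  | sub t u => t.arrs ++ u.arrs
  | ite c t u => c.arrs ++ (t.arrs ++ u.arrs)
  | sum _ t => t.arrs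

theorem Tm.den_congr (t : Tm) : ∀ {m m' : Store}, (∀ x ∈ t.vars, m.var x = m'.var x) →
    (∀ a ∈ t.arrs, m.arr a = m'.arr a) → t.den n d m = t.den n d m' := by
  induction t with
  | lit k => intros; rfl
  | size => intros; rfl
  | dist => intros; rfl
  | v x => exact fun hv _ => hv x (List.mem_singleton_self x)
  | arr a t u iht ihu =>
    intro m m' hv ha
    simp only [vars, arrs, List.forall_mem_append, List.forall_mem_cons] at hv ha
    rw [den, den, iht hv.1 ha.2.1, ihu hv.2 ha.2.2, ha.1]
  | add t u iht ihu =>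
    intro m m' hv ha
    simp only [vars, arrs, List.forall_mem_append] at hv ha
    rw [den, den, iht hv.1 ha.1, ihu hv.2 ha.2]
  | sub t u iht ihu =>
    intro m m' hv ha
    simp only [vars, arrs, List.forall_mem_append] at hv ha
    rw [den, den, iht hv.1 ha.1, ihu hv.2 ha.2]
  | ite c t u ihc iht ihu =>
    intro m m' hv ha
    simp only [vars, arrs, List.forall_mem_append] at hv ha
    rw [den, den, ihc hv.1 ha.1, iht hv.2.1 ha.2.1, ihu hv.2.2 ha.2.2]
  | sum x t ih =>
    intro m m' hv ha
    refine Finset.sum_congr rfl fun i _ => ih (fun y hy => ?_) ha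
    simp only [Store.setVar, hv y hy]

lemma Tm.den_setVar_congr (t : Tm) {m m' : Store} (x k : ℕ)
    (hv : ∀ y ∈ t.vars, y ≠ x → m.var y = m'.var y) (ha : ∀ a ∈ t.arrs, m.arr a = m'.arr a) :
    t.den n d (m.setVar x k) = t.den n d (m'.setVar x k) := by
  refine t.den_congr (fun y hy => ?_) ha
  by_cases hyx : y = x
  · simp [hyx]
  · rw [setVar_var_of_ne _ _ hyx, setVar_var_of_ne _ _ hyx, hv y hy hyx]

/-- The variables that a command changes. -/
def Cmd.vars : Cmd → List ℕ
  | skip => []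
  | assign x _ => [x]
  | cell _ _ _ _ => []
  | seq P Q => P.vars ++ Q.vars
  | ite _ P Q => P.vars ++ Q.vars
  | loop x P => x :: P.vars

/-- The arrays that a command changes. -/
def Cmd.arrs : Cmd → List ℕ
  | skip => []
  | assign _ _ => []
  | cell a _ _ _ => [a]
  | seq P Q => P.arrs ++ Q.arrs
  | ite _ P Q => P.arrs ++ Q.arrs
  | loop _ P => P.arrs

theorem Cmd.run_loop_inv {x : ℕ} {P : Cmd} {m : Store} (Inv : ℕ → Store → Prop) (init : Inv 0 m)
    (step : ∀ i < n, ∀ m', Inv i m' → Inv (i + 1) (P.run n d (m'.setVar x i))) :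
    Inv n ((Cmd.loop x P).run n d m) := by
  suffices h : ∀ k ≤ n, Inv k (Nat.rec (motive := fun _ => Store) m
    (fun i m' => P.run n d (m'.setVar x i)) k) from h n le_rfl
  intro k
  induction k with
  | zero => exact fun _ => init
  | succ k ih => exact fun hk => step k hk _ (ih (by omega))

theorem Cmd.run_var (C : Cmd) :
    ∀ (m : Store) {x : ℕ}, x ∉ C.vars → (C.run n d m).var x = m.var x := by
  induction C with
  | skip => intros; rfl
  | assign y t =>
    exact fun m x hx => setVar_var_of_ne _ _ (by simpa only [vars, List.mem_singleton] using hx)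
  | cell a t u w => intros; rfl
  | seq P Q ihP ihQ =>
    intro m x hx
    simp only [vars, List.mem_append, not_or] at hx
    rw [run, ihQ _ hx.2, ihP _ hx.1]
  | ite c P Q ihP ihQ =>
    intro m x hx
    simp only [vars, List.mem_append, not_or] at hx
    rw [run]
    split_ifs
    exacts [ihP _ hx.1, ihQ _ hx.2]
  | loop y P ih =>
    intro m x hx
    simp only [vars, List.mem_cons, not_or] at hx
    refine run_loop_inv (fun _ m' => m'.var x = m.var x) rfl fun i _ m' h => ?_
    rw [ih _ hx.2, setVar_var_of_ne _ _ hx.1, h]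

theorem Cmd.run_arr (C : Cmd) :
    ∀ (m : Store) {a : ℕ}, a ∉ C.arrs → (C.run n d m).arr a = m.arr a := by
  induction C with
  | skip => intros; rfl
  | assign y t => intros; rfl
  | cell b t u w =>
    intro m a ha
    have hab : a ≠ b := by simpa only [arrs, List.mem_singleton] using ha
    funext i j
    simp [run, Store.setArr, hab]
  | seq P Q ihP ihQ =>
    intro m a ha
    simp only [arrs, List.mem_append, not_or] at ha
    rw [run, ihQ _ ha.2, ihP _ ha.1]
  | ite c P Q ihP ihQ =>
    intro m a ha
    simp only [arrs, List.mem_append, not_or] at ha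
    rw [run]
    split_ifs
    exacts [ihP _ ha.1, ihQ _ ha.2]
  | loop y P ih =>
    intro m a ha
    refine run_loop_inv (fun _ m' => m'.arr a = m.arr a) rfl fun i _ m' h => ?_
    rw [ih _ ha, setVar_arr, h]

/-- In contrast to `Cmd.run_loop_inv`, the invariant need not mention what `P` does not change. -/
theorem Cmd.run_loop_inv_of_frame {x : ℕ} {P : Cmd} {m : Store} (Inv : ℕ → Store → Prop)
    (init : Inv 0 m)
    (step : ∀ i < n, ∀ m', (∀ y ∉ (loop x P).vars, m'.var y = m.var y) →
      (∀ a ∉ P.arrs, m'.arr a = m.arr a) → Inv i m' → Inv (i + 1) (P.run n d (m'.setVar x i))) :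
    Inv n ((loop x P).run n d m) := by
  refine (run_loop_inv (fun i m' => (∀ y ∉ (loop x P).vars, m'.var y = m.var y) ∧
    (∀ a ∉ P.arrs, m'.arr a = m.arr a) ∧ Inv i m') ⟨fun _ _ => rfl, fun _ _ => rfl, init⟩ ?_).2.2
  refine fun i hi m' ⟨hvar, harr, hInv⟩ =>
    ⟨fun y hy => ?_, fun a ha => ?_, step i hi m' hvar harr hInv⟩
  · rw [P.run_var _ (List.not_mem_of_not_mem_cons hy),
      setVar_var_of_ne _ _ (List.ne_of_not_mem_cons hy), hvar y hy]
  · rw [P.run_arr _ ha, setVar_arr, harr a ha]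

end Frame

namespace Tm

section Conditions

/-- A term is regarded as a condition that holds when its value is not zero. -/
def Holds (n d : ℕ) (t : Tm) (m : Store) : Prop := t.den n d m ≠ 0

/-- Conjunction. -/
def and (t u : Tm) : Tm := ite t u (lit 0)

/-- Negation. -/
def not (t : Tm) : Tm := ite t (lit 0) (lit 1)

/-- Comparison, by truncated subtraction. -/
def le (t u : Tm) : Tm := not (sub t u)

/-- Equality. -/
def eq (t u : Tm) : Tm := and (le t u) (le u t)

/-- One of the terms `t 0, …, t (k - 1)` holds. -/
def any (t : ℕ → Tm) : ℕ → Tm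
  | 0 => lit 0
  | k + 1 => add (any t k) (t k)

/-- The term `t` added to itself `k` times; the machine does not multiply. -/
def mul (t : Tm) : ℕ → Tm
  | 0 => lit 0
  | k + 1 => add (mul t k) t

/-- The least value of `x` for which `c` holds; the variable `y` is auxiliary. The value is found
by counting the `y` such that `c` holds for no `x ≤ y`. -/
def least (x y : ℕ) (c : Tm) : Tm := sum y (not (sum x (and (le (v x) (v y)) c)))

variable {m : Store}

@[simp]
lemma holds_and {t u : Tm} : (and t u).Holds n d m ↔ t.Holds n d m ∧ u.Holds n d m := by
  simp only [Holds, and, den]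
  split_ifs with h <;> simp [h]

@[simp]
lemma holds_add {t u : Tm} : (add t u).Holds n d m ↔ t.Holds n d m ∨ u.Holds n d m := by
  simp only [Holds, den]
  omega

@[simp]
lemma holds_not {t : Tm} : (not t).Holds n d m ↔ ¬ t.Holds n d m := by
  simp only [Holds, not, den]
  split_ifs with h <;> simp [h]

@[simp]
lemma holds_le {t u : Tm} : (le t u).Holds n d m ↔ t.den n d m ≤ u.den n d m := by
  rw [le, holds_not, Holds, den]
  omega

@[simp]
lemma holds_eq {t u : Tm} : (eq t u).Holds n d m ↔ t.den n d m = u.den n d m := by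
  rw [eq, holds_and, holds_le, holds_le, le_antisymm_iff]

@[simp]
lemma holds_sum {x : ℕ} {t : Tm} :
    (sum x t).Holds n d m ↔ ∃ i : Fin n, t.Holds n d (m.setVar x i) := by
  simp only [Holds, den, ne_eq, Finset.sum_eq_zero_iff, Finset.mem_range, not_forall]
  exact ⟨fun ⟨i, hi, h⟩ => ⟨⟨i, hi⟩, h⟩, fun ⟨i, h⟩ => ⟨i, i.2, h⟩⟩

@[simp]
lemma holds_any {t : ℕ → Tm} {k : ℕ} :
    (any t k).Holds n d m ↔ ∃ i : Fin k, (t i).Holds n d m := by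
  induction k with
  | zero => simp [any, Holds, den]
  | succ k ih => simp [any, ih, Fin.exists_fin_succ']

lemma holds_arr {a : ℕ} {t u : Tm} :
    (arr a t u).Holds n d m ↔ m.arr a (t.den n d m) (u.den n d m) ≠ 0 := Iff.rfl

@[simp]
lemma den_mul {t : Tm} {k : ℕ} : (mul t k).den n d m = k * t.den n d m := by
  induction k with
  | zero => simp [mul, den]
  | succ k ih => rw [mul, den, ih, Nat.succ_mul]

lemma den_sum_ite {x : ℕ} {c : Tm} {S : Set (Fin n)}
    (h : ∀ i : Fin n, c.Holds n d (m.setVar x i) ↔ i ∈ S) :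
    (sum x (ite c (lit 1) (lit 0))).den n d m = S.ncard := by
  classical
  simp only [den]
  rw [← Fin.sum_univ_eq_sum_range (fun i => if c.den n d (m.setVar x i) ≠ 0 then 1 else 0) n,
    Finset.sum_boole, ← Set.ncard_coe_finset, Nat.cast_id]
  congr 1
  ext i
  simpa [Holds] using h i

end Conditions

section Least

lemma card_filter_forall_le_spec (p : ℕ → Prop) (n : ℕ)
    [DecidablePred fun j => ∀ i ≤ j, ¬ p i] {N : ℕ}
    (hN : ((Finset.range n).filter fun j => ∀ i ≤ j, ¬ p i).card = N) :
    N ≤ n ∧ (N < n → p N) ∧ ∀ i < N, ¬ p i := by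
  classical
  have hex : ∃ i, i = n ∨ p i := ⟨n, .inl rfl⟩
  have hle : Nat.find hex ≤ n := Nat.find_min' hex (.inl rfl)
  have hmin : ∀ i < Nat.find hex, ¬ p i := fun i hi hp => Nat.find_min hex hi (.inr hp)
  have hfilter : (Finset.range n).filter (fun j => ∀ i ≤ j, ¬ p i) =
      Finset.range (Nat.find hex) := by
    ext j
    simp only [Finset.mem_filter, Finset.mem_range]
    refine ⟨fun ⟨hj, hp⟩ => lt_of_not_ge fun hle => ?_, fun hj =>
      ⟨hj.trans_le hle, fun i hi => hmin i (hi.trans_lt hj)⟩⟩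
    exact (Nat.find_spec hex).elim (fun h => (h ▸ hle).not_gt hj) (hp _ hle)
  rw [hfilter, Finset.card_range] at hN
  rw [← hN]
  exact ⟨hle, fun h => (Nat.find_spec hex).resolve_left h.ne, hmin⟩

lemma holds_and_le_setVar {x y : ℕ} (hxy : x ≠ y) {c : Tm} (hy : y ∉ c.vars) (m : Store)
    (i j : ℕ) : (and (le (v x) (v y)) c).Holds n d ((m.setVar y j).setVar x i) ↔
      i ≤ j ∧ c.Holds n d (m.setVar x i) := by
  have hc : c.den n d ((m.setVar y j).setVar x i) = c.den n d (m.setVar x i) :=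
    c.den_setVar_congr x i (fun z hz _ => setVar_var_of_ne _ _ fun h => hy (h ▸ hz))
      fun _ _ => rfl
  rw [holds_and, holds_le, Holds, hc, Holds, den, den, setVar_var_self,
    setVar_var_of_ne _ _ hxy.symm, setVar_var_self]

theorem least_spec {x y : ℕ} (hxy : x ≠ y) {c : Tm} (hy : y ∉ c.vars) (m : Store) :
    (least x y c).den n d m ≤ n ∧
      ((least x y c).den n d m < n → c.Holds n d (m.setVar x ((least x y c).den n d m))) ∧
      ∀ i < (least x y c).den n d m, ¬ c.Holds n d (m.setVar x i) := by
  classical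
  refine card_filter_forall_le_spec (fun i => c.Holds n d (m.setVar x i)) n ?_
  rw [Finset.card_filter, least, den]
  refine Finset.sum_congr rfl fun j hj => ?_
  have hsum : (sum x (and (le (v x) (v y)) c)).den n d (m.setVar y j) ≠ 0 ↔
      ¬ ∀ i ≤ j, ¬ c.Holds n d (m.setVar x i) := by
    refine holds_sum.trans ?_
    simp only [holds_and_le_setVar hxy hy, not_forall, not_not]
    exact ⟨fun ⟨i, hij, hc⟩ => ⟨i, hij, hc⟩,
      fun ⟨i, hij, hc⟩ => ⟨⟨i, hij.trans_lt (Finset.mem_range.1 hj)⟩, hij, hc⟩⟩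
  rw [not, den, den, den, if_congr hsum rfl rfl, ite_not]

end Least

end Tm

section Tables

/-- Fill the row `v 0` of the array `a` with the values of `t`, which depends on the column
`v 1`. -/
def fillRow (a : ℕ) (t : Tm) : Cmd := .loop 1 (.cell a (.v 0) (.v 1) t)

/-- Fill the array `a` with the values of `t`, which depends on the position `(v 0, v 1)`. -/
def fill (a : ℕ) (t : Tm) : Cmd := .loop 0 (fillRow a t)

variable {a : ℕ} {t : Tm}

lemma fillRow_arr (ha : a ∉ t.arrs) (m : Store) (i j : ℕ) :
    ((fillRow a t).run n d m).arr a i j =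
      if i = m.var 0 ∧ j < n then t.den n d (m.setVar 1 j) else m.arr a i j := by
  refine Cmd.run_loop_inv_of_frame (fun l m' => m'.arr a i j =
    if i = m.var 0 ∧ j < l then t.den n d (m.setVar 1 j) else m.arr a i j) (by simp) ?_
  intro l _ m' hvar harr hInv
  have hval : t.den n d (m'.setVar 1 l) = t.den n d (m.setVar 1 l) :=
    t.den_setVar_congr 1 l (fun y _ hy => hvar y (by simpa [Cmd.vars] using hy))
      fun b hb => harr b (by rintro hba; simp_all [Cmd.arrs])
  have hrow : (m'.setVar 1 l).var 0 = m.var 0 := hvar 0 (by simp [Cmd.vars])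
  simp only [Cmd.run, Tm.den, hval, hrow, setVar_var_self, Store.setArr, setVar_arr, true_and, hInv]
  grind

lemma fill_arr (ha : a ∉ t.arrs) (m : Store) {i j : ℕ} (hi : i < n) (hj : j < n) :
    ((fill a t).run n d m).arr a i j = t.den n d ((m.setVar 0 i).setVar 1 j) := by
  refine Cmd.run_loop_inv_of_frame (fun k m' => ∀ i < k,
    m'.arr a i j = t.den n d ((m.setVar 0 i).setVar 1 j)) (by simp) ?_ i hi
  intro k _ m' hvar harr hInv i hi
  have hval : t.den n d ((m'.setVar 0 k).setVar 1 j) = t.den n d ((m.setVar 0 k).setVar 1 j) :=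
    t.den_setVar_congr 1 j (fun y _ hy1 => by
      by_cases hy0 : y = 0
      · simp [hy0]
      · rw [setVar_var_of_ne _ _ hy0, setVar_var_of_ne _ _ hy0,
          hvar y (by simp [Cmd.vars, fillRow, hy0, hy1])])
      fun b hb => harr b (by rintro hba; simp_all [Cmd.arrs, fillRow])
  rw [fillRow_arr ha, setVar_var_self, setVar_arr]
  split_ifs with h
  · rw [hval, h.1]
  · exact hInv i (by omega)

/-- Compute the array `a`, possibly from its old contents; the array `9` holds the new contents in
the meantime. -/
def table (a : ℕ) (t : Tm) : Cmd := .seq (fill 9 t) (fill a (.arr 9 (.v 0) (.v 1)))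

@[simp]
lemma arrs_table : (table a t).arrs = [9, a] := rfl

theorem table_arr (ha : a ≠ 9) (ht : 9 ∉ t.arrs) (m : Store) (i j : Fin n) :
    ((table a t).run n d m).arr a i j = t.den n d ((m.setVar 0 i).setVar 1 j) := by
  rw [table, Cmd.run, fill_arr (by simpa [Tm.arrs] using ha) _ i.2 j.2]
  exact fill_arr ht m i.2 j.2

end Tables

/-! ### Distances, cores and balls -/

section Memory

/-- Column `0` of the array `a` is an indicator of `S`. -/
def IsSet (m : Store) (a : ℕ) (S : Set (Fin n)) : Prop := ∀ i : Fin n, m.arr a i 0 ≠ 0 ↔ i ∈ S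

/-- The array `a` is an adjacency matrix of `H`. -/
def IsAdj (m : Store) (a : ℕ) (H : SimpleGraph (Fin n)) : Prop :=
  ∀ i j : Fin n, m.arr a i j ≠ 0 ↔ H.Adj i j

/-- The array `a` is the matrix `D`. -/
def IsMatrix (m : Store) (a : ℕ) (D : Fin n → Fin n → ℕ) : Prop :=
  ∀ i j : Fin n, m.arr a i j = D i j

variable {m m' : Store} {a : ℕ}

lemma IsSet.congr {S : Set (Fin n)} (h : IsSet m a S) (he : m'.arr a = m.arr a) :
    IsSet m' a S := by
  rwa [IsSet, he]

lemma IsAdj.congr {H : SimpleGraph (Fin n)} (h : IsAdj m a H) (he : m'.arr a = m.arr a) :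
    IsAdj m' a H := by
  rwa [IsAdj, he]

lemma IsMatrix.congr {D : Fin n → Fin n → ℕ} (h : IsMatrix m a D) (he : m'.arr a = m.arr a) :
    IsMatrix m' a D := by
  rwa [IsMatrix, he]

lemma isSet_table {t : Tm} (ha : a ≠ 9) (ht : 9 ∉ t.arrs) {S : Set (Fin n)}
    (h : ∀ i : Fin n, t.Holds n d ((m.setVar 0 i).setVar 1 0) ↔ i ∈ S) :
    IsSet ((table a t).run n d m) a S := by
  intro i
  have hval := table_arr (d := d) ha ht m i ⟨0, i.pos⟩
  rw [← h i, Tm.Holds, ← hval]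

lemma isAdj_table {t : Tm} (ha : a ≠ 9) (ht : 9 ∉ t.arrs) {H : SimpleGraph (Fin n)}
    (h : ∀ i j : Fin n, t.Holds n d ((m.setVar 0 i).setVar 1 j) ↔ H.Adj i j) :
    IsAdj ((table a t).run n d m) a H := by
  intro i j
  rw [← h i j, table_arr ha ht, Tm.Holds]

instance (t : Tm) (m : Store) : Decidable (t.Holds n d m) := inferInstanceAs (Decidable (_ ≠ 0))

lemma Tm.den_ite {c t u : Tm} : (ite c t u).den n d m =
    if c.Holds n d m then t.den n d m else u.den n d m := rfl

end Memory

section Distances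

/-- A number larger than all distances and radii that occur. -/
def infty : Tm := .add .size (.mul .dist 3)

@[simp]
lemma den_infty (m : Store) : infty.den n d m = n + 3 * d := by
  simp [infty, Tm.den]

/-- The entries up to `v 4` of the array `b` are the correct distances in the graph `a`; add the
distances `v 4 + 1`. -/
def distanceStep (a b : ℕ) : Cmd :=
  table b (.ite (.le (.arr b (.v 0) (.v 1)) (.v 4)) (.arr b (.v 0) (.v 1))
    (.ite (.sum 2 (.and (.arr a (.v 2) (.v 1)) (.le (.arr b (.v 0) (.v 2)) (.v 4))))
      (.add (.v 4) (.lit 1)) infty))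

/-- Compute the distances in the graph with adjacency matrix `a` into the array `b`. -/
def distances (a b : ℕ) : Cmd :=
  .seq (table b (.ite (.eq (.v 0) (.v 1)) (.lit 0) infty)) (.loop 4 (distanceStep a b))

lemma cappedDist_le_iff {V : Type*} {G : SimpleGraph V} {M r : ℕ} (hr : r < M) {u v : V} :
    cappedDist G M u v ≤ r ↔ ∃ p : G.Walk u v, p.length ≤ r := by
  rw [cappedDist]
  split_ifs with huv
  · obtain ⟨q, hq⟩ := huv.exists_walk_length_eq_dist
    exact ⟨fun h => ⟨q, hq.trans_le h⟩, fun ⟨p, hp⟩ => (G.dist_le p).trans hp⟩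
  · exact iff_of_false hr.not_ge fun ⟨p, _⟩ => huv p.reachable

open Classical in
/-- The distances up to `k`; `M` stands for larger ones. -/
noncomputable def distUpTo {V : Type*} (G : SimpleGraph V) (M k : ℕ) (u v : V) : ℕ :=
  if ∃ p : G.Walk u v, p.length ≤ k then G.dist u v else M

section DistUpTo

variable {V : Type*} {G : SimpleGraph V} {M k : ℕ} {u v : V}

lemma distUpTo_zero [DecidableEq V] : distUpTo G M 0 u v = if u = v then 0 else M := by
  rw [distUpTo]
  split_ifs with hp huv huv
  · rw [huv, dist_self]
  · exact absurd (hp.choose.eq_of_length_eq_zero (Nat.le_zero.1 hp.choose_spec)) huv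
  · exact absurd ⟨huv ▸ .nil, by subst huv; rfl⟩ hp
  · rfl

lemma distUpTo_card [Fintype V] : distUpTo G M (Fintype.card V) u v = cappedDist G M u v := by
  rw [distUpTo, cappedDist]
  congr 1
  refine propext ⟨fun ⟨p, _⟩ => p.reachable, fun huv => ?_⟩
  obtain ⟨p, hp⟩ := huv.exists_walk_length_eq_dist
  exact ⟨p, hp.trans_le (dist_lt_card huv).le⟩

lemma distUpTo_le_iff (hk : k < M) : distUpTo G M k u v ≤ k ↔ ∃ p : G.Walk u v, p.length ≤ k := by
  rw [distUpTo]
  split_ifs with h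
  · exact iff_of_true ((G.dist_le h.choose).trans h.choose_spec) h
  · exact iff_of_false hk.not_ge h

lemma exists_walk_length_le_succ_iff : (∃ p : G.Walk u v, p.length ≤ k + 1) ↔
    (∃ p : G.Walk u v, p.length ≤ k) ∨ ∃ z, G.Adj z v ∧ ∃ p : G.Walk u z, p.length ≤ k := by
  constructor
  · rintro ⟨p, hp⟩
    obtain ⟨q, rfl⟩ : ∃ q : G.Walk v u, q.reverse = p := ⟨p.reverse, p.reverse_reverse⟩
    cases q with
    | nil => exact .inl ⟨.nil, Nat.zero_le _⟩
    | cons hadj q => exact .inr ⟨_, hadj.symm, q.reverse, by simpa using hp⟩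
  · rintro (⟨p, hp⟩ | ⟨z, hzv, p, hp⟩)
    · exact ⟨p, hp.trans k.le_succ⟩
    · exact ⟨p.concat hzv, by simpa using hp⟩

lemma distUpTo_succ (hk : k < M) [Decidable (∃ z, G.Adj z v ∧ distUpTo G M k u z ≤ k)] :
    distUpTo G M (k + 1) u v = if distUpTo G M k u v ≤ k then distUpTo G M k u v else
      if ∃ z, G.Adj z v ∧ distUpTo G M k u z ≤ k then k + 1 else M := by
  classical
  simp only [distUpTo_le_iff hk]
  by_cases hshort : ∃ p : G.Walk u v, p.length ≤ k
  · rw [if_pos hshort, distUpTo, distUpTo, if_pos hshort,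
      if_pos (exists_walk_length_le_succ_iff.2 (.inl hshort))]
  · rw [if_neg hshort, distUpTo, exists_walk_length_le_succ_iff, or_iff_right hshort]
    split_ifs with hlast
    · obtain ⟨p, hp⟩ := exists_walk_length_le_succ_iff.2 (.inr hlast)
      obtain ⟨q, hq⟩ := p.reachable.exists_walk_length_eq_dist
      have hlong : k < q.length := lt_of_not_ge fun h => hshort ⟨q, h⟩
      exact le_antisymm ((G.dist_le p).trans hp) (hq ▸ hlong)
    · rfl

end DistUpTo

variable {a b : ℕ} {m : Store} {H : SimpleGraph (Fin n)}

lemma distances_init (hb : b ≠ 9) :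
    IsMatrix ((table b (.ite (.eq (.v 0) (.v 1)) (.lit 0) infty)).run n d m) b
      (distUpTo H (n + 3 * d) 0) := by
  intro i j
  rw [table_arr hb (by simp [Tm.arrs, infty, Tm.mul, Tm.eq, Tm.and, Tm.le, Tm.not]), Tm.den_ite,
    den_infty, distUpTo_zero]
  simp [Tm.den, setVar_var, Fin.ext_iff]

lemma distances_step (ha : a ≠ 9) (hb : b ≠ 9) (hH : IsAdj m a H) {k : ℕ} (hk : k < n)
    (hD : IsMatrix m b (distUpTo H (n + 3 * d) k)) :
    IsMatrix ((distanceStep a b).run n d (m.setVar 4 k)) b (distUpTo H (n + 3 * d) (k + 1)) := by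
  classical
  intro i j
  rw [distanceStep, table_arr hb (by simp [Tm.arrs, infty, Tm.mul, Tm.and, Tm.le, Tm.not, ha.symm,
    hb.symm]), Tm.den_ite, Tm.den_ite, den_infty, distUpTo_succ (by omega)]
  simp [Tm.holds_arr, Tm.den, setVar_var, hD _ _, hH _ _]

theorem distances_spec (hab : a ≠ b) (ha : a ≠ 9) (hb : b ≠ 9) (hH : IsAdj m a H) :
    IsMatrix ((distances a b).run n d m) b (cappedDist H (n + 3 * d)) := by
  have harr : ∀ t, a ∉ (table b t).arrs := fun t => by
    simp [hab, ha]
  have hloop := Cmd.run_loop_inv_of_frame (d := d)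
    (m := (table b (.ite (.eq (.v 0) (.v 1)) (.lit 0) infty)).run n d m)
    (P := distanceStep a b) (fun k m' => IsMatrix m' b (distUpTo H (n + 3 * d) k))
    (distances_init hb) (x := 4) fun k hk m' _ harr' hD => distances_step ha hb
      ((hH.congr (Cmd.run_arr _ _ (harr _))).congr (harr' a (harr _))) hk hD
  intro i j
  rw [← distUpTo_card, Fintype.card_fin]
  exact hloop i j

end Distances

section Core

section Prune

variable {V : Type*} (G : SimpleGraph V) (S : Set V)

/-- The vertices of `K` with two neighbours in `K`. Iterating this map leads to `maxCore`. -/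
def prune (K : Set V) : Set V :=
  {v | v ∈ K ∧ ∃ a ∈ K, ∃ b ∈ K, a ≠ b ∧ G.Adj v a ∧ G.Adj v b}

lemma prune_subset : prune G S ⊆ S := fun _ hv => hv.1

lemma prune_iterate_subset (k : ℕ) : (prune G)^[k] S ⊆ S := by
  induction k with
  | zero => exact subset_rfl
  | succ k ih => exact Function.iterate_succ_apply' (prune G) k S ▸ (prune_subset G _).trans ih

variable {G S} in
lemma IsCore.subset_prune_iterate {K : Set V} (hK : IsCore G K) (h : K ⊆ S) (k : ℕ) :
    K ⊆ (prune G)^[k] S := by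
  induction k with
  | zero => exact h
  | succ k ih =>
    rw [Function.iterate_succ_apply']
    intro v hv
    obtain ⟨a, ha, b, hb, hab⟩ := hK.2 v hv
    exact ⟨ih hv, a, ih ha, b, ih hb, hab⟩

variable [Finite V]

lemma ncard_prune_iterate_add_le (k : ℕ) : ((prune G)^[k] S).ncard + k ≤ Nat.card V ∨
    prune G ((prune G)^[k] S) = (prune G)^[k] S := by
  induction k with
  | zero => exact .inl (Set.ncard_le_card _)
  | succ k ih =>
    rw [Function.iterate_succ_apply']
    refine or_iff_not_imp_right.2 fun hmoves => ?_
    have hmoves' : prune G ((prune G)^[k] S) ≠ (prune G)^[k] S := fun h => hmoves (by rw [h, h])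
    have hlt := Set.ncard_lt_ncard ((prune_subset G _).lt_of_ne hmoves')
    have hle := ih.resolve_right hmoves'
    omega

lemma prune_iterate_card :
    prune G ((prune G)^[Nat.card V] S) = (prune G)^[Nat.card V] S := by
  rcases ncard_prune_iterate_add_le G S (Nat.card V) with h | h
  · have hempty : (prune G)^[Nat.card V] S = ∅ := (Set.ncard_eq_zero).1 (by omega)
    rw [hempty]
    exact Set.subset_empty_iff.1 (prune_subset G ∅)
  · exact h

/-- The largest subset of `S` that is a core or empty. -/
def maxCore : Set V := (prune G)^[Nat.card V] S

omit [Finite V] in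
lemma maxCore_subset : maxCore G S ⊆ S := prune_iterate_subset G S _

variable {G S}

lemma isCore_maxCore (h : (maxCore G S).Nonempty) : IsCore G (maxCore G S) := by
  refine ⟨h, fun v hv => ?_⟩
  rw [maxCore, ← prune_iterate_card] at hv
  exact hv.2

lemma not_isAcyclic_iff_maxCore_nonempty :
    ¬ (restrict G S).IsAcyclic ↔ (maxCore G S).Nonempty := by
  refine ⟨fun h => ?_, fun h => not_isAcyclic_of_isCore (maxCore_subset G S) (isCore_maxCore h)⟩
  obtain ⟨v, c, hc, hcS⟩ := not_isAcyclic_restrict_iff.1 h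
  exact (isCore_support hc).1.mono ((isCore_support hc).subset_prune_iterate hcS _)

end Prune

/-- Compute `maxCore` for the set `a` into the array `b`. -/
def core (a b : ℕ) : Cmd :=
  .seq (table b (.arr a (.v 0) (.lit 0)))
    (.loop 4 (table b (.and (.arr b (.v 0) (.lit 0)) (.sum 2 (.and (.arr b (.v 2) (.lit 0))
      (.sum 3 (.and (.arr b (.v 3) (.lit 0)) (.and (.not (.eq (.v 2) (.v 3)))
        (.and (.arr 0 (.v 0) (.v 2)) (.arr 0 (.v 0) (.v 3)))))))))))

theorem core_spec {a b : ℕ} (ha : a ≠ 9) (hb : b ≠ 9) (hb0 : b ≠ 0) {m : Store}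
    {G : SimpleGraph (Fin n)} {S : Set (Fin n)} (hG : IsAdj m 0 G) (hS : IsSet m a S) :
    IsSet ((core a b).run n d m) b (maxCore G S) := by
  have harr : ∀ t, 0 ∉ (table b t).arrs := fun t => by
    simp [hb0.symm]
  rw [maxCore, Nat.card_fin]
  refine Cmd.run_loop_inv_of_frame (fun k m' => IsSet m' b ((prune G)^[k] S)) ?_ ?_
  · refine isSet_table hb (by simpa [Tm.arrs] using ha.symm) fun i => ?_
    simp [Tm.holds_arr, Tm.den, setVar_var, hS i]
  · intro k _ m' _ harr' hK
    have hG' : IsAdj m' 0 G := (hG.congr (Cmd.run_arr _ _ (harr _))).congr (harr' 0 (harr _))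
    refine isSet_table hb (by simp [Tm.arrs, Tm.and, Tm.eq, Tm.le, Tm.not, hb.symm]) fun i => ?_
    rw [Function.iterate_succ_apply']
    simp [Tm.holds_arr, Tm.den, setVar_var, hK _, hG' _ _, prune, ← Fin.ext_iff]

/-- Some entry of the set `a` is not zero. -/
def nonempty (a : ℕ) : Tm := .sum 2 (.arr a (.v 2) (.lit 0))

lemma holds_nonempty {a : ℕ} {m : Store} {S : Set (Fin n)} (hS : IsSet m a S) :
    (nonempty a).Holds n d m ↔ S.Nonempty := by
  simp [nonempty, Tm.holds_arr, Tm.den, hS _, Set.Nonempty]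

end Core

section Ball

/-- Compute the complement of the ball of radius `r` around the set `a` into the array `b`; the
array `3` holds the distances. -/
def outside (a b : ℕ) (r : Tm) : Cmd :=
  table b (.not (.sum 2 (.and (.arr a (.v 2) (.lit 0)) (.le (.arr 3 (.v 0) (.v 2)) r))))

lemma arrs_mul_dist (k : ℕ) : (Tm.mul .dist k).arrs = [] := by
  induction k with
  | zero => rfl
  | succ k ih => simp [Tm.mul, Tm.arrs, ih]

theorem outside_spec {a b : ℕ} (ha : a ≠ 9) (hb : b ≠ 9) {k : ℕ} (hk : k ≤ 3) {m : Store}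
    {G : SimpleGraph (Fin n)} {S : Set (Fin n)} (hD : IsMatrix m 3 (cappedDist G (n + 3 * d)))
    (hS : IsSet m a S) :
    IsSet ((outside a b (.mul .dist k)).run n d m) b (ball G S (k * d))ᶜ := by
  refine isSet_table hb (by simp [Tm.arrs, Tm.and, Tm.le, Tm.not, arrs_mul_dist, ha.symm])
    fun i => ?_
  have hlt : k * d < n + 3 * d := by
    have := Nat.mul_le_mul_right d hk
    have := i.pos
    omega
  simp [Tm.holds_arr, Tm.den, setVar_var, mem_ball_iff, ← cappedDist_le_iff hlt, hS _, hD _ _]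

end Ball

section Extraction

variable {G : SimpleGraph (Fin n)} {K : Set (Fin n)} {m : Store} {w : ℕ → Fin n}

lemma setArr_arr_of_ne (m : Store) {a b : ℕ} (i j k : ℕ) (h : b ≠ a) :
    (m.setArr a i j k).arr b = m.arr b := by
  funext i' j'
  simp [Store.setArr, h]

lemma Tm.exists_den_least_eq {x y : ℕ} (hxy : x ≠ y) {c : Tm} (hy : y ∉ c.vars)
    (h : ∃ i : Fin n, c.Holds n d (m.setVar x i)) :
    ∃ z : Fin n, (least x y c).den n d m = z ∧ c.Holds n d (m.setVar x z) := by
  obtain ⟨-, hholds, hleast⟩ := least_spec (n := n) (d := d) hxy hy m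
  obtain ⟨i, hi⟩ := h
  have hlt : (least x y c).den n d m < n := (not_lt.1 fun hlt => hleast i hlt hi).trans_lt i.2
  exact ⟨⟨_, hlt⟩, rfl, hholds hlt⟩

/-- The array `8` holds the vertices `w 0, …, w k` of a walk in `K` that never turns back. Since
`0 - 1 = 0`, the last condition holds at `l = 0` by adjacency. -/
def IsTrace (G : SimpleGraph (Fin n)) (K : Set (Fin n)) (m : Store) (k : ℕ) (w : ℕ → Fin n) :
    Prop :=
  (∀ l ≤ k, m.arr 8 l 0 = w l ∧ w l ∈ K) ∧
    ∀ l < k, G.Adj (w l) (w (l + 1)) ∧ w (l + 1) ≠ w (l - 1)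

/-- Some vertex of the set `a`. -/
def someVertex (a : ℕ) : Tm := .least 2 3 (.arr a (.v 2) (.lit 0))

/-- A vertex `v 2` of the set `a` continues the walk in the array `8` after time `v 4`. -/
def continuesTrace (a : ℕ) : Tm :=
  .and (.arr 0 (.arr 8 (.v 4) (.lit 0)) (.v 2)) (.and (.arr a (.v 2) (.lit 0))
    (.not (.eq (.v 2) (.arr 8 (.sub (.v 4) (.lit 1)) (.lit 0)))))

/-- Prolong the walk in the array `8`. -/
def traceStep (a : ℕ) : Cmd :=
  .cell 8 (.add (.v 4) (.lit 1)) (.lit 0) (.least 2 3 (continuesTrace a))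

/-- Trace a walk in the set `a` that never turns back into the array `8`. -/
def traceWalk (a : ℕ) : Cmd :=
  .seq (.cell 8 (.lit 0) (.lit 0) (someVertex a)) (.loop 4 (traceStep a))

lemma IsCore.exists_adj_ne (hK : IsCore G K) {v : Fin n} (hv : v ∈ K) (x : Fin n) :
    ∃ y, G.Adj v y ∧ y ∈ K ∧ y ≠ x := by
  obtain ⟨y, hy, z, hz, hyz, hvy, hvz⟩ := hK.2 v hv
  by_cases h : y = x
  · exact ⟨z, hvz, hz, fun hzx => hyz (h.trans hzx.symm)⟩
  · exact ⟨y, hvy, hy, h⟩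

lemma exists_den_someVertex_eq {a : ℕ} (ha : IsSet m a K) (hK : K.Nonempty) :
    ∃ z ∈ K, (someVertex a).den n d m = z := by
  have hholds : ∀ z : Fin n, (Tm.arr a (.v 2) (.lit 0)).Holds n d (m.setVar 2 z) ↔ z ∈ K := by
    simp [Tm.holds_arr, Tm.den, ha _]
  obtain ⟨x, hx⟩ := hK
  obtain ⟨z, hz, hzK⟩ := Tm.exists_den_least_eq (x := 2) (y := 3) (by decide)
    (by simp [Tm.vars]) ⟨x, (hholds x).2 hx⟩
  exact ⟨z, (hholds z).1 hzK, hz⟩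

lemma exists_den_continuesTrace_eq {a k : ℕ} (hG : IsAdj m 0 G) (ha : IsSet m a K)
    (hK : IsCore G K) (hw : IsTrace G K m k w) :
    ∃ z, G.Adj (w k) z ∧ z ∈ K ∧ z ≠ w (k - 1) ∧
      (Tm.least 2 3 (continuesTrace a)).den n d (m.setVar 4 k) = z := by
  have hholds : ∀ z : Fin n, (continuesTrace a).Holds n d ((m.setVar 4 k).setVar 2 z) ↔
      G.Adj (w k) z ∧ z ∈ K ∧ z ≠ w (k - 1) := fun z => by
    simp [continuesTrace, Tm.holds_arr, Tm.den, setVar_var, (hw.1 k le_rfl).1,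
      (hw.1 (k - 1) (by omega)).1, hG _ _, ha _, ← Fin.ext_iff]
  obtain ⟨y, hy⟩ := hK.exists_adj_ne (hw.1 k le_rfl).2 (w (k - 1))
  obtain ⟨z, hz, hcont⟩ := Tm.exists_den_least_eq (x := 2) (y := 3) (by decide)
    (by simp [continuesTrace, Tm.vars, Tm.and, Tm.not, Tm.eq, Tm.le]) ⟨y, (hholds y).2 hy⟩
  obtain ⟨hadj, hzK, hne⟩ := (hholds z).1 hcont
  exact ⟨z, hadj, hzK, hne, hz⟩

lemma exists_isTrace_traceStep {a k : ℕ} (hG : IsAdj m 0 G) (ha : IsSet m a K) (hK : IsCore G K)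
    (hw : IsTrace G K m k w) :
    ∃ w', IsTrace G K ((traceStep a).run n d (m.setVar 4 k)) (k + 1) w' := by
  obtain ⟨z, hadj, hzK, hne, hz⟩ := exists_den_continuesTrace_eq (d := d) hG ha hK hw
  have hold : ∀ l ≤ k, Function.update w (k + 1) z l = w l := fun l hl =>
    Function.update_of_ne (by omega) _ _
  refine ⟨Function.update w (k + 1) z, fun l hl => ?_, fun l hl => ?_⟩
  · simp only [traceStep, Cmd.run, Store.setArr, Tm.den, hz, setVar_var_self, setVar_arr]
    rcases hl.eq_or_lt with rfl | hl
    · simpa using hzK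
    · rw [hold l (by omega)]
      simpa [hl.ne] using hw.1 l (by omega)
  · rw [hold l (by omega), hold (l - 1) (by omega)]
    rcases (Nat.lt_succ_iff.1 hl).eq_or_lt with rfl | hl
    · simpa using ⟨hadj, hne⟩
    · rw [hold (l + 1) hl]
      exact hw.2 l hl

theorem traceWalk_spec {a : ℕ} (ha8 : a ≠ 8) (hG : IsAdj m 0 G) (ha : IsSet m a K)
    (hK : IsCore G K) : ∃ w, IsTrace G K ((traceWalk a).run n d m) n w := by
  refine Cmd.run_loop_inv_of_frame (fun k m' => ∃ w, IsTrace G K m' k w) ?_ ?_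
  · obtain ⟨z, hzK, hz⟩ := exists_den_someVertex_eq (d := d) ha hK.1
    refine ⟨fun _ => z, fun l hl => ⟨?_, hzK⟩, fun l hl => absurd hl l.not_lt_zero⟩
    simp [Cmd.run, Store.setArr, Tm.den, hz, Nat.le_zero.1 hl]
  · rintro k - m' - harr ⟨w, hw⟩
    have hframe : ∀ b ≠ 8, m'.arr b = m.arr b := fun b hb =>
      (harr b (by simpa [traceStep, Cmd.arrs] using hb)).trans (setArr_arr_of_ne _ _ _ _ hb)
    exact exists_isTrace_traceStep (hG.congr (hframe 0 (by decide))) (ha.congr (hframe a ha8)) hK hw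

/-- The walk in the array `8` is at time `v 2` at a vertex that it has visited before. -/
def revisits : Tm :=
  .sum 6 (.and (.not (.le (.v 2) (.v 6))) (.eq (.arr 8 (.v 6) (.lit 0)) (.arr 8 (.v 2) (.lit 0))))

/-- The walk in the array `8` is at time `v 2`, before time `v 5`, at the vertex of time `v 5`. -/
def visits : Tm :=
  .and (.not (.le (.v 5) (.v 2))) (.eq (.arr 8 (.v 2) (.lit 0)) (.arr 8 (.v 5) (.lit 0)))

lemma holds_revisits (hw : ∀ k ≤ n, m.arr 8 k 0 = w k) {l : ℕ} (hl : l ≤ n) :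
    revisits.Holds n d (m.setVar 2 l) ↔ ∃ k < l, w k = w l := by
  have hread : ∀ k : Fin n, (Tm.and (.not (.le (.v 2) (.v 6))) (.eq (.arr 8 (.v 6) (.lit 0))
      (.arr 8 (.v 2) (.lit 0)))).Holds n d ((m.setVar 2 l).setVar 6 k) ↔ (k : ℕ) < l ∧ w k = w l :=
    fun k => by simp [Tm.den, setVar_var, hw l hl, hw k k.2.le, ← Fin.ext_iff]
  rw [revisits, Tm.holds_sum]
  simp only [hread]
  exact ⟨fun ⟨k, hk⟩ => ⟨k, hk⟩, fun ⟨k, hkl, hk⟩ => ⟨⟨k, by omega⟩, hkl, hk⟩⟩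

lemma exists_den_least_revisits_eq (hw : ∀ k ≤ n, m.arr 8 k 0 = w k) :
    ∃ j ≤ n, (Tm.least 2 3 revisits).den n d m = j ∧ (∃ k < j, w k = w j) ∧
      Set.InjOn w (Set.Iio j) := by
  obtain ⟨hle, hrev, hleast⟩ := Tm.least_spec (n := n) (d := d) (x := 2) (y := 3) (by decide)
    (c := revisits) (by simp [revisits, Tm.vars, Tm.and, Tm.not, Tm.eq, Tm.le]) m
  generalize (Tm.least 2 3 revisits).den n d m = j at hle hrev hleast
  have hne : ∀ l < j, ∀ k < l, w k ≠ w l := fun l hl k hk h =>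
    hleast l hl ((holds_revisits hw (by omega)).2 ⟨k, hk, h⟩)
  refine ⟨j, hle, rfl, ?_, fun k hk l hl h => ?_⟩
  · rcases hle.lt_or_eq with hlt | rfl
    · exact (holds_revisits hw hle).1 (hrev hlt)
    · obtain ⟨i, l, hil, hl, h, -⟩ := exists_first_repeat w
      rw [Nat.card_fin] at hl
      rcases hl.lt_or_eq with hl | rfl
      · exact absurd h.symm (hne l hl i hil)
      · exact ⟨i, hil, h.symm⟩
  · rcases lt_trichotomy k l with hkl | rfl | hkl
    · exact absurd h (hne l hl k hkl)
    · rfl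
    · exact absurd h.symm (hne k hk l hkl)

lemma exists_den_least_visits_eq (hw : ∀ k ≤ n, m.arr 8 k 0 = w k) {j : ℕ} (hj : j ≤ n)
    (hv : m.var 5 = j) (h : ∃ k < j, w k = w j) :
    ∃ i < j, (Tm.least 2 3 visits).den n d m = i ∧ w i = w j := by
  have hholds : ∀ k : Fin n, visits.Holds n d (m.setVar 2 k) ↔ (k : ℕ) < j ∧ w k = w j :=
    fun k => by simp [visits, Tm.den, setVar_var, hv, hw j hj, hw k k.2.le, ← Fin.ext_iff]
  obtain ⟨k, hkj, hk⟩ := h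
  obtain ⟨i, hi, hvisit⟩ := Tm.exists_den_least_eq (x := 2) (y := 3) (by decide)
    (by simp [visits, Tm.vars, Tm.and, Tm.not, Tm.eq, Tm.le])
    ⟨⟨k, by omega⟩, (hholds _).2 ⟨hkj, hk⟩⟩
  exact ⟨i, ((hholds i).1 hvisit).1, hi, ((hholds i).1 hvisit).2⟩

/-- Copy the part of the array `8` from `v 6` to `v 5` into the array `b`. -/
def copySegment (b : ℕ) : Cmd :=
  .seq (.loop 4 (.cell b (.v 4) (.lit 0) (.arr 8 (.add (.v 6) (.v 4)) (.lit 0))))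
    (.cell b (.sub (.v 5) (.v 6)) (.lit 0) (.arr 8 (.v 5) (.lit 0)))

lemma copySegment_arr {b i j k : ℕ} (hb : b ≠ 8) (hi : m.var 6 = i) (hj : m.var 5 = j)
    (hij : i ≤ j) (hjn : j ≤ n) (hk : k ≤ j - i) :
    ((copySegment b).run n d m).arr b k 0 = m.arr 8 (i + k) 0 := by
  set P : Cmd := .cell b (.v 4) (.lit 0) (.arr 8 (.add (.v 6) (.v 4)) (.lit 0)) with hP
  have hcopy : ∀ l < n, ((Cmd.loop 4 P).run n d m).arr b l 0 = m.arr 8 (i + l) 0 := by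
    refine Cmd.run_loop_inv_of_frame (fun k m' => ∀ l < k, m'.arr b l 0 = m.arr 8 (i + l) 0)
      (fun l hl => absurd hl l.not_lt_zero) fun k _ m' hvar harr hInv l hl => ?_
    have hvar6 : m'.var 6 = i := (hvar 6 (by simp [hP, Cmd.vars])).trans hi
    have harr8 : m'.arr 8 = m.arr 8 := harr 8 (by simpa [hP, Cmd.arrs] using hb.symm)
    rcases (Nat.lt_succ_iff.1 hl).eq_or_lt with rfl | hl
    · simp [hP, Cmd.run, Tm.den, Store.setArr, setVar_var, hvar6, harr8]
    · simpa [hP, Cmd.run, Tm.den, Store.setArr, hl.ne] using hInv l hl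
  have hvar : ∀ y ≠ 4, ((Cmd.loop 4 P).run n d m).var y = m.var y := fun y hy =>
    Cmd.run_var _ _ (by simpa [hP, Cmd.vars] using hy)
  have harr : ((Cmd.loop 4 P).run n d m).arr 8 = m.arr 8 :=
    Cmd.run_arr _ _ (by simpa [hP, Cmd.arrs] using hb.symm)
  rw [copySegment, Cmd.run, ← hP, Cmd.run]
  simp only [Tm.den, Store.setArr, hvar 5 (by decide), hvar 6 (by decide), hi, hj, harr, true_and,
    and_true]
  split_ifs with hlast
  · rw [hlast, Nat.add_sub_cancel' hij]
  · exact hcopy k (by omega)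

/-- Find a cycle in the core `a`, and write it into the array `b` and its length into the
variable `x`. -/
def extract (a b x : ℕ) : Cmd :=
  .seq (traceWalk a) <| .seq (.assign 5 (.least 2 3 revisits)) <|
  .seq (.assign 6 (.least 2 3 visits)) <| .seq (copySegment b)
    (.assign x (.add (.sub (.v 5) (.v 6)) (.lit 1)))

lemma extract_run {a b x i j : ℕ}
    (hj : (Tm.least 2 3 revisits).den n d ((traceWalk a).run n d m) = j)
    (hi : (Tm.least 2 3 visits).den n d (((traceWalk a).run n d m).setVar 5 j) = i) :
    (extract a b x).run n d m = ((copySegment b).run n d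
      ((((traceWalk a).run n d m).setVar 5 j).setVar 6 i)).setVar x (j - i + 1) := by
  simp only [extract, Cmd.run, hj, hi]
  congr 1
  simp only [Tm.den]
  rw [Cmd.run_var _ _ (by simp [copySegment, Cmd.vars]),
    Cmd.run_var _ _ (by simp [copySegment, Cmd.vars])]
  simp [setVar_var]

lemma holdsList_map_range_iff {a l : ℕ} {f : ℕ → Fin n} :
    m.HoldsList a l ((List.range l).map f) ↔ ∀ k < l, m.arr a k 0 = f k := by
  simp only [Store.HoldsList, List.bind_eq_flatMap, List.pure_def, ← List.map_eq_flatMap,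
    List.map_map, List.map_inj_left, List.mem_range, Function.comp_apply,
    eq_comm]

theorem extract_spec {a b x : ℕ} (ha8 : a ≠ 8) (hb8 : b ≠ 8) (hG : IsAdj m 0 G)
    (ha : IsSet m a K) (hK : IsCore G K) :
    ∃ (u : Fin n) (c : G.Walk u u), c.IsCycle ∧ (∀ y ∈ c.support, y ∈ K) ∧
      ((extract a b x).run n d m).HoldsList b (((extract a b x).run n d m).var x) c.support := by
  obtain ⟨w, hw, hadj⟩ := traceWalk_spec (d := d) ha8 hG ha hK
  have hread : ∀ k ≤ n, ((traceWalk a).run n d m).arr 8 k 0 = w k := fun k hk => (hw k hk).1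
  obtain ⟨j, hjn, hj, hrepeat, hinj⟩ := exists_den_least_revisits_eq (d := d) hread
  obtain ⟨i, hij, hi, hwij⟩ := exists_den_least_visits_eq (d := d)
    (m := ((traceWalk a).run n d m).setVar 5 j) hread hjn (setVar_var_self _ _ _) hrepeat
  obtain ⟨c, hc, hsupport⟩ := exists_isCycle_of_seq w hij hwij.symm
    (hinj.mono fun k hk => hk.2) (fun k _ hk => (hadj k (by omega)).1)
    (fun k _ hk => (hadj (k + 1) (by omega)).2)
  refine ⟨w i, c, hc, fun y hy => ?_, ?_⟩
  · rw [hsupport, List.mem_map] at hy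
    obtain ⟨k, hk, rfl⟩ := hy
    rw [List.mem_range] at hk
    exact (hw (i + k) (by omega)).2
  · rw [extract_run hj hi, setVar_var_self, hsupport, holdsList_map_range_iff]
    intro k hk
    rw [setVar_arr, copySegment_arr hb8 (setVar_var_self _ _ _) (by simp [setVar_var]) hij.le hjn
      (by omega)]
    exact hread _ (by omega)

end Extraction

section Search

variable {P : Cmd} {x k : ℕ} {I R : Store → Prop}

/-- Whether the memory has the property `I` does not depend on the variables from `x` on. -/
def IgnoresFrom (x : ℕ) (I : Store → Prop) : Prop := ∀ m, ∀ y ≥ x, ∀ i, I m → I (m.setVar y i)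

/-- `P` keeps the property `I`. -/
def Cmd.Preserves (n d : ℕ) (P : Cmd) (I : Store → Prop) : Prop := ∀ m, I m → I (P.run n d m)

lemma Cmd.Preserves.loop (hP : P.Preserves n d I) (hI : IgnoresFrom x I) {y : ℕ} (hy : x ≤ y) :
    (Cmd.loop y P).Preserves n d I := fun _ hm =>
  Cmd.run_loop_inv (fun _ => I) hm fun i _ m hm => hP _ (hI m y hy i hm)

/-- Run `P` for all values of the variables `x, …, x + k - 1`. -/
def nest (P : Cmd) (x : ℕ) : ℕ → Cmd
  | 0 => P
  | k + 1 => nest (.loop (x + k) P) x k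

lemma Cmd.Preserves.nest (hP : P.Preserves n d I) (hI : IgnoresFrom x I) :
    (nest P x k).Preserves n d I := by
  induction k generalizing P with
  | zero => exact hP
  | succ k ih => exact ih (hP.loop hI (Nat.le_add_right x k))

lemma nest_reaches (hP : P.Preserves n d I) (hPR : P.Preserves n d R) (hI : IgnoresFrom x I)
    (hR : IgnoresFrom x R) {f : Fin k → Fin n} (hvars : ∀ i < k, x + i ∉ P.vars)
    (hf : ∀ m, I m → (∀ i : Fin k, m.var (x + i) = f i) → R (P.run n d m)) {m : Store} (hm : I m) :
    R ((nest P x k).run n d m) := by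
  induction k generalizing P with
  | zero => exact hf m hm nofun
  | succ k ih =>
    have hxk : x ≤ x + k := Nat.le_add_right x k
    have hloop : ∀ i < k, x + i ∉ (Cmd.loop (x + k) P).vars := fun i hi => by
      rw [Cmd.vars, List.mem_cons, not_or]
      exact ⟨by omega, hvars i (by omega)⟩
    refine ih (f := fun i => f i.castSucc) (hP.loop hI hxk) (hPR.loop hR hxk) hloop
      fun m hm hvar => ?_
    refine (Cmd.run_loop_inv_of_frame (fun j m' => I m' ∧ (f (Fin.last k) < j → R m'))
      ⟨hm, nofun⟩ fun j _ m' hframe _ ⟨hI', hR'⟩ => ⟨hP _ (hI _ _ hxk _ hI'), fun hlt => ?_⟩).2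
      (f (Fin.last k)).2
    rcases (Nat.lt_succ_iff.1 hlt).eq_or_lt with heq | hlt
    · refine hf _ (hI _ _ hxk _ hI') fun i => ?_
      cases i using Fin.lastCases with
      | last => rw [Fin.val_last, setVar_var_self, heq]
      | cast i =>
        rw [Fin.val_castSucc, setVar_var_of_ne _ _ (by omega), hframe _ (hloop i i.2), hvar i]
    · exact hPR _ (hR _ _ hxk _ (hR' hlt))

/-- Unless the variable `x` is set, run `P` and set `x` if `c` holds. -/
def attempt (x : ℕ) (P : Cmd) (c : Tm) : Cmd :=
  .ite (.v x) .skip (.seq P (.ite c (.assign x (.lit 1)) .skip))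

lemma run_attempt_of_ne {c : Tm} {m : Store} (h : m.var x ≠ 0) :
    (attempt x P c).run n d m = m := by
  rw [attempt, Cmd.run, Tm.den, if_pos h, Cmd.run]

lemma run_attempt_of_eq {c : Tm} {m : Store} (h : m.var x = 0) :
    (attempt x P c).run n d m = if c.Holds n d (P.run n d m) then (P.run n d m).setVar x 1
      else P.run n d m := by
  rw [attempt, Cmd.run, Tm.den, if_neg (not_not.2 h)]
  rfl

/-- Run `attempt x P c` for all values of the variables `20, …, 20 + k - 1`, which `P` may read,
starting with the variable `x` not set. -/
def search (x : ℕ) (P : Cmd) (c : Tm) (k : ℕ) : Cmd :=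
  .seq (.assign x (.lit 0)) (nest (attempt x P c) 20 k)

variable {B Q : Store → Prop} {c : Tm}

lemma attempt_preserves (hB : IgnoresFrom 0 B) (hPB : P.Preserves n d B) :
    (attempt x P c).Preserves n d B := by
  intro m hm
  by_cases hx : m.var x = 0
  · rw [run_attempt_of_eq hx]
    split_ifs
    · exact hB _ x x.zero_le _ (hPB m hm)
    · exact hPB m hm
  · rwa [run_attempt_of_ne hx]

lemma attempt_preserves_and (hPx : x ∉ P.vars) (hB : IgnoresFrom 0 B) (hQ : IgnoresFrom 0 Q)
    (hPB : P.Preserves n d B) (hPQ : ∀ m, B m → c.Holds n d (P.run n d m) → Q (P.run n d m)) :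
    (attempt x P c).Preserves n d fun m => B m ∧ (m.var x ≠ 0 → Q m) := by
  refine fun m hm => ⟨attempt_preserves hB hPB m hm.1, ?_⟩
  by_cases hx : m.var x = 0
  · rw [run_attempt_of_eq hx]
    split_ifs with hc
    · exact fun _ => hQ _ x x.zero_le _ (hPQ m hm.1 hc)
    · rw [P.run_var m hPx]
      exact fun h => absurd hx h
  · rw [run_attempt_of_ne hx]
    exact hm.2

lemma search_spec (hx : x < 20) (hPx : x ∉ P.vars) (hB : IgnoresFrom 0 B)
    (hQ : IgnoresFrom 0 Q) (hPB : P.Preserves n d B)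
    (hPQ : ∀ m, B m → c.Holds n d (P.run n d m) → Q (P.run n d m)) {m : Store} (hm : B m) :
    B ((search x P c k).run n d m) ∧
      (((search x P c k).run n d m).var x ≠ 0 → Q ((search x P c k).run n d m)) :=
  (attempt_preserves_and hPx hB hQ hPB hPQ).nest
    (fun m y hy i hm => ⟨hB m y y.zero_le i hm.1, fun h =>
      hQ m y y.zero_le i (hm.2 (by rwa [setVar_var_of_ne _ _ (by omega)] at h))⟩)
    (m.setVar x 0) ⟨hB m x x.zero_le 0 hm, fun h => absurd (setVar_var_self m x 0) h⟩

lemma search_succeeds (hx : x < 20) (hvars : ∀ z ∈ P.vars, z < 20) (hB : IgnoresFrom 0 B)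
    (hPB : P.Preserves n d B) {f : Fin k → Fin n}
    (hf : ∀ m, B m → (∀ i : Fin k, m.var (20 + i) = f i) → c.Holds n d (P.run n d m)) {m : Store}
    (hm : B m) : ((search x P c k).run n d m).var x ≠ 0 := by
  have hflag : (attempt x P c).Preserves n d fun m => m.var x ≠ 0 := fun m hm => by
    rwa [run_attempt_of_ne hm]
  have hflag' : IgnoresFrom 20 fun m => m.var x ≠ 0 := fun m y hy i hm =>
    (setVar_var_of_ne m _ (by omega)).trans_ne hm
  refine nest_reaches (attempt_preserves hB hPB) hflag (fun m y _ => hB m y y.zero_le) hflag'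
    (f := f) (fun i _ hmem => ?_) (fun m hm hmf => ?_) (hB m x x.zero_le 0 hm)
  · have hmem' : 20 + i ∈ P.vars ∨ 20 + i = x := by simpa [attempt, Cmd.vars] using hmem
    rcases hmem' with hP | hx'
    · exact absurd (hvars _ hP) (by omega)
    · omega
  · by_cases h : m.var x = 0
    · rw [run_attempt_of_eq h, if_pos (hf m hm hmf), setVar_var_self]
      exact one_ne_zero
    · rwa [run_attempt_of_ne h]

end Search

/-! ### The algorithm -/

section Algorithm

variable {m : Store} {G : SimpleGraph (Fin n)}

/-- The array `0` is the adjacency matrix, and the array `3` is the distance matrix. -/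
def HasDistances (G : SimpleGraph (Fin n)) (d : ℕ) (m : Store) : Prop :=
  IsAdj m 0 G ∧ IsMatrix m 3 (cappedDist G (n + 3 * d))

lemma HasDistances.run (h : HasDistances G d m) {P : Cmd} (h0 : 0 ∉ P.arrs) (h3 : 3 ∉ P.arrs) :
    HasDistances G d (P.run n d m) :=
  ⟨h.1.congr (P.run_arr m h0), h.2.congr (P.run_arr m h3)⟩

lemma ignoresFrom_hasDistances (x : ℕ) : IgnoresFrom x (HasDistances G d) :=
  fun _ _ _ _ hm => hm

lemma IsSet.run {a : ℕ} {S : Set (Fin n)} (h : IsSet m a S) {P : Cmd} (ha : a ∉ P.arrs) :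
    IsSet (P.run n d m) a S :=
  h.congr (P.run_arr m ha)

/-- The variables `20, …, 20 + k - 1` hold the tuple `p`. -/
def HoldsTuple {k : ℕ} (m : Store) (p : Fin k → Fin n) : Prop := ∀ i : Fin k, m.var (20 + i) = p i

lemma HoldsTuple.run {k : ℕ} {p : Fin k → Fin n} (hp : HoldsTuple m p) {P : Cmd}
    (hP : ∀ z ∈ P.vars, z < 20) : HoldsTuple (P.run n d m) p := fun i => by
  rw [P.run_var m fun hi => absurd (hP _ hi) (by omega), hp]

/-- The vertex `v 0` is between the vertices `v x` and `v y` with respect to the distances `a`. -/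
def betweenTm (a x y : ℕ) : Tm :=
  .le (.add (.arr a (.v x) (.v 0)) (.arr a (.v 0) (.v y))) (.arr a (.v x) (.v y))

lemma holds_betweenTm {a k : ℕ} {D : Fin n → Fin n → ℕ} {p : Fin k → Fin n}
    (hD : IsMatrix m a D) (hp : HoldsTuple m p) (v : Fin n) (i j : Fin k) :
    (betweenTm a (20 + i) (20 + j)).Holds n d ((m.setVar 0 v).setVar 1 0) ↔
      v ∈ between D (p i) (p j) := by
  have hvar : ∀ l : Fin k, ((m.setVar 0 v).setVar 1 0).var (20 + l) = p l := fun l => by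
    rw [setVar_var_of_ne _ _ (by omega), setVar_var_of_ne _ _ (by omega), hp]
  have hzero : ((m.setVar 0 v).setVar 1 0).var 0 = v := rfl
  simp only [betweenTm, Tm.holds_le, Tm.den, hvar, hzero, setVar_arr, hD _ _]
  rfl

section Packing

variable {D D' : Fin n → Fin n → ℕ} {p : Fin 14 → Fin n}

/-- The vertex `v 0` is in `cycleSet` for the tuple of the variables `20, …, 33`. -/
def cycleTm : Tm :=
  .add (.add (.add (betweenTm 3 20 21) (betweenTm 3 21 22)) (betweenTm 3 22 23)) (betweenTm 3 23 20)

lemma isSet_table_cycleTm (hD : IsMatrix m 3 D) (hp : HoldsTuple m p) :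
    IsSet ((table 5 cycleTm).run n d m) 5 (cycleSet D p) := by
  refine isSet_table (by decide) (by decide) fun v => ?_
  have hpiece := holds_betweenTm (d := d) hD hp v
  simp only [cycleTm, Tm.holds_add, cycleSet, Set.mem_union]
  exact or_congr (or_congr (or_congr (hpiece 0 1) (hpiece 1 2)) (hpiece 2 3)) (hpiece 3 0)

/-- The vertices `v 0` and `v 1` of the set `10` are adjacent. -/
def restrictTm : Tm :=
  .and (.arr 0 (.v 0) (.v 1)) (.and (.arr 10 (.v 0) (.lit 0)) (.arr 10 (.v 1) (.lit 0)))

lemma isAdj_table_restrictTm {S : Set (Fin n)} (hG : IsAdj m 0 G) (hS : IsSet m 10 S) :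
    IsAdj ((table 11 restrictTm).run n d m) 11 (restrict G S) := by
  refine isAdj_table (by decide) (by decide) fun i j => ?_
  simp [restrictTm, Tm.holds_arr, Tm.den, setVar_var, hG _ _, hS _, restrict]

/-- Compute the distances in `awayFromCycle` for the tuple of the variables `20, …, 33` into the
array `4`. -/
def awayDistances : Cmd :=
  .seq (.seq (table 5 cycleTm) (outside 5 10 (.mul .dist 1)))
    (.seq (table 11 restrictTm) (distances 11 4))

lemma awayDistances_spec (h : HasDistances G d m) (hp : HoldsTuple m p) :
    IsMatrix (awayDistances.run n d m) 4
      (cappedDist (awayFromCycle G (n + 3 * d) d p) (n + 3 * d)) := by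
  have hcycle := isSet_table_cycleTm (d := d) h.2 hp
  have hout := outside_spec (b := 10) (k := 1) (by decide) (by decide) (by decide)
    (h.run (by decide) (by decide)).2 hcycle
  rw [one_mul] at hout
  have hG := h.run (P := .seq (table 5 cycleTm) (outside 5 10 (.mul .dist 1))) (by decide)
    (by decide)
  exact distances_spec (by decide) (by decide) (by decide) (isAdj_table_restrictTm hG.1 hout)

/-- The vertex `v 0` is in `chainSet` for the tuple of the variables `20, …, 33`. -/
def chainTm : Tm :=
  .add (.add (.add (betweenTm 4 24 25) (.add (.add (.add (betweenTm 3 25 28)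
    (betweenTm 3 28 29)) (betweenTm 3 29 30)) (betweenTm 3 30 27))) (betweenTm 4 27 26))
    (.add (.add (.add (betweenTm 3 26 31) (betweenTm 3 31 32)) (betweenTm 3 32 33))
      (betweenTm 3 33 24))

lemma isSet_table_chainTm (hD : IsMatrix m 3 D) (hD' : IsMatrix m 4 D') (hp : HoldsTuple m p) :
    IsSet ((table 5 chainTm).run n d m) 5 (chainSet D D' p) := by
  refine isSet_table (by decide) (by decide) fun v => ?_
  have hpiece := holds_betweenTm (d := d) hD hp v
  have hpiece' := holds_betweenTm (d := d) hD' hp v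
  simp only [chainTm, Tm.holds_add, chainSet, Set.mem_union]
  exact or_congr (or_congr (or_congr (hpiece' 4 5) (or_congr (or_congr (or_congr (hpiece 5 8)
    (hpiece 8 9)) (hpiece 9 10)) (hpiece 10 7))) (hpiece' 7 6)) (or_congr (or_congr (or_congr
    (hpiece 6 11) (hpiece 11 12)) (hpiece 12 13)) (hpiece 13 4))

/-- Compute `chainSet` for the tuple of the variables `20, …, 33` into the array `5`. -/
def chain : Cmd := .seq awayDistances (table 5 chainTm)

lemma chain_spec (h : HasDistances G d m) (hp : HoldsTuple m p) :
    IsSet (chain.run n d m) 5 (chainSet (cappedDist G (n + 3 * d))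
      (cappedDist (awayFromCycle G (n + 3 * d) d p) (n + 3 * d)) p) :=
  isSet_table_chainTm (h.run (by decide) (by decide)).2 (awayDistances_spec h hp)
    (hp.run (by decide))

/-- Compute `maxCore` for the set `chainSet` and for the complement of the ball of radius `d`
around it into the arrays `6` and `7`. -/
def packing : Cmd :=
  .seq (.seq chain (core 5 6)) (.seq (outside 5 10 (.mul .dist 1)) (core 10 7))

lemma packing_spec {S : Set (Fin n)} (h : HasDistances G d m) (hS : IsSet (chain.run n d m) 5 S) :
    IsSet (packing.run n d m) 6 (maxCore G S) ∧
      IsSet (packing.run n d m) 7 (maxCore G (ball G S d)ᶜ) := by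
  have hcore := core_spec (d := d) (b := 6) (by decide) (by decide) (by decide)
    (h.run (P := chain) (by decide) (by decide)).1 hS
  have h' := h.run (P := .seq chain (core 5 6)) (by decide) (by decide)
  have hout := outside_spec (b := 10) (k := 1) (by decide) (by decide) (by decide) h'.2
    (hS.run (P := core 5 6) (by decide))
  rw [one_mul] at hout
  exact ⟨hcore.run (P := .seq (outside 5 10 (.mul .dist 1)) (core 10 7)) (by decide),
    core_spec (by decide) (by decide) (by decide) (h'.run (by decide) (by decide)).1 hout⟩

/-- Search for a packing; the variable `10` tells whether it is found. -/
def searchPacking : Cmd := search 10 packing (.and (nonempty 6) (nonempty 7)) 14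

/-- The arrays `6` and `7` hold cores that are far from each other. -/
def HoldsPacking (G : SimpleGraph (Fin n)) (d : ℕ) (m : Store) : Prop :=
  ∃ S K L : Set (Fin n), IsSet m 6 K ∧ IsSet m 7 L ∧ IsCore G K ∧ IsCore G L ∧ K ⊆ S ∧
    L ⊆ (ball G S d)ᶜ

lemma hasDistances_packing : packing.Preserves n d (HasDistances G d) :=
  fun _ hm => hm.run (by decide) (by decide)

lemma searchPacking_spec (h : HasDistances G d m) :
    HasDistances G d (searchPacking.run n d m) ∧
      ((searchPacking.run n d m).var 10 ≠ 0 → HoldsPacking G d (searchPacking.run n d m)) := by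
  refine search_spec (by decide) (by decide) (ignoresFrom_hasDistances 0)
    (fun _ _ _ _ hm => hm) hasDistances_packing (fun m hm hc => ?_) h
  obtain ⟨h6, h7⟩ := packing_spec (S := {v | (chain.run n d m).arr 5 v 0 ≠ 0}) hm fun _ => Iff.rfl
  rw [Tm.holds_and, holds_nonempty h6, holds_nonempty h7] at hc
  exact ⟨_, _, _, h6, h7, isCore_maxCore hc.1, isCore_maxCore hc.2, maxCore_subset G _,
    maxCore_subset G _⟩

lemma searchPacking_succeeds (h : HasDistances G d m) (hp : IsPackingTuple G (n + 3 * d) d p) :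
    (searchPacking.run n d m).var 10 ≠ 0 := by
  refine search_succeeds (f := p) (by decide) (by decide) (ignoresFrom_hasDistances 0)
    hasDistances_packing (fun m hm hvar => ?_) h
  obtain ⟨h6, h7⟩ := packing_spec hm (chain_spec hm hvar)
  rw [Tm.holds_and, holds_nonempty h6, holds_nonempty h7]
  exact ⟨not_isAcyclic_iff_maxCore_nonempty.1 hp.1, not_isAcyclic_iff_maxCore_nonempty.1 hp.2⟩

end Packing

section Hitting

variable {a k s x l : ℕ} {t r : Tm} {X : Set (Fin n)}

/-- Compute a set into the array `a`, and `maxCore` for the complement of the ball of radius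
`k * d` around it into the array `7`. -/
def hitting (a k : ℕ) (t : Tm) : Cmd :=
  .seq (table a t) (.seq (outside a 10 (.mul .dist k)) (core 10 7))

/-- The set `a` has at most `r` elements. -/
def atMost (a : ℕ) (r : Tm) : Tm :=
  .le (.sum 2 (.ite (.arr a (.v 2) (.lit 0)) (.lit 1) (.lit 0))) r

lemma holds_atMost (hX : IsSet m a X) : (atMost a r).Holds n d m ↔ X.ncard ≤ r.den n d m := by
  rw [atMost, Tm.holds_le, Tm.den_sum_ite (S := X)]
  exact fun i => by simpa [Tm.holds_arr, Tm.den] using hX i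

lemma hitting_spec (ha : a ∉ [0, 3, 7, 9, 10]) (hk : k ≤ 3) (ht : 9 ∉ t.arrs)
    (hr : ∀ m, r.den n d m = s) (h : HasDistances G d m)
    (hX : ∀ v : Fin n, t.Holds n d ((m.setVar 0 v).setVar 1 0) ↔ v ∈ X) :
    IsSet ((hitting a k t).run n d m) a X ∧
      ((Tm.and (.not (nonempty 7)) (atMost a r)).Holds n d ((hitting a k t).run n d m) ↔
        X.ncard ≤ s ∧ (restrict G (ball G X (k * d))ᶜ).IsAcyclic) := by
  simp only [List.mem_cons, List.not_mem_nil, or_false, not_or] at ha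
  obtain ⟨ha0, ha3, ha7, ha9, ha10⟩ := ha
  have hset := isSet_table (d := d) ha9 ht hX
  have hdist := h.run (P := table a t) (by simp [Ne.symm ha0]) (by simp [Ne.symm ha3])
  have hout := outside_spec (b := 10) ha9 (by decide) hk hdist.2 hset
  have hcore := core_spec (d := d) (a := 10) (b := 7) (by decide) (by decide) (by decide)
    (hdist.run (P := outside a 10 (.mul .dist k)) (by simp [outside]) (by simp [outside])).1 hout
  have hX' : IsSet ((hitting a k t).run n d m) a X :=
    hset.run (P := .seq (outside a 10 (.mul .dist k)) (core 10 7))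
      (by simp [Cmd.arrs, outside, core, ha7, ha9, ha10])
  refine ⟨hX', ?_⟩
  rw [Tm.holds_and, Tm.holds_not, holds_atMost hX', hr, and_comm]
  exact and_congr_right fun _ =>
    (not_congr (holds_nonempty hcore)).trans (by rw [← not_isAcyclic_iff_maxCore_nonempty, not_not])

/-- The array `a` holds a set of at most `s` vertices that hits all cycles. -/
def HoldsHitting (G : SimpleGraph (Fin n)) (d a k s : ℕ) (m : Store) : Prop :=
  ∃ X : Set (Fin n), IsSet m a X ∧ X.ncard ≤ s ∧ (restrict G (ball G X (k * d))ᶜ).IsAcyclic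

lemma holdsHitting_of_isEmpty [IsEmpty (Fin n)] : HoldsHitting G d a k s m :=
  ⟨∅, isEmptyElim, by simp, isEmptyElim⟩

lemma HoldsHitting.run (h : HoldsHitting G d a k s m) {P : Cmd} (ha : a ∉ P.arrs) :
    HoldsHitting G d a k s (P.run n d m) :=
  h.imp fun _ hX => ⟨hX.1.run ha, hX.2⟩

/-- Search for a tuple of length `l` for which the set described by `t` has at most `r` elements
and hits all cycles; the variable `x` tells whether it is found. -/
def searchHitting (x a k : ℕ) (t r : Tm) (l : ℕ) : Cmd :=
  search x (hitting a k t) (.and (.not (nonempty 7)) (atMost a r)) l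

lemma vars_hitting : (hitting a k t).vars = [0, 1, 0, 1, 0, 1, 0, 1, 0, 1, 0, 1, 4, 0, 1, 0, 1] :=
  rfl

lemma hasDistances_hitting (ha0 : a ≠ 0) (ha3 : a ≠ 3) :
    (hitting a k t).Preserves n d (HasDistances G d) := fun _ hm =>
  hm.run (by simp [hitting, outside, core, Cmd.arrs, ha0.symm])
    (by simp [hitting, outside, core, Cmd.arrs, ha3.symm])

lemma searchHitting_spec (hx : x ∈ Set.Ioo 4 20) (ha : a ∉ [0, 3, 7, 9, 10]) (hk : k ≤ 3)
    (ht : 9 ∉ t.arrs) (hr : ∀ m, r.den n d m = s) (h : HasDistances G d m) :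
    HasDistances G d ((searchHitting x a k t r l).run n d m) ∧
      (((searchHitting x a k t r l).run n d m).var x ≠ 0 →
        HoldsHitting G d a k s ((searchHitting x a k t r l).run n d m)) := by
  have hx4 := hx.1
  refine search_spec hx.2 (by simp [vars_hitting]; omega) (ignoresFrom_hasDistances 0)
    (fun _ _ _ _ hm => hm) (hasDistances_hitting (by grind) (by grind)) (fun m hm hc => ?_) h
  obtain ⟨hX, hhits⟩ := hitting_spec ha hk ht hr hm fun _ => Iff.rfl
  exact ⟨_, hX, hhits.1 hc⟩

lemma searchHitting_succeeds (hx : x < 20) (ha : a ∉ [0, 3, 7, 9, 10]) (hk : k ≤ 3)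
    (ht : 9 ∉ t.arrs) (hr : ∀ m, r.den n d m = s) (h : HasDistances G d m) {f : Fin l → Fin n}
    (hX : ∀ m, HasDistances G d m → HoldsTuple m f →
      ∀ v : Fin n, t.Holds n d ((m.setVar 0 v).setVar 1 0) ↔ v ∈ X)
    (hcard : X.ncard ≤ s) (hhits : (restrict G (ball G X (k * d))ᶜ).IsAcyclic) :
    ((searchHitting x a k t r l).run n d m).var x ≠ 0 :=
  search_succeeds hx (by simp [vars_hitting]) (ignoresFrom_hasDistances 0)
    (hasDistances_hitting (by grind) (by grind))
    (fun m hm hvar => (hitting_spec ha hk ht hr hm (hX m hm hvar)).2.2 ⟨hcard, hhits⟩) h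

/-- The vertex `v 0` is on one of the geodesics between the vertices of the variables
`20, …, 31` and `32, …, 43`. -/
def geodesicsTm : Tm := .any (fun i => betweenTm 3 (20 + i) (20 + (12 + i))) 12

lemma holds_geodesicsTm (h : HasDistances G d m) {p q : Fin 12 → Fin n}
    (hpq : HoldsTuple m (Fin.append p q)) (v : Fin n) :
    geodesicsTm.Holds n d ((m.setVar 0 v).setVar 1 0) ↔
      v ∈ ⋃ i, between (cappedDist G (n + 3 * d)) (p i) (q i) := by
  rw [geodesicsTm, Tm.holds_any, Set.mem_iUnion]
  refine exists_congr fun i => ?_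
  rw [← Fin.append_left p q i, ← Fin.append_right p q i]
  exact holds_betweenTm h.2 hpq v (Fin.castAdd 12 i) (Fin.natAdd 12 i)

/-- The vertex `v 0` is one of the vertices of the variables `20, …, 31`. -/
def pointsTm : Tm := .any (fun i => .eq (.v 0) (.v (20 + i))) 12

lemma holds_pointsTm {p : Fin 12 → Fin n} (hp : HoldsTuple m p) (v : Fin n) :
    pointsTm.Holds n d ((m.setVar 0 v).setVar 1 0) ↔ v ∈ Set.range p := by
  rw [pointsTm, Tm.holds_any]
  refine exists_congr fun i => ?_
  rw [Tm.holds_eq, Tm.den, Tm.den, setVar_var_of_ne _ _ (by omega : 20 + (i : ℕ) ≠ 1),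
    setVar_var_of_ne _ _ (by omega : 20 + (i : ℕ) ≠ 0), hp i, Fin.ext_iff, eq_comm]
  rfl

/-- Search for a union of 12 geodesics and for 12 vertices. -/
def searchSets : Cmd :=
  .seq (searchHitting 11 1 2 geodesicsTm (.mul (.add .dist (.lit 1)) 12) 24)
    (searchHitting 12 2 3 pointsTm (.lit 12) 12)

lemma searchSets_spec (h : HasDistances G d m) (htuples : HasHittingTuples G (n + 3 * d) d) :
    HoldsHitting G d 1 2 (12 * (d + 1)) (searchSets.run n d m) ∧
      HoldsHitting G d 2 3 12 (searchSets.run n d m) := by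
  obtain ⟨⟨p, q, hcard, hhits⟩, c, hc⟩ := htuples
  have hr : ∀ m, (Tm.mul (.add .dist (.lit 1)) 12).den n d m = 12 * (d + 1) := fun _ => Tm.den_mul
  obtain ⟨h', hgeodesics⟩ := searchHitting_spec (x := 11) (a := 1) (k := 2) (l := 24)
    (t := geodesicsTm) (by decide) (by decide) (by decide) (by decide) hr h
  have hfound := searchHitting_succeeds (x := 11) (a := 1) (k := 2) (by decide) (by decide)
    (by decide) (by decide) hr h (fun _ hm hpq => holds_geodesicsTm hm hpq) hcard hhits
  obtain ⟨-, hpoints⟩ := searchHitting_spec (x := 12) (a := 2) (k := 3) (l := 12) (t := pointsTm)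
    (r := .lit 12) (by decide) (by decide) (by decide) (by decide) (fun _ => rfl) h'
  have hcard' : (Set.range c).ncard ≤ 12 := by
    rw [← Set.image_univ]
    exact (Set.ncard_image_le Set.finite_univ).trans (by simp)
  have hfound' := searchHitting_succeeds (x := 12) (a := 2) (k := 3) (r := .lit 12) (by decide)
    (by decide) (by decide) (by decide) (fun _ => rfl) h' (fun _ _ hp => holds_pointsTm hp)
    hcard' hc
  exact ⟨(hgeodesics hfound).run (by decide), hpoints hfound'⟩

end Hitting

/-- Try to find a packing and extract its cycles; otherwise find hitting sets. -/
def algorithm : Cmd :=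
  .seq (.seq (distances 0 3) searchPacking)
    (.ite (.v 10) (.seq (extract 6 1 13) (extract 7 2 14)) searchSets)

/-- The answer as `algorithm` leaves it, with the lengths of the lists in the variables `13`
and `14`. -/
def HoldsAnswer (m : Store) : Answer n → Prop
  | .cycles l₁ l₂ => m.var 10 ≠ 0 ∧ m.HoldsList 1 (m.var 13) l₁ ∧ m.HoldsList 2 (m.var 14) l₂
  | .sets X₁ X₂ => m.var 10 = 0 ∧ m.HoldsSet 1 X₁ ∧ m.HoldsSet 2 X₂

lemma isCorrect_cycles {S : Set (Fin n)} {u v : Fin n} {c₁ : G.Walk u u} {c₂ : G.Walk v v}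
    (h₁ : c₁.IsCycle) (h₂ : c₂.IsCycle) (hS₁ : ∀ y ∈ c₁.support, y ∈ S)
    (hS₂ : ∀ y ∈ c₂.support, y ∈ (ball G S d)ᶜ) :
    IsCorrect G d (.cycles c₁.support c₂.support) := by
  have hne : c₁.toSubgraph ≠ c₂.toSubgraph := by
    intro h
    have hu : u ∈ c₂.toSubgraph.verts := h ▸ c₁.start_mem_verts_toSubgraph
    exact hS₂ u ((c₂.mem_verts_toSubgraph).mp hu) (subset_ball S d (hS₁ u c₁.start_mem_support))
  refine ⟨u, v, c₁, c₂, h₁, h₂, rfl, rfl, hne, ?_, ?_⟩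
  · rintro C (rfl | rfl)
    exacts [⟨_, _, h₁, rfl⟩, ⟨_, _, h₂, rfl⟩]
  · rintro C (rfl | rfl) D (rfl | rfl) hCD ⟨x, hx, y, hy, q, -, hq⟩
    · exact hCD rfl
    · rw [Walk.mem_verts_toSubgraph] at hx hy
      exact hS₂ y hy (mem_ball_iff.mpr ⟨x, hS₁ x hx, q.reverse, by rwa [Walk.length_reverse]⟩)
    · rw [Walk.mem_verts_toSubgraph] at hx hy
      exact hS₂ x hx (mem_ball_iff.mpr ⟨y, hS₁ y hy, q, hq⟩)
    · exact hCD rfl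

lemma exists_answer_of_holdsPacking (h : HasDistances G d m) (h10 : m.var 10 ≠ 0)
    (hpack : HoldsPacking G d m) :
    ∃ A : Answer n,
      HoldsAnswer ((extract 7 2 14).run n d ((extract 6 1 13).run n d m)) A ∧ IsCorrect G d A := by
  obtain ⟨S, K, L, hK, hL, hcoreK, hcoreL, hKS, hLS⟩ := hpack
  obtain ⟨u, c₁, hc₁, hsub₁, hlist₁⟩ := extract_spec (d := d) (b := 1) (x := 13) (by decide)
    (by decide) h.1 hK hcoreK
  obtain ⟨v, c₂, hc₂, hsub₂, hlist₂⟩ := extract_spec (d := d) (b := 2) (x := 14) (by decide)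
    (by decide) (h.run (P := extract 6 1 13) (by decide) (by decide)).1
    (hL.run (P := extract 6 1 13) (by decide)) hcoreL
  refine ⟨.cycles c₁.support c₂.support, ⟨?_, ?_, hlist₂⟩, isCorrect_cycles hc₁ hc₂
    (fun y hy => hKS (hsub₁ y hy)) fun y hy => hLS (hsub₂ y hy)⟩
  · rwa [Cmd.run_var _ _ (by decide), Cmd.run_var _ _ (by decide)]
  · unfold Store.HoldsList at hlist₁ ⊢
    rwa [Cmd.run_var _ _ (by decide : 13 ∉ (extract 7 2 14).vars),
      Cmd.run_arr _ _ (by decide : 1 ∉ (extract 7 2 14).arrs)]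

lemma exists_answer_of_holdsHitting (h10 : m.var 10 = 0)
    (h₁ : HoldsHitting G d 1 2 (12 * (d + 1)) m) (h₂ : HoldsHitting G d 2 3 12 m) :
    ∃ A : Answer n, HoldsAnswer m A ∧ IsCorrect G d A := by
  classical
  obtain ⟨X₁, hX₁, hcard₁, hhits₁⟩ := h₁
  obtain ⟨X₂, hX₂, hcard₂, hhits₂⟩ := h₂
  refine ⟨.sets X₁.toFinset X₂.toFinset, ⟨h10, fun v => ?_, fun v => ?_⟩, ?_, ?_, ?_, ?_⟩
  · rw [Set.mem_toFinset, hX₁ v]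
  · rw [Set.mem_toFinset, hX₂ v]
  · rwa [← Set.ncard_eq_toFinset_card']
  · rwa [← Set.ncard_eq_toFinset_card']
  · rw [Set.coe_toFinset]
    exact isAcyclic_induce_iff.mpr hhits₁
  · rw [Set.coe_toFinset]
    exact isAcyclic_induce_iff.mpr hhits₂

theorem algorithm_spec (hd : 1 ≤ d) (hG : IsAdj m 0 G) :
    ∃ A : Answer n, HoldsAnswer (algorithm.run n d m) A ∧ IsCorrect G d A := by
  have hdist : HasDistances G d ((distances 0 3).run n d m) :=
    ⟨hG.congr (Cmd.run_arr _ _ (by decide)), distances_spec (by decide) (by decide) (by decide) hG⟩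
  obtain ⟨hdist', hpack⟩ := searchPacking_spec hdist
  have hfound := fun p => searchPacking_succeeds (p := p) hdist
  rw [algorithm, Cmd.run, Cmd.run, Cmd.run, Tm.den]
  generalize searchPacking.run n d ((distances 0 3).run n d m) = m' at hdist' hpack hfound ⊢
  split_ifs with h10
  · exact exists_answer_of_holdsPacking hdist' h10 (hpack h10)
  obtain ⟨hgeodesics, hpoints⟩ : HoldsHitting G d 1 2 (12 * (d + 1)) (searchSets.run n d m') ∧
      HoldsHitting G d 2 3 12 (searchSets.run n d m') := by
    rcases isEmpty_or_nonempty (Fin n) with hempty | hnonempty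
    · exact ⟨holdsHitting_of_isEmpty, holdsHitting_of_isEmpty⟩
    rcases hasHittingTuples_or_isPackingTuple (G := G) (M := n + 3 * d) hd (by simp)
      with h | ⟨p, hp⟩
    · exact searchSets_spec hdist' h
    · exact absurd (hfound p hp) h10
  exact exists_answer_of_holdsHitting
    ((Cmd.run_var _ _ (by decide)).trans (not_not.1 h10)) hgeodesics hpoints

end Algorithm

section Output

variable {m : Store} {G : SimpleGraph (Fin n)}

/-- Move the answer from the variables of `algorithm` to the registers where it is expected. -/
def output : Prog :=
  .seq (.setVar 1 (.var (varReg 13))) (.seq (.setVar 2 (.var (varReg 14)))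
    (.setVar 0 (.sub (.lit 1) (.var (varReg 10)))))

lemma exists_runs_output {A : Answer n} (hA : HoldsAnswer m A) (r : ℕ → ℕ) :
    ∃ τ : Store, Runs output (machine n d m r) τ 8 ∧ τ.Outputs A := by
  refine ⟨_, .seq (.setVar _ _ _) (.seq (.setVar _ _ _) (.setVar _ _ _)), ?_⟩
  have hreg : varReg 14 ≠ 1 ∧ varReg 10 ≠ 1 ∧ varReg 10 ≠ 2 := by decide
  cases A with
  | cycles l₁ l₂ =>
    obtain ⟨hfound, hlists⟩ := hA
    have h1 : 1 - m.var 10 = 0 := by omega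
    simpa [Store.Outputs, Expr.eval, setVar_var, Store.HoldsList, hreg, h1] using hlists
  | sets X₁ X₂ =>
    obtain ⟨hfound, hsets⟩ := hA
    simpa [Store.Outputs, Expr.eval, setVar_var, Store.HoldsSet, hreg, hfound] using hsets

lemma inputStore_eq_machine :
    inputStore G d = machine n d ⟨fun _ => 0, (inputStore G d).arr⟩ fun _ => 0 := by
  ext x
  · rcases x with - | - | x <;> simp [inputStore, machine]
  · rfl

lemma isAdj_inputStore (var : ℕ → ℕ) : IsAdj ⟨var, (inputStore G d).arr⟩ 0 G := fun i j => by
  simp [inputStore]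

end Output

end CyclePacking

/-- One program and one polynomial work for all `d` and all finite graphs; the number of steps is
bounded by a polynomial in the number of vertices alone. -/
theorem theorem1p6 :
    ∃ (P : CyclePacking.Prog) (p : Polynomial ℕ),
      ∀ (d : ℕ), 1 ≤ d → ∀ (n : ℕ) (G : SimpleGraph (Fin n)),
        ∃ (τ : CyclePacking.Store) (t : ℕ) (A : CyclePacking.Answer n),
          CyclePacking.Runs P (CyclePacking.inputStore G d) τ t ∧
          t ≤ p.eval n ∧
          τ.Outputs A ∧
          CyclePacking.IsCorrect G d A := by
  obtain ⟨P, p, hP⟩ := CyclePacking.algorithm.isExecutable 0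
  refine ⟨.seq P CyclePacking.output, p + .C 8, fun d hd n G => ?_⟩
  obtain ⟨A, hanswer, hcorrect⟩ :=
    CyclePacking.algorithm_spec hd (CyclePacking.isAdj_inputStore (G := G) (d := d) fun _ => 0)
  obtain ⟨r, c, hrun, hc, -⟩ := hP n d ⟨fun _ => 0, (CyclePacking.inputStore G d).arr⟩ fun _ => 0
  obtain ⟨τ, hrun', hout⟩ := CyclePacking.exists_runs_output (d := d) hanswer r
  rw [CyclePacking.inputStore_eq_machine]
  refine ⟨τ, _, A, .seq hrun hrun', ?_, hout, hcorrect⟩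
  rw [Polynomial.eval_add, Polynomial.eval_C]
  exact Nat.add_le_add_right hc 8
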